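/- Let $p$ be a prime, let $d\ge 0$, let $\Gamma$ be a (multiplicatively written) topological group isomorphic to $\mathbb{Z}_p^d$, and let $\Lambda_\Gamma=\mathbb{Z}_p[[\Gamma]]=\varprojlim_U \mathbb{Z}_p[\Gamma/U]$ be its Iwasawa algebra ($U$ running over the open subgroups of $\Gamma$). For $\sigma\in\Gamma$ and $m\ge n\ge 0$ put $\omega_{\sigma,n}=\sigma^{p^n}-1\in\Lambda_\Gamma$ and $$\nu_{\sigma,n,m}=\sum_{i=0}^{p^{m-n}-1}\sigma^{ip^n}\in\Lambda_\Gamma ,$$ so that $\nu_{\sigma,n,m}=\omega_{\sigma,m}/\omega_{\sigma,n}$ for $\sigma\neq 1$. Let $\sigma_1,\dots,\sigma_d$ be any $\mathbb{Z}_p$-basis of $\Gamma$ and put $\nu_{n,m}=\prod_{i=1}^d\nu_{\sigma_i,n,m}$. Let $\tau_1,\dots,\tau_c$ be any tight set of $\mathbb{Z}_p$-generators of $\Gamma$, that is, the $\tau_i$ generate $\Gamma$ topologically, no $\tau_i$ is a $p$-th power in $\Gamma$, and the closed subgroups $\overline{\langle\tau_i\rangle}$ and $\overline{\langle\tau_j\rangle}$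 are distinct for $i\ne j$. For $n\ge 0$ let $J_n\subset\Lambda_\Gamma$ be the ideal generated by $\nu_{\tau_1,0,n},\dots,\nu_{\tau_c,0,n}$; then $J_m\subset J_n$ for $m\ge n$. Then $\nu_{n,m}J_n\subset J_m$ for all $m\ge n\ge 0$, so that for every $\Lambda_\Gamma$-module $Y$ multiplication by $\nu_{n,m}$ induces a norm map $\nu_{n,m}\colon Y/J_nY\to Y/J_mY$. Define $$\ddot Y_{(n)}=\bigcup_{m\ge n}\ker\bigl(\nu_{n,m}\colon Y/J_nY\to Y/J_mY\bigr),\qquad \ddot Y=\varprojlim_n \ddot Y_{(n)},$$ the limit being taken over the natural projections $Y/J_mY\to Y/J_nY$ for $m\ge n$. If $Y$ is a finitely generated $\Lambda_\Gamma$-module, then $\ddot Y$ is pseudo-null: it is a finitely generated $\Lambda_\Gamma$-module whose localization at every prime ideal of $\Lambda_\Gamma$ of height at most $1$ is zero. -/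

import Mathlib

noncomputable section

namespace IwasawaTower

/-! ### The Iwasawa algebra `ℤ_p[[Γ]]` -/

section Algebra

variable (p : ℕ) [Fact p.Prime] (Γ : Type*) [CommGroup Γ] [TopologicalSpace Γ]

variable {Γ} in
/-- The projection `ℤ_p[Γ/U] → ℤ_p[Γ/V]` for open subgroups `U ≤ V` of `Γ`. -/
def transition {U V : OpenSubgroup Γ} (h : U ≤ V) :
    MonoidAlgebra ℤ_[p] (Γ ⧸ U.toSubgroup) →ₐ[ℤ_[p]]
      MonoidAlgebra ℤ_[p] (Γ ⧸ V.toSubgroup) :=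
  MonoidAlgebra.mapDomainAlgHom ℤ_[p] ℤ_[p]
    (QuotientGroup.map U.toSubgroup V.toSubgroup (MonoidHom.id Γ) fun _ hg => h hg)

/-- The inverse limit of the group rings `ℤ_p[Γ/U]`, `U` running through the open subgroups
of `Γ`, as a subalgebra of their product. -/
def completedGroupAlgebra :
    Subalgebra ℤ_[p] (∀ U : OpenSubgroup Γ, MonoidAlgebra ℤ_[p] (Γ ⧸ U.toSubgroup)) where
  carrier := {x | ∀ (U V : OpenSubgroup Γ) (h : U ≤ V), transition p h (x U) = x V}
  mul_mem' {x y} hx hy U V h := by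
    rw [Pi.mul_apply, Pi.mul_apply, map_mul, hx U V h, hy U V h]
  add_mem' {x y} hx hy U V h := by
    rw [Pi.add_apply, Pi.add_apply, map_add, hx U V h, hy U V h]
  algebraMap_mem' r U V h := (transition p h).commutes r

/-- The Iwasawa algebra `Λ_Γ = ℤ_p[[Γ]]`. -/
def Lam : Type _ := completedGroupAlgebra p Γ

instance : CommRing (Lam p Γ) := inferInstanceAs (CommRing (completedGroupAlgebra p Γ))

instance : Algebra ℤ_[p] (Lam p Γ) :=
  inferInstanceAs (Algebra ℤ_[p] (completedGroupAlgebra p Γ))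

variable {Γ}

/-- The canonical map `Γ → Λ_Γ`. -/
def of : Γ →* Lam p Γ where
  toFun g := ⟨fun U => MonoidAlgebra.of ℤ_[p] (Γ ⧸ U.toSubgroup) (QuotientGroup.mk g), by
    intro U V h
    exact MonoidAlgebra.mapDomain_single⟩
  map_one' := by
    apply Subtype.ext
    funext U
    exact map_one (MonoidAlgebra.of ℤ_[p] (Γ ⧸ U.toSubgroup))
  map_mul' a b := by
    apply Subtype.ext
    funext U
    exact map_mul (MonoidAlgebra.of ℤ_[p] (Γ ⧸ U.toSubgroup)) (QuotientGroup.mk a)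
      (QuotientGroup.mk b)

/-- `ω_{σ,n} = σ^{p^n} - 1`. -/
def omega (σ : Γ) (n : ℕ) : Lam p Γ := of p (σ ^ p ^ n) - 1

/-- `ν_{σ,n,m} = ω_{σ,m} / ω_{σ,n}` for `m ≥ n ≥ 0`, that is
`1 + σ^{p^n} + σ^{2 p^n} + ⋯ + σ^{(p^{m-n} - 1) p^n}`; see `nu_mul_omega`. -/
def nu (σ : Γ) (n m : ℕ) : Lam p Γ :=
  ∑ i ∈ Finset.range (p ^ (m - n)), of p (σ ^ p ^ n) ^ i

theorem nu_mul_omega (σ : Γ) {n m : ℕ} (h : n ≤ m) :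
    nu p σ n m * omega p σ n = omega p σ m := by
  rw [nu, omega, omega, geom_sum_mul, ← map_pow, ← pow_mul, ← pow_add, Nat.add_sub_cancel' h]

theorem nu_mul_nu (σ : Γ) {n m l : ℕ} (h : n ≤ m) (h' : m ≤ l) :
    nu p σ n m * nu p σ m l = nu p σ n l := by
  have key : ∀ (x : Lam p Γ) (a b : ℕ),
      (∑ i ∈ Finset.range a, x ^ i) * (∑ j ∈ Finset.range b, (x ^ a) ^ j) =
        ∑ i ∈ Finset.range (a * b), x ^ i := by
    intro x a b
    induction b with
    | zero => simp
    | succ b ih =>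
      rw [Finset.sum_range_succ, mul_add, ih, Nat.mul_succ, Finset.sum_range_add,
        Finset.sum_mul]
      congr 1
      refine Finset.sum_congr rfl fun i _ => ?_
      rw [← pow_mul, pow_add, mul_comm]
  have e : of p (σ ^ p ^ m) = of p (σ ^ p ^ n) ^ p ^ (m - n) := by
    rw [← map_pow, ← pow_mul, ← pow_add, Nat.add_sub_cancel' h]
  rw [nu, nu, nu, e, key, ← pow_add]
  congr 3
  omega

end Algebra

/-! ### Bases and tight generating sets of `Γ ≅ ℤ_p^d` -/

section Groups

variable (p : ℕ) [Fact p.Prime] {Γ : Type*} [CommGroup Γ] [TopologicalSpace Γ]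

/-- `σ_1, …, σ_d` is a `ℤ_p`-basis of `Γ`: the standard basis of `ℤ_p^d` is carried to it by
an isomorphism of topological groups. -/
def IsZpBasis {d : ℕ} (σ : Fin d → Γ) : Prop :=
  ∃ e : Multiplicative (Fin d → ℤ_[p]) ≃ₜ* Γ,
    ∀ i, e (Multiplicative.ofAdd (Pi.single i (1 : ℤ_[p]))) = σ i

/-- `τ_1, …, τ_c` is a tight set of `ℤ_p`-generators of `Γ`: the subgroup generated by the `τ_i`
is dense in `Γ`, no `τ_i` is a `p`-th power in `Γ`, and the closures of the cyclic groups
generated by the `τ_i` are pairwise distinct. -/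
structure IsTight {c : ℕ} (τ : Fin c → Γ) : Prop where
  generates : closure (Subgroup.closure (Set.range τ) : Set Γ) = Set.univ
  not_mem : ∀ i, τ i ∉ (powMonoidHom p : Γ →* Γ).range
  distinct : ∀ i j, i ≠ j →
    closure (Subgroup.zpowers (τ i) : Set Γ) ≠ closure (Subgroup.zpowers (τ j) : Set Γ)

/-- `ν_{n,m} = ∏_i ν_{σ_i,n,m}`. -/
def normElt {d : ℕ} (σ : Fin d → Γ) (n m : ℕ) : Lam p Γ := ∏ i, nu p (σ i) n m

/-- The ideal `J_n` generated by `ν_{τ_1,0,n}, …, ν_{τ_c,0,n}`. -/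
def J {c : ℕ} (τ : Fin c → Γ) (n : ℕ) : Ideal (Lam p Γ) :=
  Ideal.span (Set.range fun i => nu p (τ i) 0 n)

theorem normElt_mul {d : ℕ} (σ : Fin d → Γ) {n m l : ℕ} (h : n ≤ m) (h' : m ≤ l) :
    normElt p σ n m * normElt p σ m l = normElt p σ n l := by
  rw [normElt, normElt, normElt, ← Finset.prod_mul_distrib]
  exact Finset.prod_congr rfl fun i _ => nu_mul_nu p (σ i) h h'

theorem J_anti {c : ℕ} (τ : Fin c → Γ) {n m : ℕ} (h : n ≤ m) : J p τ m ≤ J p τ n := by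
  rw [J, Ideal.span_le]
  rintro _ ⟨i, rfl⟩
  show nu p (τ i) 0 m ∈ J p τ n
  rw [← nu_mul_nu p (τ i) (Nat.zero_le n) h]
  exact Ideal.mul_mem_right _ _ (Ideal.subset_span ⟨i, rfl⟩)

end Groups

/-! ### The norm maps and the module `Ÿ` -/

section Modules

variable (p : ℕ) [Fact p.Prime] {Γ : Type*} [CommGroup Γ] [TopologicalSpace Γ]
variable {d c : ℕ} (σ : Fin d → Γ) (τ : Fin c → Γ)

/-- `ν_{n,m} J_n ⊆ J_m` for all `m ≥ n`. -/
def NormCompatible : Prop :=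
  ∀ n m : ℕ, n ≤ m → ∀ x ∈ J p τ n, normElt p σ n m * x ∈ J p τ m

variable (Y : Type*) [AddCommGroup Y] [Module (Lam p Γ) Y]

/-- `Y / J_n Y`. -/
abbrev Layer (n : ℕ) : Type _ := Y ⧸ (J p τ n • (⊤ : Submodule (Lam p Γ) Y))

variable {p σ τ}

/-- The norm map `Y / J_n Y → Y / J_m Y` induced by multiplication by `ν_{n,m}`. -/
def normMap (hJ : NormCompatible p σ τ) {n m : ℕ} (h : n ≤ m) :
    Layer p τ Y n →ₗ[Lam p Γ] Layer p τ Y m :=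
  Submodule.mapQ _ _ (LinearMap.lsmul (Lam p Γ) Y (normElt p σ n m)) (by
    rw [Submodule.smul_le]
    intro r hr y _
    rw [Submodule.mem_comap, LinearMap.lsmul_apply, smul_smul]
    exact Submodule.smul_mem_smul (hJ n m h r hr) Submodule.mem_top)

variable (p τ) in
/-- The projection `Y / J_m Y → Y / J_n Y` for `m ≥ n`. -/
def proj {n m : ℕ} (h : n ≤ m) : Layer p τ Y m →ₗ[Lam p Γ] Layer p τ Y n :=
  Submodule.mapQ _ _ LinearMap.id (Submodule.smul_mono_left (J_anti p τ h))

/-- The kernel of the norm map `Y / J_n Y → Y / J_m Y`. -/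
def kerNorm (hJ : NormCompatible p σ τ) {n m : ℕ} (h : n ≤ m) :
    Submodule (Lam p Γ) (Layer p τ Y n) := LinearMap.ker (normMap Y hJ h)

theorem kerNorm_mono (hJ : NormCompatible p σ τ) {n m l : ℕ} (h : n ≤ m) (h' : m ≤ l) :
    kerNorm Y hJ h ≤ kerNorm Y hJ (h.trans h') := by
  intro x hx
  obtain ⟨y, rfl⟩ := Submodule.Quotient.mk_surjective _ x
  have e : normMap Y hJ (h.trans h') (Submodule.Quotient.mk y) =
      normMap Y hJ h' (normMap Y hJ h (Submodule.Quotient.mk y)) := by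
    simp only [normMap, Submodule.mapQ_apply, LinearMap.lsmul_apply, smul_smul]
    rw [mul_comm, normElt_mul p σ h h']
  have hx' : normMap Y hJ h (Submodule.Quotient.mk y) = 0 := hx
  show normMap Y hJ (h.trans h') (Submodule.Quotient.mk y) = 0
  rw [e, hx', map_zero]

/-- `Ÿ_(n)`: the union over all `m ≥ n` of the kernels of `Y / J_n Y → Y / J_m Y`. -/
def unionKer (hJ : NormCompatible p σ τ) (n : ℕ) : Submodule (Lam p Γ) (Layer p τ Y n) where
  carrier := {x | ∃ (m : ℕ) (h : n ≤ m), x ∈ kerNorm Y hJ h}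
  zero_mem' := ⟨n, le_rfl, Submodule.zero_mem _⟩
  smul_mem' := by
    rintro r x ⟨m, h, hx⟩
    exact ⟨m, h, Submodule.smul_mem _ r hx⟩
  add_mem' := by
    rintro x y ⟨m, h, hx⟩ ⟨l, h', hy⟩
    exact ⟨max m l, h.trans (le_max_left m l), Submodule.add_mem _
      (kerNorm_mono Y hJ h (le_max_left m l) hx) (kerNorm_mono Y hJ h' (le_max_right m l) hy)⟩

/-- `Ÿ`: the inverse limit of the `Ÿ_(n)` over the projections `Y / J_m Y → Y / J_n Y`, `m ≥ n`,
as a submodule of the product of the `Y / J_n Y`. -/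
def ddot (hJ : NormCompatible p σ τ) : Submodule (Lam p Γ) (∀ n, Layer p τ Y n) where
  carrier := {x | (∀ n, x n ∈ unionKer Y hJ n) ∧
    ∀ (n m : ℕ) (h : n ≤ m), proj p τ Y h (x m) = x n}
  zero_mem' := ⟨fun n => Submodule.zero_mem _, fun n m h => map_zero (proj p τ Y h)⟩
  smul_mem' := by
    rintro r x ⟨hx, hx'⟩
    refine ⟨fun n => Submodule.smul_mem _ r (hx n), fun n m h => ?_⟩
    rw [Pi.smul_apply, Pi.smul_apply, map_smul, hx' n m h]
  add_mem' := by
    rintro x y ⟨hx, hx'⟩ ⟨hy, hy'⟩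
    refine ⟨fun n => Submodule.add_mem _ (hx n) (hy n), fun n m h => ?_⟩
    rw [Pi.add_apply, Pi.add_apply, map_add, hx' n m h, hy' n m h]

end Modules

/-- A module over a commutative ring is pseudo-null if it is finitely generated and its
localization at every prime ideal of height at most one vanishes. -/
def IsPseudoNull (R M : Type*) [CommRing R] [AddCommGroup M] [Module R M] : Prop :=
  Module.Finite R M ∧ ∀ (P : Ideal R) [P.IsPrime], P.height ≤ 1 →
    Subsingleton (LocalizedModule P.primeCompl M)

end IwasawaTower

end

/-! Write Λ for `Lam p Γ`, 𝔪 for its maximal ideal and I_n for the ideal generated by the ω_{σ_i,n}.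
Λ is a power series ring over ℤ_p in the σ_i - 1, hence a complete noetherian local UFD. I_n is the
kernel of Λ → ℤ_p[Γ/Γ^{p^n}], so it does not depend on the basis, and Λ/I_n is reduced and ℤ_p-free.
One has I_n ⊆ J_n ⊆ 𝔪^n and ∏(τ_i - 1)·J_n ⊆ I_n. Norm compatibility is checked on each generator
ν_{τ_i,0,n}, in a basis of Γ containing τ_i; modulo I_m the norm element of one basis is a multiple
of that of any other.

By completeness every element of Ÿ comes from some z ∈ Y such that for each n there is m ≥ n with
ν_{n,m} z ∈ J_m Y. A prime ideal of height at most 1 lies in (π) for a prime element π, so some s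
prime to π must kill z. Otherwise z survives over the discrete valuation ring Λ_(π), and some φ : Y
→ Λ/(π^k) has φ(z) ≠ 0. A lift f of φ(z) satisfies ν_{n,m} f ∈ J_m + (π^k), so all reduces to
`IsTight.pow_dvd`: then π^k divides f.

If π divides no τ_i - 1, multiplication by ∏(τ_i - 1) replaces J_m by I_m. There are two
possibilities (`IsZpBasis.regular_or_torsion_bound`). If π is associated to p, or some power map g ↦
g^a with a prime to p sends π to an s not divisible by π, then π is regular modulo all I_m up to a
multiplier prime to π; in the second case because characters of Γ/Γ^{p^m} related by such a power
map are conjugate over ℚ_p. Otherwise the zeros of π are stable under all these maps, and a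
Weierstrass polynomial with its discriminant yields one multiplier, prime to π, that kills the
p-power torsion of Λ/(π, I_n) for every n. In both cases f is compared with multiples of π^k or of π
modulo I_n, using that the elements of Λ/I_m killed by all ω_{σ_i,n} are the multiples of ν_{n,m};
Krull's theorem concludes as n grows.

If π divides τ_i - 1, the two are associated, and tightness makes π divide no other τ_l - 1. The
product over l ≠ i then reduces J_m to ν_{τ_i,0,m} and the ω of the other basis vectors, where a
regular sequence argument applies. -/

/-! ### Power series, regular sequences and Krull's intersection theorem -/

namespace IwasawaTower

open PowerSeries

/-! ### Completeness of power series rings -/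

section PowerSeriesComplete

variable {A : Type*} [CommRing A] (I : Ideal A)

/-- The ideal of `A⟦X⟧` generated by `I` and `X`. -/
noncomputable def powerSeriesIdeal : Ideal A⟦X⟧ := I.map (C (R := A)) ⊔ Ideal.span {X}

/-- Together with `mem_powerSeriesIdeal_pow` this describes the powers of (I, X) coefficientwise, so
that limits in A⟦X⟧ can be taken one coefficient at a time. The subtraction is truncated:
coefficients of index at least n are unrestricted. -/
theorem coeff_mem_of_mem_powerSeriesIdeal_pow (n : ℕ) :
    ∀ f ∈ powerSeriesIdeal I ^ n, ∀ i, coeff i f ∈ I ^ (n - i) := by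
  induction n with
  | zero => intro f _ i; simp
  | succ n ih =>
    intro f hf
    rw [pow_succ'] at hf
    refine Submodule.mul_induction_on hf ?_ ?_
    · intro u hu v hv i
      obtain ⟨a, ha, b, hb, rfl⟩ := Submodule.mem_sup.1 hu
      obtain ⟨c, rfl⟩ := Ideal.mem_span_singleton.1 hb
      rw [add_mul, map_add]
      refine Ideal.add_mem _ ?_ ?_
      · have ha' : ∀ j, coeff j a ∈ I := by
          intro j
          refine Submodule.span_induction ?_ ?_ ?_ ?_ ha (p := fun a _ => coeff j a ∈ I)
          · rintro _ ⟨x, hx, rfl⟩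
            rw [coeff_C]; split_ifs
            · exact hx
            · exact I.zero_mem
          · simp
          · intro x y _ _ hx hy; rw [map_add]; exact I.add_mem hx hy
          · intro r x hx' _
            have h2 : ∀ k, coeff k x ∈ I := by
              intro k
              refine Submodule.span_induction ?_ ?_ ?_ ?_ hx' (p := fun a _ => ∀ k, coeff k a ∈ I) k
              · rintro _ ⟨x, hx, rfl⟩ k
                rw [coeff_C]; split_ifs
                · exact hx
                · exact I.zero_mem
              · simp
              · intro x y _ _ hx hy k; rw [map_add]; exact I.add_mem (hx k) (hy k)
              · intro r x _ hx k
                rw [smul_eq_mul, coeff_mul]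
                exact Ideal.sum_mem _ fun q _ => I.mul_mem_left _ (hx _)
            rw [smul_eq_mul, coeff_mul]
            exact Ideal.sum_mem _ fun q _ => I.mul_mem_left _ (h2 _)
        rw [coeff_mul]
        refine Ideal.sum_mem _ fun q hq => ?_
        have : q.1 + q.2 = i := by simpa using hq
        have h3 := Ideal.mul_mem_mul (ha' q.1) (ih v hv q.2)
        rw [← pow_succ'] at h3
        exact Ideal.pow_le_pow_right (by omega) h3
      · rw [mul_assoc]
        cases i with
        | zero => simp
        | succ i =>
          rw [mul_comm, coeff_succ_mul_X]
          have h3 := ih (c * v) (Ideal.mul_mem_left _ _ hv) i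
          rwa [show n + 1 - (i + 1) = n - i by omega]
    · intro x y hx hy i
      rw [map_add]; exact Ideal.add_mem _ (hx i) (hy i)

theorem mem_powerSeriesIdeal_pow (n : ℕ) (f : A⟦X⟧) (hf : ∀ i, coeff i f ∈ I ^ (n - i)) :
    f ∈ powerSeriesIdeal I ^ n := by
  rw [eq_X_pow_mul_shift_add_trunc n f]
  have hX : (X : A⟦X⟧) ∈ powerSeriesIdeal I :=
    Ideal.mem_sup_right (Ideal.mem_span_singleton_self _)
  refine Ideal.add_mem _ (Ideal.mul_mem_right _ _ (Ideal.pow_mem_pow hX n)) ?_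
  rw [trunc_apply, ← Polynomial.coeToPowerSeries.ringHom_apply, map_sum]
  refine Ideal.sum_mem _ fun i hi => ?_
  have hi' : i < n := by simpa using hi
  rw [Polynomial.coeToPowerSeries.ringHom_apply, Polynomial.coe_monomial]
  have h1 : C (coeff i f) ∈ powerSeriesIdeal I ^ (n - i) := by
    have := Ideal.mem_map_of_mem (C (R := A)) (hf i)
    rw [Ideal.map_pow] at this
    exact Ideal.pow_right_mono le_sup_left _ this
  have h2 := Ideal.mul_mem_mul (Ideal.pow_mem_pow hX i) h1
  rw [← pow_add, Nat.add_sub_cancel' hi'.le] at h2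
  convert h2 using 1
  ext m
  rw [coeff_monomial, mul_comm, coeff_C_mul, coeff_X_pow]
  simp

theorem isAdicComplete_powerSeriesIdeal [IsAdicComplete I A] :
    IsAdicComplete (powerSeriesIdeal I) A⟦X⟧ where
  haus' f hf := by
    ext i
    refine IsHausdorff.haus' (I := I) (coeff i f) fun n => ?_
    -- The shift by i makes up for the i powers that are lost in the i-th coefficient.
    have h := hf (n + i)
    rw [SModEq.zero, smul_eq_mul, Ideal.mul_top] at h ⊢
    simpa using coeff_mem_of_mem_powerSeriesIdeal_pow I _ _ h i
  prec' f hf := by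
    have key : ∀ i, ∃ L : A, ∀ n, coeff i (f (n + i)) - L ∈ I ^ n := by
      intro i
      obtain ⟨L, hL⟩ := IsPrecomplete.prec' (I := I) (M := A) (fun n => coeff i (f (n + i)))
        (by
          intro m n hmn
          have h := hf (m := m + i) (n := n + i) (by omega)
          rw [SModEq.sub_mem, smul_eq_mul, Ideal.mul_top] at h ⊢
          rw [← map_sub]
          simpa using coeff_mem_of_mem_powerSeriesIdeal_pow I _ _ h i)
      refine ⟨L, fun n => ?_⟩
      have := hL n
      rwa [SModEq.sub_mem, smul_eq_mul, Ideal.mul_top] at this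
    choose L hL using key
    refine ⟨PowerSeries.mk L, fun n => ?_⟩
    rw [SModEq.sub_mem, smul_eq_mul, Ideal.mul_top]
    refine mem_powerSeriesIdeal_pow I n _ fun i => ?_
    rw [map_sub, coeff_mk]
    by_cases hi : n ≤ i
    · simp [Nat.sub_eq_zero_of_le hi]
    · have h := hL i (n - i)
      rwa [Nat.sub_add_cancel (by omega)] at h

end PowerSeriesComplete

/-! ### Closedness of ideals and submodules, completeness of finite modules -/

section Krull

/-- An ideal of a noetherian local ring is closed. -/
theorem mem_of_forall_mem_sup_pow {A : Type*} [CommRing A] [IsNoetherianRing A] [IsLocalRing A]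
    (𝔠 : Ideal A) (x : A) (h : ∀ k, x ∈ 𝔠 ⊔ IsLocalRing.maximalIdeal A ^ k) : x ∈ 𝔠 := by
  rw [← Ideal.Quotient.eq_zero_iff_mem]
  refine IsHausdorff.haus' (I := IsLocalRing.maximalIdeal A) (M := A ⧸ 𝔠) _ fun k => ?_
  rw [SModEq.zero]
  obtain ⟨a, ha, b, hb, rfl⟩ := Submodule.mem_sup.1 (h k)
  rw [map_add, Ideal.Quotient.eq_zero_iff_mem.2 ha, zero_add]
  have := Submodule.smul_mem_smul hb (Submodule.mem_top : (1 : A ⧸ 𝔠) ∈ (⊤ : Submodule A (A ⧸ 𝔠)))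
  rwa [Algebra.smul_def, mul_one] at this

/-- The same for modules. -/
theorem mem_of_forall_mem_sup_pow_smul {A Y : Type*} [CommRing A] [IsNoetherianRing A]
    [IsLocalRing A] [AddCommGroup Y] [Module A Y] [Module.Finite A Y]
    (N : Submodule A Y) (y : Y)
    (h : ∀ k, y ∈ N ⊔ IsLocalRing.maximalIdeal A ^ k • (⊤ : Submodule A Y)) : y ∈ N := by
  rw [← Submodule.Quotient.mk_eq_zero]
  refine IsHausdorff.haus' (I := IsLocalRing.maximalIdeal A) (M := Y ⧸ N) _ fun k => ?_
  rw [SModEq.zero]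
  obtain ⟨a, ha, b, hb, rfl⟩ := Submodule.mem_sup.1 (h k)
  rw [Submodule.Quotient.mk_add, (Submodule.Quotient.mk_eq_zero N).2 ha, zero_add]
  have := Submodule.mem_map_of_mem (f := N.mkQ) hb
  rw [Submodule.map_smul''] at this
  exact Submodule.smul_mono le_rfl le_top this

/-- Finitely generated modules over complete rings are precomplete. -/
theorem isPrecomplete_of_finite {A Y : Type*} [CommRing A] (I : Ideal A) [IsPrecomplete I A]
    [AddCommGroup Y] [Module A Y] [Module.Finite A Y] : IsPrecomplete I Y := by
  obtain ⟨n, g, hg⟩ := Module.Finite.exists_fin' A Y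
  have hpi : IsPrecomplete I (Fin n → A) := by
    refine ⟨fun f hf => ?_⟩
    have : ∀ i, ∃ L : A, ∀ k, f k i ≡ L [SMOD (I ^ k • ⊤ : Submodule A A)] := fun i =>
      IsPrecomplete.prec' (I := I) (fun k => f k i) (by
        intro a b hab
        have h := SModEq.sub_mem.1 (hf hab)
        rw [SModEq.sub_mem]
        have := Submodule.mem_map_of_mem (f := LinearMap.proj (R := A) (φ := fun _ : Fin n => A) i) h
        rw [Submodule.map_smul''] at this
        exact Submodule.smul_mono le_rfl le_top this)
    choose L hL using this
    refine ⟨L, fun k => SModEq.sub_mem.2 ?_⟩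
    rw [pi_eq_sum_univ (f k - L)]
    refine Submodule.sum_mem _ fun i _ => ?_
    have := SModEq.sub_mem.1 (hL i k)
    rw [smul_eq_mul, Ideal.mul_top] at this
    exact Submodule.smul_mem_smul this Submodule.mem_top
  -- Precompleteness is surjectivity of the map to the completion, and completion preserves the
  -- surjection from A^n to Y.
  rw [← AdicCompletion.of_surjective_iff] at hpi ⊢
  intro z
  obtain ⟨w, rfl⟩ := AdicCompletion.map_surjective I hg z
  obtain ⟨v, rfl⟩ := hpi w
  exact ⟨g v, (AdicCompletion.map_of I g v).symm⟩

/-- Over a complete noetherian local ring with maximal ideal `𝔪`, a finitely generated module is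
complete for each filtration that is finer than the `𝔪`-adic one. -/
theorem exists_of_compatible {A Y : Type*} [CommRing A] [IsNoetherianRing A] [IsLocalRing A]
    [IsAdicComplete (IsLocalRing.maximalIdeal A) A] [AddCommGroup Y] [Module A Y]
    [Module.Finite A Y] (N : ℕ → Submodule A Y)
    (hN' : ∀ n, N n ≤ IsLocalRing.maximalIdeal A ^ n • ⊤) (y : ℕ → Y)
    (hy : ∀ m n, m ≤ n → y m - y n ∈ N m) : ∃ z, ∀ n, y n - z ∈ N n := by
  have := isPrecomplete_of_finite (Y := Y) (IsLocalRing.maximalIdeal A)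
  obtain ⟨z, hz⟩ := IsPrecomplete.prec' (I := IsLocalRing.maximalIdeal A) y
    (fun {m n} h => SModEq.sub_mem.2 (hN' m (hy m n h)))
  -- The 𝔪-adic limit z also works for the finer filtration: y n - z lies in N n + 𝔪^k Y for every
  -- k, and N n is closed.
  refine ⟨z, fun n => mem_of_forall_mem_sup_pow_smul _ _ fun k => ?_⟩
  have e : y n - z = (y n - y (max n k)) + (y (max n k) - z) := by abel
  rw [e]
  refine Submodule.add_mem_sup (hy _ _ (le_max_left _ _)) ?_
  exact Submodule.smul_mono_left (Ideal.pow_le_pow_right (le_max_right _ _))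
    (SModEq.sub_mem.1 (hz (max n k)))

end Krull

/-! ### Non-zero-divisors modulo ideals -/

section NonZeroDivisors

/-- A power series that does not vanish modulo the maximal ideal is a non-zero-divisor modulo
every ideal that is extended from the coefficient ring. -/
theorem coeff_mem_of_coeff_mul_mem {A : Type*} [CommRing A] [IsNoetherianRing A] [IsLocalRing A]
    (𝔟 : Ideal A) (g f : A⟦X⟧) (hg : ∃ i, coeff i g ∉ IsLocalRing.maximalIdeal A)
    (h : ∀ i, coeff i (g * f) ∈ 𝔟) (i : ℕ) : coeff i f ∈ 𝔟 := by
  classical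
  refine mem_of_forall_mem_sup_pow _ _ fun k => ?_
  induction k generalizing i with
  | zero => simp
  | succ k ih =>
    induction i using Nat.strong_induction_on with
    | _ i ihi =>
    -- N is the index of the first unit coefficient of g. In the coefficient i + N of g * f, the
    -- terms with a lower coefficient of g gain a factor in 𝔪 over the accuracy k already known,
    -- those with a higher one involve earlier coefficients of f, and only coeff N g * coeff i f is
    -- left.
    set N := Nat.find hg
    have hN : IsUnit (coeff N g) := by
      have := Nat.find_spec hg
      rwa [IsLocalRing.mem_maximalIdeal, mem_nonunits_iff, not_not] at this
    have h1 := h (i + N)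
    rw [coeff_mul, ← Finset.add_sum_erase _ _ (a := (N, i)) (by simp [add_comm])] at h1
    have h2 : ∑ q ∈ (Finset.HasAntidiagonal.antidiagonal (i + N)).erase (N, i), coeff q.1 g * coeff q.2 f ∈
        𝔟 ⊔ IsLocalRing.maximalIdeal A ^ (k + 1) := by
      refine Ideal.sum_mem _ fun q hq => ?_
      rw [Finset.mem_erase, Finset.HasAntidiagonal.mem_antidiagonal] at hq
      rcases lt_trichotomy q.1 N with hlt | heq | hgt
      · have := Nat.find_min hg hlt
        rw [not_not] at this
        have h3 := Ideal.mul_mem_mul this (ih q.2)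
        refine (?_ : _ ≤ 𝔟 ⊔ IsLocalRing.maximalIdeal A ^ (k + 1)) h3
        rw [Ideal.mul_sup, pow_succ']
        exact sup_le_sup_right Ideal.mul_le_right _
      · exact absurd (Prod.ext heq (by omega : q.2 = i)) hq.1
      · exact Ideal.mul_mem_left _ _ (ihi q.2 (by omega))
    have h4 : coeff N g * coeff i f ∈ 𝔟 ⊔ IsLocalRing.maximalIdeal A ^ (k + 1) := by
      have := Ideal.sub_mem _ (Ideal.mem_sup_left h1 : _ ∈ 𝔟 ⊔ IsLocalRing.maximalIdeal A ^ (k + 1)) h2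
      simpa using this
    exact (Ideal.unit_mul_mem_iff_mem _ hN).1 h4

/-- The converse direction needs 𝔟 to be finitely generated: all coefficients are expressed in the
same finite set of generators. -/
theorem mem_map_C_iff {A : Type*} [CommRing A] [IsNoetherianRing A] (𝔟 : Ideal A) (f : A⟦X⟧) :
    f ∈ 𝔟.map (C (R := A)) ↔ ∀ i, coeff i f ∈ 𝔟 := by
  constructor
  · intro hf
    refine Submodule.span_induction ?_ ?_ ?_ ?_ hf (p := fun a _ => ∀ j, coeff j a ∈ 𝔟)
    · rintro _ ⟨x, hx, rfl⟩ j
      rw [coeff_C]; split_ifs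
      · exact hx
      · exact 𝔟.zero_mem
    · simp
    · intro x y _ _ hx hy j; rw [map_add]; exact 𝔟.add_mem (hx j) (hy j)
    · intro r x _ hx j
      rw [smul_eq_mul, coeff_mul]
      exact Ideal.sum_mem _ fun q _ => 𝔟.mul_mem_left _ (hx _)
  · intro hf
    obtain ⟨s, hs⟩ := (isNoetherianRing_iff_ideal_fg A).1 inferInstance 𝔟
    have : ∀ i, ∃ c : s → A, ∑ a : s, c a * a.1 = coeff i f := by
      intro i
      have := hf i
      rw [← hs] at this
      obtain ⟨c, -, hc⟩ := Submodule.mem_span_finset.1 this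
      refine ⟨fun a => c a, ?_⟩
      rw [← hc, ← Finset.sum_coe_sort s]
      rfl
    choose c hc using this
    have e : f = ∑ a : s, C a.1 * PowerSeries.mk (fun i => c i a) := by
      ext i
      rw [map_sum, ← hc i]
      refine Finset.sum_congr rfl fun a _ => ?_
      rw [coeff_C_mul, coeff_mk, mul_comm]
    rw [e]
    refine Ideal.sum_mem _ fun a _ => Ideal.mul_mem_right _ _ (Ideal.mem_map_of_mem _ ?_)
    rw [← hs]; exact Ideal.subset_span a.2

/-- `c` is a non-zero-divisor modulo the ideal `𝔟`. -/
def NZDMod {R : Type*} [CommRing R] (𝔟 : Ideal R) (c : R) : Prop := ∀ x, c * x ∈ 𝔟 → x ∈ 𝔟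

theorem nzdMod_map_C {A : Type*} [CommRing A] [IsNoetherianRing A] [IsLocalRing A]
    (𝔟 : Ideal A) (g : A⟦X⟧) (hg : ∃ i, coeff i g ∉ IsLocalRing.maximalIdeal A) :
    NZDMod (𝔟.map (C (R := A))) g := by
  intro f h
  rw [mem_map_C_iff] at h ⊢
  exact coeff_mem_of_coeff_mul_mem 𝔟 g f hg h

theorem NZDMod.congr {R : Type*} [CommRing R] {𝔟 : Ideal R} {c e : R} (hc : NZDMod 𝔟 c)
    (h : c - e ∈ 𝔟) : NZDMod 𝔟 e := fun x hx => hc x (by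
  have : c * x = (c - e) * x + e * x := by ring
  rw [this]
  exact Ideal.add_mem _ (Ideal.mul_mem_right _ _ h) hx)

/-- If `t` is regular modulo `𝔟` and `u` is regular modulo `𝔟 + (t)`, then `u` is regular modulo
`𝔟 + (t ^ k)`. -/
theorem NZDMod.sup_span_pow {R : Type*} [CommRing R] {𝔟 : Ideal R} {t u : R} (ht : NZDMod 𝔟 t)
    (hu : NZDMod (𝔟 ⊔ Ideal.span {t}) u) (k : ℕ) : NZDMod (𝔟 ⊔ Ideal.span {t ^ k}) u := by
  induction k with
  | zero => intro x _; simp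
  | succ k ih =>
    intro x hx
    have h1 : x ∈ 𝔟 ⊔ Ideal.span {t} := hu x (by
      refine (sup_le_sup_left ?_ 𝔟) hx
      rw [Ideal.span_singleton_le_span_singleton]
      exact Dvd.intro_left (t ^ k) (pow_succ t k).symm)
    obtain ⟨b, hb, y, hy, rfl⟩ := Submodule.mem_sup.1 h1
    obtain ⟨z, rfl⟩ := Ideal.mem_span_singleton.1 hy
    obtain ⟨b', hb', y', hy', e⟩ := Submodule.mem_sup.1 hx
    obtain ⟨w, rfl⟩ := Ideal.mem_span_singleton.1 hy'
    -- Cancelling one factor t modulo 𝔟 brings z into the situation of exponent k.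
    have h2 : u * z - t ^ k * w ∈ 𝔟 := by
      refine ht _ ?_
      have : t * (u * z - t ^ k * w) = b' - u * b := by linear_combination -e
      rw [this]
      exact Ideal.sub_mem _ hb' (Ideal.mul_mem_left _ _ hb)
    have h3 : z ∈ 𝔟 ⊔ Ideal.span {t ^ k} := ih z (by
      have : u * z = (u * z - t ^ k * w) + t ^ k * w := by ring
      rw [this]
      exact Submodule.add_mem_sup h2 (Ideal.mul_mem_right _ _ (Ideal.mem_span_singleton_self _)))
    obtain ⟨b3, hb3, y3, hy3, rfl⟩ := Submodule.mem_sup.1 h3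
    obtain ⟨w3, rfl⟩ := Ideal.mem_span_singleton.1 hy3
    have : b + t * (b3 + t ^ k * w3) = (b + t * b3) + t ^ (k + 1) * w3 := by ring
    rw [this]
    exact Submodule.add_mem_sup (Ideal.add_mem _ hb (Ideal.mul_mem_left _ _ hb3))
      (Ideal.mul_mem_right _ _ (Ideal.mem_span_singleton_self _))

/-! ### Ideals generated by products along a regular sequence -/

section Regular

variable {R ι : Type*} [CommRing R] [DecidableEq ι] (K : Ideal R) (b c : ι → R)

/-- The ideal generated by `K`, by the `b i` with `i ∈ s` and by the `b i * c i` with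
`i ∈ u \ s`. -/
def mixedIdeal (u s : Finset ι) : Ideal R :=
  K ⊔ Ideal.span ((fun i => if i ∈ s then b i else b i * c i) '' (u : Set ι))

variable {K b c}

theorem mixedIdeal_mem {u s : Finset ι} {x : R} {j : ι} (hj : j ∈ u)
    (hx : x ∈ mixedIdeal K b c u s) :
    ∃ z, x - (if j ∈ s then b j else b j * c j) * z ∈ mixedIdeal K b c (u.erase j) s := by
  have : mixedIdeal K b c u s = mixedIdeal K b c (u.erase j) s ⊔
      Ideal.span {if j ∈ s then b j else b j * c j} := by
    rw [mixedIdeal, mixedIdeal, sup_assoc, ← Ideal.span_union]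
    congr 2
    ext y
    simp only [Set.mem_image, Set.mem_union, Set.mem_singleton_iff, Finset.mem_coe,
      Finset.mem_erase]
    constructor
    · rintro ⟨i, hi, rfl⟩
      by_cases h : i = j
      · subst h; exact Or.inr rfl
      · exact Or.inl ⟨i, ⟨h, hi⟩, rfl⟩
    · rintro (⟨i, ⟨-, hi⟩, rfl⟩ | rfl)
      · exact ⟨i, hi, rfl⟩
      · exact ⟨j, hj, rfl⟩
  rw [this] at hx
  obtain ⟨a, ha, y, hy, rfl⟩ := Submodule.mem_sup.1 hx
  obtain ⟨z, rfl⟩ := Ideal.mem_span_singleton.1 hy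
  exact ⟨z, by simpa using ha⟩

theorem mixedIdeal_erase_insert (u s : Finset ι) (j : ι) :
    mixedIdeal K b c (u.erase j) (insert j s) = mixedIdeal K b c (u.erase j) s := by
  rw [mixedIdeal, mixedIdeal]
  congr 2
  refine Set.image_congr fun i hi => ?_
  have : i ≠ j := by simp at hi; exact hi.2
  simp [this]

theorem mixedIdeal_erase_le (u s : Finset ι) (j : ι) :
    mixedIdeal K b c (u.erase j) s ≤ mixedIdeal K b c u s :=
  sup_le_sup_left (Ideal.span_mono (Set.image_mono (by simp))) _

theorem mem_mixedIdeal {u s : Finset ι} {j : ι} (hj : j ∈ u) :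
    (if j ∈ s then b j else b j * c j) ∈ mixedIdeal K b c u s :=
  Ideal.mem_sup_right (Ideal.subset_span ⟨j, hj, rfl⟩)

/-- For a regular sequence of products `b i * c i`: the kernel of multiplication by `∏ c i`. -/
theorem mem_mixedIdeal_of_prod_mul_mem {u : Finset ι}
    (H : ∀ j ∈ u, ∀ s ⊆ u, j ∉ s → NZDMod (mixedIdeal K b c (u.erase j) s) (c j))
    (s : Finset ι) (hs : s ⊆ u) (x : R) (hx : (∏ i ∈ s, c i) * x ∈ mixedIdeal K b c u ∅) :
    x ∈ mixedIdeal K b c u s := by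
  induction s using Finset.induction_on generalizing x with
  | empty => simpa using hx
  | insert j s hj ih =>
    have hju : j ∈ u := hs (Finset.mem_insert_self _ _)
    have hsu : s ⊆ u := (Finset.subset_insert _ _).trans hs
    rw [Finset.prod_insert hj, mul_comm (c j), mul_assoc] at hx
    -- The induction hypothesis applies to c j * x. Splitting off the generator b j * c j exposes a
    -- factor c j, which is regular modulo the other generators.
    obtain ⟨z, hz⟩ := mixedIdeal_mem hju (ih hsu _ hx)
    rw [if_neg hj, show c j * x - b j * c j * z = c j * (x - b j * z) by ring] at hz
    have h := H j hju s hsu hj _ hz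
    rw [← mixedIdeal_erase_insert] at h
    have h1 := mixedIdeal_erase_le _ _ _ h
    have h2 := mem_mixedIdeal (K := K) (b := b) (c := c) (s := insert j s) hju
    rw [if_pos (Finset.mem_insert_self _ _)] at h2
    have := Ideal.add_mem _ h1 (Ideal.mul_mem_right z _ h2)
    simpa using this

theorem prod_mul_mem_mixedIdeal {u : Finset ι} (s : Finset ι) (x : R)
    (hx : x ∈ mixedIdeal K b c u s) : (∏ i ∈ s, c i) * x ∈ mixedIdeal K b c u ∅ := by
  obtain ⟨k, hk, y, hy, rfl⟩ := Submodule.mem_sup.1 hx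
  rw [mul_add]
  refine Ideal.add_mem _ (Ideal.mem_sup_left (Ideal.mul_mem_left _ _ hk)) ?_
  refine Submodule.span_induction ?_ ?_ ?_ ?_ hy
    (p := fun y _ => (∏ i ∈ s, c i) * y ∈ mixedIdeal K b c u ∅)
  · rintro _ ⟨i, hi, rfl⟩
    have h2 := mem_mixedIdeal (K := K) (b := b) (c := c) (s := ∅) (Finset.mem_coe.1 hi)
    rw [if_neg (Finset.notMem_empty _)] at h2
    simp only
    split_ifs with h
    · rw [← Finset.mul_prod_erase s c h, show c i * (∏ j ∈ s.erase i, c j) * b i =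
        (∏ j ∈ s.erase i, c j) * (b i * c i) by ring]
      exact Ideal.mul_mem_left _ _ h2
    · exact Ideal.mul_mem_left _ _ h2
  · simp
  · intro y z _ _ hy hz; rw [mul_add]; exact Ideal.add_mem _ hy hz
  · intro r y _ hy
    rw [smul_eq_mul, mul_left_comm]; exact Ideal.mul_mem_left _ _ hy

/-- For a regular sequence of products `b i * c i`: the elements killed by all `b i`. -/
theorem exists_prod_mul_sub_mem_mixedIdeal {u : Finset ι}
    (H : ∀ j ∈ u, ∀ s ⊆ u, j ∉ s → NZDMod (mixedIdeal K b c (u.erase j) s) (c j))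
    (H' : ∀ j ∈ u, ∀ s ⊆ u, j ∉ s → NZDMod (mixedIdeal K b c (u.erase j) s) (b j))
    (s : Finset ι) (hs : s ⊆ u) (x : R) (hx : ∀ i ∈ s, b i * x ∈ mixedIdeal K b c u ∅) :
    ∃ y, x - (∏ i ∈ s, c i) * y ∈ mixedIdeal K b c u ∅ := by
  induction s using Finset.induction_on with
  | empty => exact ⟨x, by simp⟩
  | insert j s hj ih =>
    have hju : j ∈ u := hs (Finset.mem_insert_self _ _)
    have hsu : s ⊆ u := (Finset.subset_insert _ _).trans hs
    obtain ⟨y, hy⟩ := ih hsu fun i hi => hx i (Finset.mem_insert_of_mem hi)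
    have h1 : (∏ i ∈ s, c i) * (b j * y) ∈ mixedIdeal K b c u ∅ := by
      have := Ideal.sub_mem _ (hx j (Finset.mem_insert_self _ _)) (Ideal.mul_mem_left _ (b j) hy)
      rwa [show b j * x - b j * (x - (∏ i ∈ s, c i) * y) = (∏ i ∈ s, c i) * (b j * y) by ring]
        at this
    -- The factors c i with i ∈ s have been removed from b j * y. After cancelling b j, y agrees
    -- with c j * z modulo the remaining generators, so z is the quotient for the enlarged set.
    obtain ⟨z, hz⟩ := mixedIdeal_mem hju (mem_mixedIdeal_of_prod_mul_mem H s hsu _ h1)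
    rw [if_neg hj, show b j * y - b j * c j * z = b j * (y - c j * z) by ring] at hz
    have h2 := prod_mul_mem_mixedIdeal s _ (mixedIdeal_erase_le _ _ _ (H' j hju s hsu hj _ hz))
    refine ⟨z, ?_⟩
    rw [Finset.prod_insert hj]
    have := Ideal.add_mem _ hy h2
    rwa [show x - (∏ i ∈ s, c i) * y + (∏ i ∈ s, c i) * (y - c j * z) =
      x - c j * (∏ i ∈ s, c i) * z by ring] at this

end Regular

end NonZeroDivisors

end IwasawaTower

/-! ### Group rings over `ℤ_p` and discriminants -/

namespace IwasawaTower

/-! ### Galois conjugate characters of finite abelian p-groups -/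

section GroupRing

variable {p : ℕ} [Fact p.Prime]

theorem natCast_smul_injective_monoidAlgebra {G : Type*} [Monoid G] {n : ℕ} (hn : n ≠ 0)
    (x : MonoidAlgebra ℤ_[p] G) (h : (n : MonoidAlgebra ℤ_[p] G) * x = 0) : x = 0 := by
  rw [← nsmul_eq_mul] at h
  apply (MonoidAlgebra.coeffLinearEquiv (R := ℤ_[p]) (S := ℤ_[p]) (M := G)).injective
  rw [map_zero]
  ext g
  have h1 := congrArg (MonoidAlgebra.coeffLinearEquiv (R := ℤ_[p]) (S := ℤ_[p]) (M := G)) h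
  rw [map_nsmul, map_zero] at h1
  have h2 := DFunLike.congr_fun h1 g
  rw [Finsupp.smul_apply, Finsupp.zero_apply, nsmul_eq_mul] at h2
  rw [Finsupp.zero_apply]
  exact (mul_eq_zero.1 h2).resolve_left (Nat.cast_ne_zero.2 hn)

/-- ℤ_p[G] embeds in ℚ_p[G], which is reduced because the order of G is invertible there. -/
theorem isReduced_monoidAlgebra (G : Type*) [CommGroup G] [Finite G] :
    IsReduced (MonoidAlgebra ℤ_[p] G) := by
  have : NeZero (Nat.card G : ℚ_[p]) := ⟨Nat.cast_ne_zero.2 Nat.card_pos.ne'⟩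
  have : IsReduced (MonoidAlgebra ℚ_[p] G) := inferInstance
  refine isReduced_of_injective (MonoidAlgebra.mapRingHom G (algebraMap ℤ_[p] ℚ_[p])) ?_
  exact MonoidAlgebra.map_injective _ (IsFractionRing.injective ℤ_[p] ℚ_[p])

open Polynomial in
-- The substitution X ↦ X + 1 produces an Eisenstein polynomial over ℤ. It stays Eisenstein over ℤ_p
-- because divisibility of integers by powers of p can be tested there.
theorem irreducible_cyclotomic_padicInt (n : ℕ) :
    Irreducible (cyclotomic (p ^ (n + 1)) ℤ_[p]) := by
  have hE := cyclotomic_prime_pow_comp_X_add_one_isEisensteinAt p n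
  set f : ℤ[X] := (cyclotomic (p ^ (n + 1)) ℤ).comp (X + 1) with hf
  have hmon : f.Monic := by
    rw [hf, show (X + 1 : ℤ[X]) = X + C 1 by simp]
    exact (cyclotomic.monic _ ℤ).comp (monic_X_add_C 1) (by rw [natDegree_X_add_C]; simp)
  set g : ℤ_[p][X] := f.map (Int.castRingHom ℤ_[p]) with hg
  have hgmon : g.Monic := hmon.map _
  have hmem : ∀ z : ℤ, z ∈ Ideal.span {(p : ℤ)} → (z : ℤ_[p]) ∈ Ideal.span {(p : ℤ_[p])} := by
    intro z hz
    obtain ⟨w, rfl⟩ := Ideal.mem_span_singleton.1 hz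
    rw [Int.cast_mul, Int.cast_natCast]
    exact Ideal.mul_mem_right _ _ (Ideal.mem_span_singleton_self _)
  have hpr : (Ideal.span {(p : ℤ_[p])}).IsPrime := by
    rw [← PadicInt.maximalIdeal_eq_span_p]; infer_instance
  have hnat : g.natDegree = f.natDegree := hmon.natDegree_map _
  have hgE : g.IsEisensteinAt (Ideal.span {(p : ℤ_[p])}) := by
    refine hgmon.isEisensteinAt_of_mem_of_notMem hpr.ne_top ?_ ?_
    · intro k hk
      rw [hg, coeff_map]
      exact hmem _ (hE.mem (by rwa [hnat] at hk))
    · rw [hg, coeff_map, eq_intCast, Ideal.span_singleton_pow, Ideal.mem_span_singleton]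
      intro h
      apply hE.notMem
      rw [Ideal.submodule_span_eq, Ideal.span_singleton_pow, Ideal.mem_span_singleton]
      have h2 := (PadicInt.pow_p_dvd_int_iff (p := p) 2 (f.coeff 0)).1 (by exact_mod_cast h)
      exact_mod_cast h2
  have hdeg : 0 < g.natDegree := by
    rw [hnat, hf, natDegree_comp, show (X + 1 : ℤ[X]) = X + C 1 by simp, natDegree_X_add_C,
      natDegree_cyclotomic, mul_one]
    exact Nat.totient_pos.2 (pow_pos (Fact.out : p.Prime).pos _)
  have hirr := hgE.irreducible hpr hgmon.isPrimitive hdeg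
  have e : g = Polynomial.algEquivAevalXAddC (1 : ℤ_[p]) (cyclotomic (p ^ (n + 1)) ℤ_[p]) := by
    rw [hg, hf, Polynomial.map_comp, map_cyclotomic]
    simp [Polynomial.algEquivAevalXAddC, Polynomial.comp_eq_aeval]
  rw [e] at hirr
  exact (MulEquiv.irreducible_iff _).1 hirr

open Polynomial in
-- ζ and ζ^a are roots of the same irreducible cyclotomic polynomial, which divides every polynomial
-- vanishing at ζ.
theorem eval_pow_eq_zero_of_isPrimitiveRoot {K : Type*} [Field K] [Algebra ℤ_[p] K]
    (hK : Function.Injective (algebraMap ℤ_[p] K)) {n a : ℕ} (ha : a.Coprime p) {ζ : K}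
    (hζ : IsPrimitiveRoot ζ (p ^ n)) (P : ℤ_[p][X]) (hP : aeval ζ P = 0) :
    aeval (ζ ^ a) P = 0 := by
  cases n with
  | zero =>
    rw [pow_zero, IsPrimitiveRoot.one_right_iff] at hζ
    rw [hζ, one_pow]; rwa [hζ] at hP
  | succ n =>
    have : CharZero K := (algebraMap ℤ_[p] K).charZero_iff hK |>.1 inferInstance
    have : Module.IsTorsionFree ℤ_[p] K := Module.isTorsionFree_iff_algebraMap_injective.2 hK
    have hcyc : ∀ ξ : K, IsPrimitiveRoot ξ (p ^ (n + 1)) →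
        aeval ξ (cyclotomic (p ^ (n + 1)) ℤ_[p]) = 0 := by
      intro ξ hξ
      rw [aeval_def, ← eval_map, map_cyclotomic]
      exact hξ.isRoot_cyclotomic (pow_pos (Fact.out : p.Prime).pos _)
    have hint : IsIntegral ℤ_[p] ζ :=
      ⟨_, cyclotomic.monic _ _, hcyc ζ hζ⟩
    have h1 := minpoly.isIntegrallyClosed_dvd hint (hcyc ζ hζ)
    have h2 := minpoly.isIntegrallyClosed_dvd hint hP
    have h3 : cyclotomic (p ^ (n + 1)) ℤ_[p] ∣ P :=
      ((minpoly.prime_of_isIntegrallyClosed hint).irreducible.dvd_symm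
        (irreducible_cyclotomic_padicInt n) h1).trans h2
    obtain ⟨Q, rfl⟩ := h3
    rw [map_mul, hcyc _ (hζ.pow_of_coprime a (ha.pow_right _)), zero_mul]

theorem lift_mapDomain_pow_eq_zero {G K : Type*} [CommGroup G] [Finite G] [Field K]
    [Algebra ℤ_[p] K] (hK : Function.Injective (algebraMap ℤ_[p] K)) {n a : ℕ}
    (hG : ∀ g : G, g ^ p ^ n = 1) (ha : a.Coprime p) (φ : MonoidAlgebra ℤ_[p] G →ₐ[ℤ_[p]] K)
    (x : MonoidAlgebra ℤ_[p] G) (hx : φ x = 0) :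
    φ (MonoidAlgebra.mapDomainAlgHom ℤ_[p] ℤ_[p] (powMonoidHom a) x) = 0 := by
  classical
  set h : G →* Kˣ := ((φ : MonoidAlgebra ℤ_[p] G →* K).comp
    (MonoidAlgebra.of ℤ_[p] G)).toHomUnits with hh
  have hφ : ∀ g, φ (MonoidAlgebra.single g 1) = h g := fun g => rfl
  have : Finite h.range := (Set.finite_range h).to_subtype
  obtain ⟨⟨z, g₀, rfl⟩, hz⟩ := IsCyclic.exists_generator (α := h.range)
  have hdvd : orderOf (h g₀) ∣ p ^ n := by
    rw [orderOf_dvd_iff_pow_eq_one, ← map_pow, hG, map_one]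
  obtain ⟨j, -, hj⟩ := (Nat.dvd_prime_pow (Fact.out : p.Prime)).1 hdvd
  have hprim : IsPrimitiveRoot ((h g₀ : Kˣ) : K) (p ^ j) := by
    rw [← hj, IsPrimitiveRoot.coe_units_iff]; exact IsPrimitiveRoot.orderOf _
  have hexp : ∀ g, ∃ e : ℕ, h g = h g₀ ^ e := by
    intro g
    obtain ⟨e, he⟩ := (mem_powers_iff_mem_zpowers (x := (⟨h g₀, g₀, rfl⟩ : h.range))).2
      (hz ⟨h g, g, rfl⟩)
    exact ⟨e, (congrArg Subtype.val he).symm⟩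
  choose e he using hexp
  -- The image of G in Kˣ is cyclic, generated by a root of unity ζ of p-power order. P lifts φ to
  -- polynomials: φ y is the value of P y at ζ, and φ after the a-th power map is its value at ζ^a.
  -- P is only linear, since the exponents e g are arbitrary choices.
  let P : MonoidAlgebra ℤ_[p] G →ₗ[ℤ_[p]] Polynomial ℤ_[p] :=
    (MonoidAlgebra.basis G ℤ_[p]).constr ℤ_[p] fun g => Polynomial.X ^ e g
  have hP : ∀ g, P (MonoidAlgebra.single g 1) = Polynomial.X ^ e g := fun g => by
    have := (MonoidAlgebra.basis G ℤ_[p]).constr_basis ℤ_[p] (fun g => (Polynomial.X : Polynomial ℤ_[p]) ^ e g) g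
    rwa [MonoidAlgebra.basis_apply] at this
  have e1 : ∀ y, φ y = Polynomial.aeval ((h g₀ : Kˣ) : K) (P y) := by
    intro y
    have : φ.toLinearMap = (Polynomial.aeval ((h g₀ : Kˣ) : K)).toLinearMap ∘ₗ P := by
      refine (MonoidAlgebra.basis G ℤ_[p]).ext fun g => ?_
      rw [MonoidAlgebra.basis_apply]
      simp only [AlgHom.toLinearMap_apply, LinearMap.comp_apply]
      rw [hP, hφ, he g]; simp
    exact LinearMap.congr_fun this y
  have e2 : ∀ y, φ (MonoidAlgebra.mapDomainAlgHom ℤ_[p] ℤ_[p] (powMonoidHom a) y) =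
      Polynomial.aeval (((h g₀ : Kˣ) : K) ^ a) (P y) := by
    intro y
    have : φ.toLinearMap ∘ₗ
        (MonoidAlgebra.mapDomainAlgHom ℤ_[p] ℤ_[p] (powMonoidHom (α := G) a)).toLinearMap =
        (Polynomial.aeval (((h g₀ : Kˣ) : K) ^ a)).toLinearMap ∘ₗ P := by
      refine (MonoidAlgebra.basis G ℤ_[p]).ext fun g => ?_
      rw [MonoidAlgebra.basis_apply]
      simp only [AlgHom.toLinearMap_apply, LinearMap.comp_apply]
      have h3 : MonoidAlgebra.mapDomainAlgHom ℤ_[p] ℤ_[p] (powMonoidHom (α := G) a)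
          (MonoidAlgebra.single g 1) = MonoidAlgebra.single (g ^ a) 1 :=
        MonoidAlgebra.mapDomain_single
      rw [h3, hP, hφ, map_pow, he g, Units.val_pow_eq_pow_val, Units.val_pow_eq_pow_val, map_pow,
        Polynomial.aeval_X, ← pow_mul, ← pow_mul, mul_comm]
    exact LinearMap.congr_fun this y
  rw [e2]
  exact eval_pow_eq_zero_of_isPrimitiveRoot hK ha hprim _ (by rw [← e1, hx])

theorem algebraMap_padicInt_injective {R : Type*} [CommRing R] [IsDomain R] [Algebra ℤ_[p] R]
    (h : (p : R) ≠ 0) : Function.Injective (algebraMap ℤ_[p] R) := by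
  rw [injective_iff_map_eq_zero]
  intro z hz
  by_contra hne
  rw [PadicInt.unitCoeff_spec hne, map_mul, map_pow, map_natCast] at hz
  rcases mul_eq_zero.1 hz with h1 | h1
  · exact ((PadicInt.unitCoeff hne).isUnit.map (algebraMap ℤ_[p] R)).ne_zero h1
  · exact h (pow_eq_zero_iff (n := _) (by rintro h2; rw [h2, pow_zero] at h1; exact one_ne_zero h1) |>.1 h1)

/-- The annihilator of an element of `ℤ_p[G]`, `G` a finite abelian `p`-group, is contained in
that of its image under a power map prime to `p`. -/
theorem mapDomain_pow_mul_eq_zero {G : Type*} [CommGroup G] [Finite G] {n a : ℕ}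
    (hG : ∀ g : G, g ^ p ^ n = 1) (ha : a.Coprime p) (x y : MonoidAlgebra ℤ_[p] G)
    (hxy : x * y = 0) :
    MonoidAlgebra.mapDomainAlgHom ℤ_[p] ℤ_[p] (powMonoidHom a) x * y = 0 := by
  have hred := isReduced_monoidAlgebra (p := p) G
  set z := MonoidAlgebra.mapDomainAlgHom ℤ_[p] ℤ_[p] (powMonoidHom a) x * y
  -- As the ring is reduced, p * z vanishes as soon as it lies in every prime ideal. The factor p
  -- disposes of the primes containing p; for the others ℤ_p embeds in the residue field and the
  -- conjugacy of characters applies.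
  refine natCast_smul_injective_monoidAlgebra (Fact.out : p.Prime).ne_zero z ?_
  refine IsNilpotent.eq_zero (mem_nilradical.1 ?_)
  rw [nilradical_eq_sInf, Ideal.mem_sInf]
  intro 𝔮 (h𝔮 : 𝔮.IsPrime)
  by_cases hp : (p : MonoidAlgebra ℤ_[p] G) ∈ 𝔮
  · exact Ideal.mul_mem_right _ _ hp
  refine Ideal.mul_mem_left _ _ ?_
  have hq : x * y ∈ 𝔮 := by rw [hxy]; exact 𝔮.zero_mem
  rcases h𝔮.mem_or_mem hq with h | h
  · refine Ideal.mul_mem_right _ _ ?_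
    let K := FractionRing (MonoidAlgebra ℤ_[p] G ⧸ 𝔮)
    let φ : MonoidAlgebra ℤ_[p] G →ₐ[ℤ_[p]] K :=
      (Algebra.algHom ℤ_[p] (MonoidAlgebra ℤ_[p] G ⧸ 𝔮) K).comp (Ideal.Quotient.mkₐ ℤ_[p] 𝔮)
    have hφ : ∀ w, φ w = 0 ↔ w ∈ 𝔮 := by
      intro w
      rw [← Ideal.Quotient.eq_zero_iff_mem]
      exact map_eq_zero_iff _ (IsFractionRing.injective (MonoidAlgebra ℤ_[p] G ⧸ 𝔮) K)
    have hK : Function.Injective (algebraMap ℤ_[p] K) := by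
      refine algebraMap_padicInt_injective fun h0 => hp ((hφ _).1 ?_)
      rw [map_natCast, h0]
    exact (hφ _).1 (lift_mapDomain_pow_eq_zero hK hG ha φ x ((hφ x).2 h))
  · exact Ideal.mul_mem_left _ _ h

end GroupRing

/-! ### Discriminants and nilpotents in reductions of finite free algebras -/

section Discriminant

open Polynomial

theorem mem_map_algebraMap_iff_repr {A B ι : Type*} [CommRing A] [CommRing B] [Algebra A B]
    [Fintype ι] (b : Module.Basis ι A B) (𝔟 : Ideal A) (z : B) :
    z ∈ 𝔟.map (algebraMap A B) ↔ ∀ i, b.repr z i ∈ 𝔟 := by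
  constructor
  · intro h
    have h' : z ∈ (𝔟 • ⊤ : Submodule A B) := by
      rw [Ideal.smul_top_eq_map]; exact h
    refine Submodule.smul_induction_on h' ?_ ?_
    · intro r hr n _ i
      rw [map_smul, Finsupp.smul_apply]
      exact 𝔟.mul_mem_right _ hr
    · intro x y hx hy i
      rw [map_add, Finsupp.add_apply]
      exact 𝔟.add_mem (hx i) (hy i)
  · intro h
    rw [← b.sum_repr z]
    refine Ideal.sum_mem _ fun i _ => ?_
    rw [Algebra.smul_def]
    exact Ideal.mul_mem_right _ _ (Ideal.mem_map_of_mem _ (h i))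

/-- Multiplication by z is nilpotent modulo 𝔟, so its trace is nilpotent in the reduced ring A/𝔟. -/
theorem trace_mem_of_pow_mem {A B ι : Type*} [CommRing A] [CommRing B] [Algebra A B]
    [Fintype ι] [DecidableEq ι] (b : Module.Basis ι A B) (𝔟 : Ideal A) (h𝔟 : 𝔟.IsRadical) (z : B)
    {N : ℕ} (hz : z ^ N ∈ 𝔟.map (algebraMap A B)) : Algebra.trace A B z ∈ 𝔟 := by
  have : IsReduced (A ⧸ 𝔟) := (Ideal.isRadical_iff_quotient_reduced 𝔟).1 h𝔟
  set M := (Algebra.leftMulMatrix b z).map (Ideal.Quotient.mk 𝔟)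
  have hM : IsNilpotent M := by
    refine ⟨N, ?_⟩
    have e : M ^ N = ((Algebra.leftMulMatrix b (z ^ N)).map (Ideal.Quotient.mk 𝔟)) := by
      rw [map_pow]
      exact (map_pow (Ideal.Quotient.mk 𝔟).mapMatrix (Algebra.leftMulMatrix b z) N).symm
    rw [e]
    ext i j
    rw [Matrix.map_apply, Algebra.leftMulMatrix_eq_repr_mul, Matrix.zero_apply,
      Ideal.Quotient.eq_zero_iff_mem]
    exact (mem_map_algebraMap_iff_repr b 𝔟 _).1 (Ideal.mul_mem_right _ _ hz) i
  have h1 := (Matrix.isNilpotent_trace_of_isNilpotent hM).eq_zero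
  rw [Algebra.trace_eq_matrix_trace b, ← Ideal.Quotient.eq_zero_iff_mem, ← h1]
  simp [Matrix.trace, M]

/-- Inverting the nonzero elements of A turns B into a finite field extension in characteristic
zero, whose trace form is nondegenerate. -/
theorem discr_ne_zero_of_isDomain {A B ι : Type*} [CommRing A] [IsDomain A] [CharZero A]
    [CommRing B] [IsDomain B] [Algebra A B] [FaithfulSMul A B] [Fintype ι] [DecidableEq ι]
    (b : Module.Basis ι A B) :
    Algebra.discr A b ≠ 0 := by
  have : Module.Finite A B := Module.Finite.of_basis b
  let K := FractionRing A
  let M := nonZeroDivisors A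
  let L := Localization (Algebra.algebraMapSubmonoid B M)
  have hM : Algebra.algebraMapSubmonoid B M ≤ nonZeroDivisors B :=
    map_le_nonZeroDivisors_of_injective _ (FaithfulSMul.algebraMap_injective A B) le_rfl
  have : IsDomain L := IsLocalization.isDomain_localization hM
  let _ : Algebra K L := localizationAlgebra M B
  have hfin : Module.Finite K L := Module.Finite.of_basis (b.localizationLocalization K M L)
  let _ : Field L := (isField_of_isIntegral_of_isField' (R := K) (S := L) (Field.toIsField K)).toField
  have : CharZero K := inferInstance
  intro h
  have h1 := Algebra.discr_localizationLocalization A M (Rₘ := K) (Sₘ := L) b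
  rw [h, map_zero] at h1
  exact Algebra.discr_not_zero_of_basis K (b.localizationLocalization K M L) h1

/-- A multiple of the discriminant kills the nilpotent elements of all reductions. -/
theorem discr_mul_mem {A B ι : Type*} [CommRing A] [CommRing B] [Algebra A B]
    [Fintype ι] [DecidableEq ι] (b : Module.Basis ι A B) (𝔟 : Ideal A) (h𝔟 : 𝔟.IsRadical) (y : B)
    {N : ℕ} (hy : y ^ N ∈ 𝔟.map (algebraMap A B)) :
    algebraMap A B (Algebra.discr A b) * y ∈ 𝔟.map (algebraMap A B) := by
  rw [mem_map_algebraMap_iff_repr b]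
  have h1 : ∀ i, (Algebra.traceMatrix A b).mulVec (b.repr y) i ∈ 𝔟 := by
    intro i
    have : (Algebra.traceMatrix A b).mulVec (b.repr y) i = Algebra.trace A B (b i * y) := by
      conv_rhs => rw [← b.sum_repr y]
      rw [Finset.mul_sum, map_sum, Matrix.mulVec, dotProduct]
      refine Finset.sum_congr rfl fun j _ => ?_
      rw [Algebra.traceMatrix_apply, Algebra.traceForm_apply, mul_smul_comm, map_smul,
        smul_eq_mul, mul_comm]
    rw [this]
    refine trace_mem_of_pow_mem b 𝔟 h𝔟 _ (N := N) ?_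
    rw [mul_pow]
    exact Ideal.mul_mem_left _ _ hy
  intro i
  -- Cramer's rule: the adjugate turns the trace matrix into its determinant, the discriminant.
  have h2 : (Algebra.traceMatrix A b).adjugate.mulVec
      ((Algebra.traceMatrix A b).mulVec (b.repr y)) i ∈ 𝔟 := by
    rw [Matrix.mulVec, dotProduct]
    exact Ideal.sum_mem _ fun j _ => 𝔟.mul_mem_left _ (h1 j)
  rw [Matrix.mulVec_mulVec, Matrix.adjugate_mul, Matrix.smul_mulVec, Matrix.one_mulVec] at h2
  rw [← Algebra.smul_def, map_smul]
  exact h2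

end Discriminant
end IwasawaTower

/-! ### Separating elements by maps to `R ⧸ π ^ k` -/

namespace IwasawaTower

section Separation

theorem exists_linearMap_quotient_pow_ne_zero_of_dvr {A : Type*} {M : Type*} [CommRing A]
    [IsDomain A] [IsDiscreteValuationRing A] {ϖ : A} (hϖ : Irreducible ϖ) [AddCommGroup M]
    [Module A M] [Module.Finite A M] (y : M) (hy : y ≠ 0) :
    ∃ (k : ℕ) (ψ : M →ₗ[A] A ⧸ Ideal.span {ϖ ^ k}), ψ y ≠ 0 := by
  classical
  obtain ⟨n, ι, _, q, hq, e, ⟨E⟩⟩ := Module.equiv_free_prod_directSum A M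
  have hE : E y ≠ 0 := fun h => hy (E.map_eq_zero_iff.1 h)
  -- For a nonzero torsion component, k is the exponent of its cyclic summand; for a nonzero free
  -- coordinate, k is any exponent for which ϖ ^ k does not divide it.
  by_cases h1 : (E y).1 = 0
  · have h2 : (E y).2 ≠ 0 := fun h => hE (Prod.ext h1 h)
    obtain ⟨i, hi⟩ : ∃ i, (E y).2 i ≠ 0 := by
      by_contra! hcon
      exact h2 (DFinsupp.ext hcon)
    have hspan : Ideal.span {ϖ ^ e i} = A ∙ q i ^ e i :=
      Ideal.span_singleton_eq_span_singleton.2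
        ((IsDiscreteValuationRing.associated_of_irreducible A hϖ (hq i)).pow_pow)
    refine ⟨e i, (Submodule.quotEquivOfEq _ _ hspan.symm).toLinearMap ∘ₗ
      DirectSum.component A ι _ i ∘ₗ LinearMap.snd _ _ _ ∘ₗ E.toLinearMap, ?_⟩
    intro h
    exact hi ((Submodule.quotEquivOfEq _ _ hspan.symm).map_eq_zero_iff.1 h)
  · obtain ⟨i, hi⟩ : ∃ i, (E y).1 i ≠ 0 := by
      by_contra! hcon
      exact h1 (Finsupp.ext hcon)
    obtain ⟨k, hk⟩ : ∃ k, (E y).1 i ∉ Ideal.span {ϖ ^ k} := by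
      by_contra! hcon
      refine hi (IsHausdorff.haus' (I := IsLocalRing.maximalIdeal A) _ fun k => ?_)
      rw [SModEq.zero, smul_eq_mul, Ideal.mul_top, hϖ.maximalIdeal_eq, Ideal.span_singleton_pow]
      exact hcon k
    refine ⟨k, (Submodule.mkQ _) ∘ₗ Finsupp.lapply i ∘ₗ LinearMap.fst _ _ _ ∘ₗ E.toLinearMap, ?_⟩
    intro h
    exact hk ((Submodule.Quotient.mk_eq_zero _).1 h)

/-- An element of a finitely generated module that survives in the localization at a principal
prime ideal `(π)` is detected by a homomorphism to some `R / (π ^ k)`. -/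
theorem exists_linearMap_quotient_pow_ne_zero {R Y : Type*} [CommRing R] [IsDomain R]
    [IsNoetherianRing R] [AddCommGroup Y] [Module R Y] [Module.Finite R Y] {π : R} (hπ : Prime π)
    (y : Y) (hy : ∀ s, ¬ π ∣ s → s • y ≠ 0) :
    ∃ (k : ℕ) (φ : Y →ₗ[R] R ⧸ Ideal.span {π ^ k}), φ y ≠ 0 := by
  classical
  set P : Ideal R := Ideal.span {π}
  have hP : P.IsPrime := (Ideal.span_singleton_prime hπ.ne_zero).2 hπ
  let A := Localization.AtPrime P
  have hinj : Function.Injective (algebraMap R A) :=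
    IsLocalization.injective A P.primeCompl_le_nonZeroDivisors
  have hmax : IsLocalRing.maximalIdeal A = Ideal.span {algebraMap R A π} := by
    rw [← Localization.AtPrime.map_eq_maximalIdeal, Ideal.map_span, Set.image_singleton]
  have hϖ0 : algebraMap R A π ≠ 0 := fun h => hπ.ne_zero (hinj (by rw [h, map_zero]))
  have hfield : ¬ IsField A := by
    rw [IsLocalRing.isField_iff_maximalIdeal_eq, hmax, Ideal.span_singleton_eq_bot]
    exact hϖ0
  have hdvr : IsDiscreteValuationRing A := by
    have h04 := (IsDiscreteValuationRing.TFAE A hfield).out 0 4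
    exact h04.2 ⟨_, hmax⟩
  have hϖ : Irreducible (algebraMap R A π) :=
    (IsDiscreteValuationRing.irreducible_iff_uniformizer _).2 hmax
  let M := LocalizedModule P.primeCompl Y
  let f : Y →ₗ[R] M := LocalizedModule.mkLinearMap P.primeCompl Y
  have hfy : f y ≠ 0 := by
    intro h
    obtain ⟨s, hs⟩ := (IsLocalizedModule.eq_zero_iff P.primeCompl f).1 h
    exact hy s.1 (fun hd => s.2 (Ideal.mem_span_singleton.2 hd)) hs
  obtain ⟨k, ψ, hψ⟩ := exists_linearMap_quotient_pow_ne_zero_of_dvr hϖ (f y) hfy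
  let 𝔞 : Ideal A := Ideal.span {algebraMap R A π ^ k}
  let g : Y →ₗ[R] A ⧸ 𝔞 := (ψ.restrictScalars R) ∘ₗ f
  let j : (R ⧸ Ideal.span {π ^ k}) →ₗ[R] A ⧸ 𝔞 :=
    Submodule.mapQ _ (𝔞.restrictScalars R) (Algebra.linearMap R A) (by
      rw [Ideal.span_le, Set.singleton_subset_iff]
      show algebraMap R A (π ^ k) ∈ 𝔞
      rw [map_pow]; exact Ideal.mem_span_singleton_self _)
  have hjmk : ∀ r : R, j (Submodule.Quotient.mk r) = Ideal.Quotient.mk 𝔞 (algebraMap R A r) :=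
    fun r => rfl
  have hj : Function.Injective j := by
    rw [injective_iff_map_eq_zero]
    intro z hz
    obtain ⟨r, rfl⟩ := Submodule.Quotient.mk_surjective _ z
    rw [hjmk, Ideal.Quotient.eq_zero_iff_mem, Ideal.mem_span_singleton] at hz
    obtain ⟨c, hc⟩ := hz
    obtain ⟨⟨a, s⟩, ha⟩ := IsLocalization.surj P.primeCompl c
    have h1 : s.1 * r = π ^ k * a := hinj (by
      rw [map_mul, map_mul, map_pow, hc, ← ha]; ring)
    refine (Submodule.Quotient.mk_eq_zero _).2 (Ideal.mem_span_singleton.2 ?_)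
    refine hπ.pow_dvd_of_dvd_mul_left k (fun hd => s.2 (Ideal.mem_span_singleton.2 hd)) ?_
    exact ⟨a, h1⟩
  -- The map g takes values in A/𝔞, of which R/(π^k) is a submodule. Each value enters this
  -- submodule after multiplication by an element prime to π; the product s over generators of Y
  -- serves for all of Y, and being a unit in A it does not destroy the non-vanishing.
  have hden : ∀ z : A ⧸ 𝔞, ∃ s : R, ¬ π ∣ s ∧ s • z ∈ LinearMap.range j := by
    intro z
    obtain ⟨c, rfl⟩ := Ideal.Quotient.mk_surjective z
    obtain ⟨⟨a, s⟩, ha⟩ := IsLocalization.surj P.primeCompl c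
    refine ⟨s.1, fun hd => s.2 (Ideal.mem_span_singleton.2 hd), Submodule.Quotient.mk a, ?_⟩
    show Ideal.Quotient.mk 𝔞 (algebraMap R A a) = Ideal.Quotient.mk 𝔞 (s.1 • c)
    rw [← ha, Algebra.smul_def, mul_comm]
  choose den hden1 hden2 using hden
  obtain ⟨S, hS⟩ := Module.Finite.fg_top (R := R) (M := Y)
  set s := ∏ w ∈ S, den (g w)
  have hs : ¬ π ∣ s := by
    rw [hπ.dvd_finsetProd_iff]
    push Not
    exact fun w _ => hden1 _
  have hrange : ∀ w, (s • g) w ∈ LinearMap.range j := by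
    intro w
    have : (⊤ : Submodule R Y) ≤ (LinearMap.range j).comap (s • g) := by
      rw [← hS, Submodule.span_le]
      intro w hw
      show (s • g) w ∈ LinearMap.range j
      rw [LinearMap.smul_apply, show s = _ from (Finset.prod_erase_mul S _ hw).symm, mul_smul]
      exact Submodule.smul_mem _ _ (hden2 _)
    exact this trivial
  let φ : Y →ₗ[R] R ⧸ Ideal.span {π ^ k} :=
    (LinearEquiv.ofInjective j hj).symm.toLinearMap ∘ₗ LinearMap.codRestrict _ (s • g) hrange
  refine ⟨k, φ, fun h => hψ ?_⟩
  have h1 : (⟨(s • g) y, hrange y⟩ : LinearMap.range j) = 0 :=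
    (LinearEquiv.ofInjective j hj).symm.map_eq_zero_iff.1 h
  have h2 : s • ψ (f y) = 0 := congrArg Subtype.val h1
  rw [← algebraMap_smul A] at h2
  have hu : IsUnit (algebraMap R A s) := IsLocalization.map_units A
    (⟨s, fun hd => hs (Ideal.mem_span_singleton.1 hd)⟩ : P.primeCompl)
  exact hu.smul_eq_zero.1 h2

end Separation
end IwasawaTower

/-! ### Iwasawa rings -/

namespace IwasawaTower

section IwasawaRing

open PowerSeries

/-- The ideal generated by the `(1 + x i) ^ p ^ n - 1`. -/
def omegaIdeal (p : ℕ) {ι A : Type*} [CommRing A] (x : ι → A) (n : ℕ) : Ideal A :=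
  Ideal.span (Set.range fun i => (1 + x i) ^ p ^ n - 1)

/-- The ideal generated by `p` and the `x i`. -/
def parameterIdeal (p : ℕ) {ι A : Type*} [CommRing A] (x : ι → A) : Ideal A :=
  Ideal.span (insert (p : A) (Set.range x))

/-- A list of properties that characterize `ℤ_p[[T_1, …, T_d]]` with its variables `x`. -/
structure IsIwasawaRing (p : ℕ) [Fact p.Prime] {d : ℕ} {A : Type*} [CommRing A]
    [Algebra ℤ_[p] A] (x : Fin d → A) : Prop where
  noeth : IsNoetherianRing A
  maximal : (parameterIdeal p x).IsMaximal
  complete : IsAdicComplete (parameterIdeal p x) A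
  residue : ∀ a : A, ∃ z : ℤ_[p], a - algebraMap ℤ_[p] A z ∈ parameterIdeal p x
  free : ∀ n, Module.Free ℤ_[p] (A ⧸ omegaIdeal p x n)
  finrank : ∀ n, Module.finrank ℤ_[p] (A ⧸ omegaIdeal p x n) = p ^ (n * d)

/-- Raising y ≡ 1 to the p-th power multiplies y - 1 by a sum of p terms congruent to 1 modulo I,
hence by an element of I. -/
theorem one_add_pow_sub_one_mem_pow {p : ℕ} {A : Type*} [CommRing A] {I : Ideal A} (hp : (p : A) ∈ I)
    {x : A} (hx : x ∈ I) (n : ℕ) : (1 + x) ^ p ^ n - 1 ∈ I ^ (n + 1) := by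
  induction n with
  | zero => simpa using hx
  | succ n ih =>
    set y := (1 + x) ^ p ^ n with hy
    have e : (1 + x) ^ p ^ (n + 1) - 1 = (∑ i ∈ Finset.range p, y ^ i) * (y - 1) := by
      rw [geom_sum_mul, hy, ← pow_mul, pow_succ]
    have hyI : y - 1 ∈ I := Ideal.pow_le_self (by omega) ih
    have h2 : ∑ i ∈ Finset.range p, y ^ i ∈ I := by
      rw [← Ideal.Quotient.eq_zero_iff_mem, map_sum]
      have : Ideal.Quotient.mk I y = 1 := by
        rw [← sub_eq_zero, ← map_one (Ideal.Quotient.mk I), ← map_sub]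
        exact Ideal.Quotient.eq_zero_iff_mem.2 hyI
      simp only [map_pow, this, one_pow, Finset.sum_const, Finset.card_range, nsmul_eq_mul, mul_one]
      rw [← map_natCast (Ideal.Quotient.mk I)]
      exact Ideal.Quotient.eq_zero_iff_mem.2 hp
    rw [e, pow_succ']
    exact Ideal.mul_mem_mul h2 ih

theorem one_add_pow_sub_one_dvd {p : ℕ} {A : Type*} [CommRing A] (y : A) {n m : ℕ} (h : n ≤ m) :
    y ^ p ^ n - 1 ∣ y ^ p ^ m - 1 := by
  obtain ⟨k, rfl⟩ := Nat.exists_eq_add_of_le h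
  have := sub_dvd_pow_sub_pow (y ^ p ^ n) 1 (p ^ k)
  rwa [one_pow, ← pow_mul, ← pow_add] at this

variable {p : ℕ} [Fact p.Prime]

namespace IsIwasawaRing

variable {d : ℕ} {A : Type*} [CommRing A] [Algebra ℤ_[p] A] {x : Fin d → A}

theorem isLocalRing (h : IsIwasawaRing p x) : IsLocalRing A :=
  have := h.maximal
  have := h.complete
  isLocalRing_of_isAdicComplete_maximal (parameterIdeal p x)

theorem maximalIdeal_eq (h : IsIwasawaRing p x) [IsLocalRing A] :
    IsLocalRing.maximalIdeal A = parameterIdeal p x :=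
  (IsLocalRing.eq_maximalIdeal h.maximal).symm

theorem isAdicComplete (h : IsIwasawaRing p x) [IsLocalRing A] :
    IsAdicComplete (IsLocalRing.maximalIdeal A) A := by
  rw [h.maximalIdeal_eq]; exact h.complete

theorem p_mem (p : ℕ) {ι A : Type*} [CommRing A] (x : ι → A) : (p : A) ∈ parameterIdeal p x :=
  Ideal.subset_span (Set.mem_insert _ _)

theorem x_mem (p : ℕ) {ι A : Type*} [CommRing A] (x : ι → A) (i : ι) : x i ∈ parameterIdeal p x :=
  Ideal.subset_span (Set.mem_insert_of_mem _ ⟨i, rfl⟩)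

theorem omegaIdeal_le {ι A : Type*} [CommRing A] (x : ι → A) (n : ℕ) :
    omegaIdeal p x n ≤ parameterIdeal p x ^ (n + 1) := by
  rw [omegaIdeal, Ideal.span_le]
  rintro _ ⟨i, rfl⟩
  exact one_add_pow_sub_one_mem_pow (p_mem p x) (x_mem p x i) n

theorem omegaIdeal_anti {ι A : Type*} [CommRing A] (x : ι → A) :
    Antitone (omegaIdeal p x) := by
  intro n m h
  rw [omegaIdeal, Ideal.span_le]
  rintro _ ⟨i, rfl⟩
  have := one_add_pow_sub_one_dvd (p := p) (1 + x i) h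
  exact Ideal.mem_of_dvd _ this (Ideal.subset_span ⟨i, rfl⟩)

theorem padicInt : IsIwasawaRing p (Fin.elim0 : Fin 0 → ℤ_[p]) := by
  have hI : parameterIdeal p (Fin.elim0 : Fin 0 → ℤ_[p]) = IsLocalRing.maximalIdeal ℤ_[p] := by
    rw [parameterIdeal, Set.range_eq_empty, PadicInt.maximalIdeal_eq_span_p]
    simp
  have hbot : ∀ n, omegaIdeal p (Fin.elim0 : Fin 0 → ℤ_[p]) n = ⊥ := fun n => by
    rw [omegaIdeal, Set.range_eq_empty, Ideal.span_empty]
  have E : ∀ n, (ℤ_[p] ⧸ omegaIdeal p (Fin.elim0 : Fin 0 → ℤ_[p]) n) ≃ₗ[ℤ_[p]] ℤ_[p] := fun n =>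
    Submodule.quotEquivOfEqBot _ (hbot n)
  refine ⟨inferInstance, ?_, ?_, fun a => ⟨a, by simp⟩, fun n => ?_, fun n => ?_⟩
  · rw [hI]; infer_instance
  · rw [hI]; infer_instance
  · exact Module.Free.of_equiv (E n).symm
  · rw [(E n).finrank_eq]; simp

theorem parameterIdeal_cons (p : ℕ) {d : ℕ} {A : Type*} [CommRing A] (x : Fin d → A) :
    parameterIdeal p (Fin.cons X (fun i => C (x i)) : Fin (d + 1) → A⟦X⟧) =
      powerSeriesIdeal (parameterIdeal p x) := by
  rw [parameterIdeal, parameterIdeal, powerSeriesIdeal, Ideal.map_span, ← Ideal.span_union,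
    Fin.range_cons, Set.image_insert_eq, ← Set.range_comp]
  congr 1
  ext f
  simp only [Set.mem_insert_iff, Set.mem_union, Set.mem_singleton_iff, map_natCast]
  rw [show (fun i => C (x i)) = C ∘ x from rfl]
  tauto

theorem mem_powerSeriesIdeal_iff {A : Type*} [CommRing A] (I : Ideal A) (f : A⟦X⟧) :
    f ∈ powerSeriesIdeal I ↔ constantCoeff f ∈ I := by
  constructor
  · intro h
    have := coeff_mem_of_mem_powerSeriesIdeal_pow I 1 f (by simpa using h) 0
    simpa using this
  · intro h
    have := mem_powerSeriesIdeal_pow I 1 f fun i => by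
      cases i with
      | zero => simpa using h
      | succ i => simp
    simpa using this

theorem omegaIdeal_cons (p : ℕ) {d : ℕ} {A : Type*} [CommRing A] (x : Fin d → A) (n : ℕ) :
    omegaIdeal p (Fin.cons X (fun i => C (x i)) : Fin (d + 1) → A⟦X⟧) n =
      Ideal.span {(1 + X) ^ p ^ n - 1} ⊔ (omegaIdeal p x n).map (C (R := A)) := by
  rw [omegaIdeal, omegaIdeal, Ideal.map_span, ← Ideal.span_union, ← Set.range_comp]
  congr 1
  ext f
  simp only [Set.mem_range, Set.mem_union, Set.mem_singleton_iff, Fin.exists_fin_succ,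
    Fin.cons_zero, Fin.cons_succ, Function.comp_apply, map_sub, map_pow, map_add, map_one,
    eq_comm]

open Polynomial in
/-- Weierstrass division by `(1 + X) ^ p ^ n - 1` modulo an ideal of the coefficients. -/
theorem exists_quotient_equiv {A : Type*} [CommRing A] [IsLocalRing A] [IsNoetherianRing A]
    [IsAdicComplete (IsLocalRing.maximalIdeal A) A] [Algebra ℤ_[p] A]
    (hp : (p : A) ∈ IsLocalRing.maximalIdeal A) (𝔟 : Ideal A) (n : ℕ) :
    Nonempty ((A⟦X⟧ ⧸ (Ideal.span {((1 + PowerSeries.X) ^ p ^ n - 1 : A⟦X⟧)} ⊔ 𝔟.map (PowerSeries.C (R := A))))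
      ≃ₗ[ℤ_[p]] (Fin (p ^ n) → A ⧸ 𝔟)) := by
  set g : A⟦X⟧ := (1 + PowerSeries.X) ^ p ^ n - 1
  have hchar : CharP (IsLocalRing.ResidueField A) p := by
    rw [CharP.charP_iff_prime_eq_zero (Fact.out : p.Prime), ← map_natCast (IsLocalRing.residue A)]
    exact Ideal.Quotient.eq_zero_iff_mem.2 hp
  -- By Frobenius g reduces to a power of X, so remainders of Weierstrass division by g have exactly
  -- p ^ n coefficients.
  have hmap : g.map (IsLocalRing.residue A) = PowerSeries.X ^ p ^ n := by
    have : CharP (PowerSeries (IsLocalRing.ResidueField A)) p :=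
      charP_of_injective_ringHom (f := PowerSeries.C) PowerSeries.C_injective p
    simp only [g, map_sub, map_pow, map_add, map_one, PowerSeries.map_X]
    rw [add_pow_char_pow]; simp
  have hg0 : g.map (IsLocalRing.residue A) ≠ 0 := by
    rw [hmap]; exact pow_ne_zero _ PowerSeries.X_ne_zero
  have hord : (g.map (Ideal.Quotient.mk (IsLocalRing.maximalIdeal A))).order.toNat = p ^ n := by
    have : g.map (Ideal.Quotient.mk (IsLocalRing.maximalIdeal A)) = PowerSeries.X ^ p ^ n := hmap
    rw [this]
    have : Nontrivial (A ⧸ IsLocalRing.maximalIdeal A) :=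
      inferInstanceAs (Nontrivial (IsLocalRing.ResidueField A))
    rw [PowerSeries.order_X_pow]; rfl
  have H : g.IsWeierstrassDivisorAt (IsLocalRing.maximalIdeal A) :=
    PowerSeries.IsWeierstrassDivisor.of_map_ne_zero hg0
  let ρ : A⟦X⟧ →ₗ[A] (Fin (p ^ n) → A ⧸ 𝔟) :=
    { toFun := fun f i => Ideal.Quotient.mk 𝔟 ((H.mod f).coeff i)
      map_add' := fun f f' => by
        ext i; simp
      map_smul' := fun a f => by
        ext i; rw [H.mod_smul]; simp [Algebra.smul_def] }
  have hρ : ∀ f i, ρ f i = Ideal.Quotient.mk 𝔟 ((H.mod f).coeff i) := fun f i => rfl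
  have hgmod : ∀ h, H.mod (g * h) = 0 := by
    intro h
    have h1 := H.isWeierstrassDivisionAt_div_mod (g * h)
    refine (H.eq_of_mul_add_eq_mul_add (q := H.div (g * h)) (q' := h) h1.degree_lt ?_ ?_).2
    · rw [Polynomial.degree_zero]; exact WithBot.bot_lt_coe _
    · rw [← h1.eq_mul_add]; simp
  have hker : LinearMap.ker (ρ.restrictScalars ℤ_[p]) =
      (Ideal.span {g} ⊔ 𝔟.map (PowerSeries.C (R := A))).restrictScalars ℤ_[p] := by
    ext f
    rw [LinearMap.mem_ker, LinearMap.restrictScalars_apply, Submodule.restrictScalars_mem]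
    constructor
    · intro hf
      have h1 := H.isWeierstrassDivisionAt_div_mod f
      rw [h1.eq_mul_add]
      refine Submodule.add_mem_sup (Ideal.mul_mem_right _ _ (Ideal.mem_span_singleton_self _)) ?_
      rw [mem_map_C_iff]
      intro i
      rw [Polynomial.coeff_coe]
      by_cases hi : i < p ^ n
      · have := congrFun hf ⟨i, hi⟩
        exact Ideal.Quotient.eq_zero_iff_mem.1 this
      · have h2 := h1.degree_lt
        rw [hord] at h2
        rw [Polynomial.coeff_eq_zero_of_degree_lt (lt_of_lt_of_le h2 (by exact_mod_cast not_lt.1 hi))]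
        exact 𝔟.zero_mem
    · intro hf
      obtain ⟨u, hu, b, hb, rfl⟩ := Submodule.mem_sup.1 hf
      obtain ⟨h, rfl⟩ := Ideal.mem_span_singleton.1 hu
      rw [map_add]
      have h1 : ρ (g * h) = 0 := by ext i; rw [hρ, hgmod]; simp
      rw [h1, zero_add]
      -- The factor 1 is then generalised to an arbitrary h, so that the induction over the span can
      -- absorb ring multipliers.
      rw [← one_mul b]
      refine Submodule.span_induction ?_ ?_ ?_ ?_ hb (p := fun b _ => ∀ h, ρ (h * b) = 0) 1
      · rintro _ ⟨a, ha, rfl⟩ h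
        rw [mul_comm, ← PowerSeries.smul_eq_C_mul, map_smul]
        ext i
        rw [Pi.smul_apply, Algebra.smul_def, Ideal.Quotient.algebraMap_eq,
          Ideal.Quotient.eq_zero_iff_mem.2 ha, zero_mul]; rfl
      · intro h; simp
      · intro x y _ _ hx hy h; rw [mul_add, map_add, hx, hy, add_zero]
      · intro r x _ hx h; rw [smul_eq_mul, ← mul_assoc]; exact hx _
  have hsurj : Function.Surjective (ρ.restrictScalars ℤ_[p]) := by
    intro c
    choose c' hc' using fun i => Ideal.Quotient.mk_surjective (c i)
    let r : A[X] := ∑ i : Fin (p ^ n), Polynomial.monomial i (c' i)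
    have hr : r.degree < (p ^ n : ℕ) := by
      refine (Polynomial.degree_sum_le _ _).trans_lt ?_
      rw [Finset.sup_lt_iff (WithBot.bot_lt_coe _)]
      intro i _
      exact (Polynomial.degree_monomial_le _ _).trans_lt (by exact_mod_cast i.2)
    refine ⟨r, ?_⟩
    ext i
    rw [LinearMap.restrictScalars_apply, hρ, H.mod_coe_eq_self (by rw [hord]; exact hr), ← hc' i]
    congr 1
    simp only [r, Polynomial.finsetSum_coeff, Polynomial.coeff_monomial]
    rw [Finset.sum_eq_single i]
    · simp
    · intro j _ hj; rw [if_neg (fun h => hj (Fin.ext h))]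
    · simp
  exact ⟨((Submodule.Quotient.restrictScalarsEquiv ℤ_[p] _).symm.trans
    (Submodule.quotEquivOfEq _ _ hker.symm)).trans
      ((ρ.restrictScalars ℤ_[p]).quotKerEquivOfSurjective hsurj)⟩

/-- The new variable contributes the factor p^n to the rank, since by Weierstrass division the
quotient by the ω's is p^n copies of the quotient of A. -/
theorem powerSeries (h : IsIwasawaRing p x) :
    IsIwasawaRing p (Fin.cons X (fun i => C (x i)) : Fin (d + 1) → A⟦X⟧) := by
  have := h.noeth
  have := h.isLocalRing
  have := h.isAdicComplete
  have := h.complete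
  have hmax : (powerSeriesIdeal (parameterIdeal p x)).IsMaximal := by
    have : powerSeriesIdeal (parameterIdeal p x) =
        (parameterIdeal p x).comap (constantCoeff (R := A)) := by
      ext f; rw [mem_powerSeriesIdeal_iff, Ideal.mem_comap]
    rw [this]
    have := h.maximal
    exact Ideal.comap_isMaximal_of_surjective _ constantCoeff_surj
  have E : ∀ n, Nonempty ((A⟦X⟧ ⧸ omegaIdeal p
      (Fin.cons X (fun i => C (x i)) : Fin (d + 1) → A⟦X⟧) n)
      ≃ₗ[ℤ_[p]] (Fin (p ^ n) → A ⧸ omegaIdeal p x n)) := by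
    intro n
    rw [omegaIdeal_cons]
    exact exists_quotient_equiv (by rw [h.maximalIdeal_eq]; exact p_mem p x) _ n
  have hfree := h.free
  have hfin : ∀ n, Module.Finite ℤ_[p] (A ⧸ omegaIdeal p x n) := fun n => by
    refine Module.finite_of_finrank_pos ?_
    rw [h.finrank]; exact pow_pos (Fact.out : p.Prime).pos _
  refine ⟨inferInstance, ?_, ?_, ?_, fun n => ?_, fun n => ?_⟩
  · rw [parameterIdeal_cons]; exact hmax
  · rw [parameterIdeal_cons]; exact isAdicComplete_powerSeriesIdeal _
  · intro f
    obtain ⟨z, hz⟩ := h.residue (constantCoeff f)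
    refine ⟨z, ?_⟩
    rw [parameterIdeal_cons, mem_powerSeriesIdeal_iff, map_sub]
    convert hz using 2
    rw [PowerSeries.algebraMap_apply]; simp
  · exact Module.Free.of_equiv (E n).some.symm
  · rw [(E n).some.finrank_eq, Module.finrank_pi_fintype]
    simp only [h.finrank, Finset.sum_const, Finset.card_univ, Fintype.card_fin, smul_eq_mul]
    rw [← pow_add]; ring_nf

end IsIwasawaRing
end IwasawaRing
end IwasawaTower

/-! ### The layers `ℤ_p[Γ / Γ ^ (p ^ n)]` -/

namespace IwasawaTower

noncomputable section

section Levels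

open Multiplicative

variable {p : ℕ} [Fact p.Prime] {Γ : Type*} [CommGroup Γ] [TopologicalSpace Γ] {d : ℕ}
  (e : Multiplicative (Fin d → ℤ_[p]) ≃ₜ* Γ)

/-- The coordinates modulo `p ^ n` of an element of `Γ ≅ ℤ_p^d`. -/
def coordHom (n : ℕ) : Γ →* Multiplicative (Fin d → ZMod (p ^ n)) where
  toFun g := ofAdd fun i => PadicInt.toZModPow n (toAdd (e.symm g) i)
  map_one' := by rw [map_one]; ext i; simp
  map_mul' a b := by rw [map_mul]; ext i; simp

theorem coordHom_apply (n : ℕ) (g : Γ) (i : Fin d) :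
    toAdd (coordHom e n g) i = PadicInt.toZModPow n (toAdd (e.symm g) i) := rfl

theorem mem_ker_coordHom (n : ℕ) (g : Γ) :
    g ∈ (coordHom e n).ker ↔ ∀ i, (p : ℤ_[p]) ^ n ∣ toAdd (e.symm g) i := by
  have : ∀ z : ℤ_[p], PadicInt.toZModPow n z = 0 ↔ (p : ℤ_[p]) ^ n ∣ z := by
    intro z
    rw [← RingHom.mem_ker, PadicInt.ker_toZModPow, Ideal.mem_span_singleton]
  simp only [← this]
  constructor
  · intro h i
    rw [← coordHom_apply, h]; rfl
  · intro h
    exact toAdd.injective (funext h)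

/-- The open subgroup `Γ ^ (p ^ n)`. -/
def level (n : ℕ) : OpenSubgroup Γ where
  toSubgroup := (coordHom e n).ker
  isOpen' := by
    have h1 : IsOpen {v : Fin d → ℤ_[p] | ∀ i, v i ∈ Metric.closedBall (0 : ℤ_[p]) ((p : ℝ) ^ (-n : ℤ))} := by
      rw [Set.ofPred_forall]
      refine isOpen_iInter_of_finite fun i => ?_
      refine (IsUltrametricDist.isOpen_closedBall _ ?_).preimage (continuous_apply i)
      exact (zpow_pos (by exact_mod_cast (Fact.out : p.Prime).pos) _).ne'
    have h2 : IsOpen ((fun g : Γ => toAdd (e.symm g)) ⁻¹'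
        {v : Fin d → ℤ_[p] | ∀ i, v i ∈ Metric.closedBall (0 : ℤ_[p]) ((p : ℝ) ^ (-n : ℤ))}) :=
      h1.preimage (continuous_toAdd.comp e.symm.continuous)
    convert h2 using 1
    ext g
    show g ∈ (coordHom e n).ker ↔ _
    rw [mem_ker_coordHom]
    refine forall_congr' fun i => ?_
    rw [mem_closedBall_zero_iff, PadicInt.norm_le_pow_iff_mem_span_pow, Ideal.mem_span_singleton]

theorem mem_level (n : ℕ) (g : Γ) :
    g ∈ level e n ↔ ∀ i, (p : ℤ_[p]) ^ n ∣ toAdd (e.symm g) i := mem_ker_coordHom e n g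

theorem level_anti : Antitone (level e) := by
  intro n m h g hg
  rw [mem_level] at hg ⊢
  exact fun i => (pow_dvd_pow _ h).trans (hg i)

/-- The subgroups Γ^{p^n} form a neighbourhood basis of 1, so they are cofinal among the open
subgroups and Λ_Γ is determined by these levels. -/
theorem exists_level_subset {O : Set Γ} (hO : IsOpen O) (h1 : 1 ∈ O) :
    ∃ n, (level e n : Set Γ) ⊆ O := by
  have hO' : IsOpen ((fun v : Fin d → ℤ_[p] => e (ofAdd v)) ⁻¹' O) :=
    hO.preimage (e.continuous.comp continuous_ofAdd)
  have h0 : (0 : Fin d → ℤ_[p]) ∈ ((fun v : Fin d → ℤ_[p] => e (ofAdd v)) ⁻¹' O) := by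
    show e (ofAdd 0) ∈ O
    rwa [ofAdd_zero, map_one]
  obtain ⟨ε, hε, hball⟩ := Metric.isOpen_iff.1 hO' 0 h0
  obtain ⟨n, hn⟩ := exists_pow_lt_of_lt_one hε
    (show (p : ℝ)⁻¹ < 1 from inv_lt_one_of_one_lt₀ (by exact_mod_cast (Fact.out : p.Prime).one_lt))
  refine ⟨n, fun g hg => ?_⟩
  have hmem : toAdd (e.symm g) ∈ Metric.ball (0 : Fin d → ℤ_[p]) ε := by
    rw [mem_ball_zero_iff]
    refine lt_of_le_of_lt ((pi_norm_le_iff_of_nonneg (by positivity)).2 fun i => ?_) hn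
    rw [inv_pow, ← zpow_natCast, ← zpow_neg, PadicInt.norm_le_pow_iff_mem_span_pow,
      Ideal.mem_span_singleton]
    exact (mem_level e n g).1 hg i
  have h3 : e (ofAdd (toAdd (e.symm g))) ∈ O := hball hmem
  rwa [ofAdd_toAdd, ContinuousMulEquiv.apply_symm_apply] at h3

theorem exists_level_le (U : OpenSubgroup Γ) : ∃ n, level e n ≤ U :=
  exists_level_subset e U.isOpen U.one_mem

theorem coordHom_surjective (n : ℕ) : Function.Surjective (coordHom e n) := by
  intro c
  have : NeZero (p ^ n) := ⟨pow_ne_zero _ (Fact.out : p.Prime).ne_zero⟩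
  refine ⟨e (ofAdd fun i => ((toAdd c i).val : ℤ_[p])), ?_⟩
  apply toAdd.injective
  funext i
  rw [coordHom_apply, ContinuousMulEquiv.symm_apply_apply, toAdd_ofAdd, map_natCast,
    ZMod.natCast_zmod_val]

/-- `Γ / Γ ^ (p ^ n) ≃ (ℤ / p ^ n) ^ d`. -/
def levelQuotientEquiv (n : ℕ) :
    Γ ⧸ (level e n).toSubgroup ≃* Multiplicative (Fin d → ZMod (p ^ n)) :=
  QuotientGroup.quotientKerEquivOfSurjective (coordHom e n) (coordHom_surjective e n)

theorem finite_level_quotient (n : ℕ) : Finite (Γ ⧸ (level e n).toSubgroup) := by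
  have : NeZero (p ^ n) := ⟨pow_ne_zero _ (Fact.out : p.Prime).ne_zero⟩
  exact Finite.of_equiv _ (levelQuotientEquiv e n).symm.toEquiv

theorem card_level_quotient (n : ℕ) : Nat.card (Γ ⧸ (level e n).toSubgroup) = p ^ (n * d) := by
  rw [Nat.card_congr (levelQuotientEquiv e n).toEquiv,
    Nat.card_congr (Multiplicative.toAdd (α := Fin d → ZMod (p ^ n))), Nat.card_pi]
  simp [pow_mul]

theorem pow_mem_level (n : ℕ) (g : Γ) : g ^ p ^ n ∈ level e n := by
  rw [mem_level]
  intro i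
  rw [map_pow, toAdd_pow, Pi.smul_apply, nsmul_eq_mul, Nat.cast_pow]
  exact dvd_mul_right _ _

end Levels

section LevelHom

open Multiplicative

variable {p : ℕ} [Fact p.Prime] {d : ℕ} {A : Type*} [CommRing A] (x : Fin d → A)

/-- The character of `(ℤ / p ^ n) ^ d` with values `1 + x i`. -/
def levelHom (n : ℕ) : Multiplicative (Fin d → ZMod (p ^ n)) →* A ⧸ omegaIdeal p x n where
  toFun v := ∏ i, (Ideal.Quotient.mk (omegaIdeal p x n) (1 + x i)) ^ (toAdd v i).val
  map_one' := by simp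
  map_mul' a b := by
    have : NeZero (p ^ n) := ⟨pow_ne_zero _ (Fact.out : p.Prime).ne_zero⟩
    rw [← Finset.prod_mul_distrib]
    refine Finset.prod_congr rfl fun i _ => ?_
    have h : (Ideal.Quotient.mk (omegaIdeal p x n) (1 + x i)) ^ p ^ n = 1 := by
      rw [← map_pow, ← sub_eq_zero, ← map_one (Ideal.Quotient.mk (omegaIdeal p x n)), ← map_sub]
      exact Ideal.Quotient.eq_zero_iff_mem.2 (Ideal.subset_span ⟨i, rfl⟩)
    rw [toAdd_mul, Pi.add_apply, ZMod.val_add, ← pow_eq_pow_mod _ h, pow_add]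

theorem one_add_pow_eq_one (n : ℕ) (i : Fin d) :
    (Ideal.Quotient.mk (omegaIdeal p x n) (1 + x i)) ^ p ^ n = 1 := by
  rw [← map_pow, ← sub_eq_zero, ← map_one (Ideal.Quotient.mk (omegaIdeal p x n)), ← map_sub]
  exact Ideal.Quotient.eq_zero_iff_mem.2 (Ideal.subset_span ⟨i, rfl⟩)

variable [Algebra ℤ_[p] A] {Γ : Type*} [CommGroup Γ] [TopologicalSpace Γ]
  (e : Multiplicative (Fin d → ℤ_[p]) ≃ₜ* Γ)

/-- The map `ℤ_p[Γ / Γ ^ (p ^ n)] → A / (ω_n)`. -/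
def levelAlgHom (n : ℕ) : MonoidAlgebra ℤ_[p] (Γ ⧸ (level e n).toSubgroup) →ₐ[ℤ_[p]]
    A ⧸ omegaIdeal p x n :=
  MonoidAlgebra.lift ℤ_[p] _ _ ((levelHom x n).comp (levelQuotientEquiv e n).toMonoidHom)

theorem levelAlgHom_single (n : ℕ) (g : Γ) :
    levelAlgHom x e n (MonoidAlgebra.single (QuotientGroup.mk g) 1) =
      ∏ i, (Ideal.Quotient.mk (omegaIdeal p x n) (1 + x i)) ^
        (PadicInt.toZModPow n (toAdd (e.symm g) i)).val := by
  rw [levelAlgHom, MonoidAlgebra.lift_single, one_smul]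
  rfl

theorem levelAlgHom_single_basis (n : ℕ) (i : Fin d) :
    levelAlgHom x e n (MonoidAlgebra.single
      (QuotientGroup.mk (e (ofAdd (Pi.single i (1 : ℤ_[p]))))) 1) =
      Ideal.Quotient.mk (omegaIdeal p x n) (1 + x i) := by
  rw [levelAlgHom_single, Finset.prod_eq_single i]
  · rw [ContinuousMulEquiv.symm_apply_apply, toAdd_ofAdd, Pi.single_eq_same, map_one,
      ZMod.val_one_eq_one_mod, ← pow_eq_pow_mod _ (one_add_pow_eq_one x n i), pow_one]
  · intro j _ hj
    rw [ContinuousMulEquiv.symm_apply_apply, toAdd_ofAdd, Pi.single_eq_of_ne hj, map_zero,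
      ZMod.val_zero, pow_zero]
  · simp

theorem factor_levelAlgHom {n m : ℕ} (h : n ≤ m)
    (y : MonoidAlgebra ℤ_[p] (Γ ⧸ (level e m).toSubgroup)) :
    Ideal.Quotient.factorₐ ℤ_[p] (IsIwasawaRing.omegaIdeal_anti (p := p) x h)
      (levelAlgHom x e m y) = levelAlgHom x e n (transition p (level_anti e h) y) := by
  have : (Ideal.Quotient.factorₐ ℤ_[p] (IsIwasawaRing.omegaIdeal_anti (p := p) x h)).comp
      (levelAlgHom x e m) = (levelAlgHom x e n).comp (transition p (level_anti e h)) := by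
    refine MonoidAlgebra.algHom_ext (fun g => ?_) (by ext)
    obtain ⟨g, rfl⟩ := QuotientGroup.mk_surjective g
    have : NeZero (p ^ n) := ⟨pow_ne_zero _ (Fact.out : p.Prime).ne_zero⟩
    have : NeZero (p ^ m) := ⟨pow_ne_zero _ (Fact.out : p.Prime).ne_zero⟩
    have ht : transition p (level_anti e h) (MonoidAlgebra.single (QuotientGroup.mk g) 1) =
        MonoidAlgebra.single (QuotientGroup.mk g) 1 := MonoidAlgebra.mapDomain_single
    rw [AlgHom.comp_apply, AlgHom.comp_apply, ht, levelAlgHom_single, levelAlgHom_single, map_prod]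
    refine Finset.prod_congr rfl fun i _ => ?_
    rw [map_pow]
    have h2 : Ideal.Quotient.factorₐ ℤ_[p] (IsIwasawaRing.omegaIdeal_anti (p := p) x h)
        (Ideal.Quotient.mk (omegaIdeal p x m) (1 + x i)) =
        Ideal.Quotient.mk (omegaIdeal p x n) (1 + x i) := rfl
    rw [h2, pow_eq_pow_mod _ (one_add_pow_eq_one x n i),
      pow_eq_pow_mod (ZMod.val (PadicInt.toZModPow n _)) (one_add_pow_eq_one x n i)]
    congr 1
    rw [← PadicInt.cast_toZModPow n m h, ZMod.cast_eq_val, ZMod.val_natCast, Nat.mod_mod]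
  exact DFunLike.congr_fun this y

/-- By integrality a maximal ideal contracts to the maximal ideal (p) of ℤ_p. This puts p in the
Jacobson radical, as Nakayama's lemma requires. -/
theorem p_mem_of_isMaximal {R : Type*} [CommRing R] [Algebra ℤ_[p] R] [Algebra.IsIntegral ℤ_[p] R]
    (M : Ideal R) [hM : M.IsMaximal] : (p : R) ∈ M := by
  have h := Ideal.isMaximal_comap_of_isIntegral_of_isMaximal (R := ℤ_[p]) M
  have h2 : (p : ℤ_[p]) ∈ M.comap (algebraMap ℤ_[p] R) := by
    rw [IsLocalRing.eq_maximalIdeal h, PadicInt.maximalIdeal_eq_span_p]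
    exact Ideal.mem_span_singleton_self _
  rwa [Ideal.mem_comap, map_natCast] at h2

/-- Surjectivity is Nakayama's lemma. Both sides are ℤ_p-free of the same finite rank, and a
surjective endomorphism of a finite module is injective. -/
theorem levelAlgHom_bijective (hx : IsIwasawaRing p x) (n : ℕ) :
    Function.Bijective (levelAlgHom x e n) := by
  let G := Γ ⧸ (level e n).toSubgroup
  let R := MonoidAlgebra ℤ_[p] G
  let S := A ⧸ omegaIdeal p x n
  have : Finite G := finite_level_quotient e n
  have hfinR : Module.Finite ℤ_[p] R := Module.Finite.of_basis (MonoidAlgebra.basis G ℤ_[p])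
  have hfreeR : Module.Free ℤ_[p] R := Module.Free.of_basis (MonoidAlgebra.basis G ℤ_[p])
  have hfreeS : Module.Free ℤ_[p] S := hx.free n
  have hfinS : Module.Finite ℤ_[p] S := by
    refine Module.finite_of_finrank_pos ?_
    rw [hx.finrank]; exact pow_pos (Fact.out : p.Prime).pos _
  have hsurj : Function.Surjective (levelAlgHom x e n) := by
    let _ : Algebra R S := (levelAlgHom x e n).toRingHom.toAlgebra
    have : IsScalarTower ℤ_[p] R S := IsScalarTower.of_algebraMap_eq fun r =>
      ((levelAlgHom x e n).commutes r).symm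
    have : Module.Finite R S := Module.Finite.of_restrictScalars_finite ℤ_[p] R S
    let s : Fin d → R := fun i =>
      MonoidAlgebra.single (QuotientGroup.mk (e (ofAdd (Pi.single i (1 : ℤ_[p]))))) 1 - 1
    have hs : ∀ i, levelAlgHom x e n (s i) = Ideal.Quotient.mk _ (x i) := fun i => by
      rw [map_sub, levelAlgHom_single_basis, map_one, map_add, map_one, add_sub_cancel_left]
    have hsp : ∀ i, (s i + 1) ^ p ^ n = 1 := fun i => by
      rw [sub_add_cancel, MonoidAlgebra.single_pow, one_pow, ← QuotientGroup.mk_pow,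
        (QuotientGroup.eq_one_iff _).2 (pow_mem_level e n _)]
      rfl
    -- Modulo a maximal ideal, which contains p, the relation (s i + 1) ^ p ^ n = 1 becomes s i ^ p
    -- ^ n = 0.
    have hjac : parameterIdeal p s ≤ Ideal.jacobson ⊥ := by
      rw [Ideal.jacobson, le_sInf_iff]
      rintro M ⟨-, hM⟩
      have hpM := p_mem_of_isMaximal (p := p) M
      rw [parameterIdeal, Ideal.span_le]
      rintro _ (rfl | ⟨i, rfl⟩)
      · exact hpM
      · refine hM.isPrime.mem_of_pow_mem (p ^ n) ?_
        have : (p : R) ∣ (s i + 1) ^ p ^ n - (s i ^ p ^ n + 1 ^ p ^ n) := by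
          obtain ⟨r, hr⟩ := exists_add_pow_prime_pow_eq (Fact.out : p.Prime) (s i) 1 n
          exact ⟨s i * 1 * r, by rw [hr]; ring⟩
        rw [hsp, one_pow] at this
        have h2 := M.mem_of_dvd this hpM
        have h3 : -(s i ^ p ^ n) ∈ M := by simpa using h2
        exact neg_mem_iff.1 h3
    have key : (⊤ : Submodule R S) ≤ LinearMap.range (Algebra.linearMap R S) := by
      refine Submodule.le_of_le_smul_of_le_jacobson_bot Module.Finite.fg_top hjac ?_
      intro c _
      obtain ⟨a, rfl⟩ := Ideal.Quotient.mk_surjective c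
      obtain ⟨z, hz⟩ := hx.residue a
      rw [← sub_add_cancel a (algebraMap ℤ_[p] A z), map_add, add_comm]
      refine Submodule.add_mem_sup ⟨algebraMap ℤ_[p] R z, ?_⟩ ?_
      · exact (levelAlgHom x e n).commutes z
      · refine Submodule.span_induction ?_ ?_ ?_ ?_ hz
          (p := fun b _ => (Ideal.Quotient.mk (omegaIdeal p x n) b : S) ∈
            (parameterIdeal p s • ⊤ : Submodule R S))
        · rintro _ (rfl | ⟨i, rfl⟩)
          · have : (Ideal.Quotient.mk (omegaIdeal p x n) (p : A) : S) = (p : R) • (1 : S) := by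
              rw [Algebra.smul_def, map_natCast, map_natCast, mul_one]
            rw [this]
            exact Submodule.smul_mem_smul (IsIwasawaRing.p_mem p s) trivial
          · have : (Ideal.Quotient.mk (omegaIdeal p x n) (x i) : S) = (s i) • (1 : S) := by
              rw [Algebra.smul_def, mul_one, ← hs i]; rfl
            rw [this]
            exact Submodule.smul_mem_smul (IsIwasawaRing.x_mem p s i) trivial
        · rw [map_zero]; exact Submodule.zero_mem _
        · intro a b _ _ ha hb; rw [map_add]; exact Submodule.add_mem _ ha hb
        · intro r b _ hb
          rw [smul_eq_mul, map_mul]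
          refine Submodule.smul_induction_on hb ?_ ?_
          · intro t ht c _
            rw [mul_smul_comm]
            exact Submodule.smul_mem_smul ht trivial
          · intro c c' hc hc'
            rw [mul_add]; exact Submodule.add_mem _ hc hc'
    intro c
    obtain ⟨r, hr⟩ := key (trivial : c ∈ (⊤ : Submodule R S))
    exact ⟨r, hr⟩
  refine ⟨?_, hsurj⟩
  have hrank : Module.finrank ℤ_[p] S = Module.finrank ℤ_[p] R := by
    rw [hx.finrank, Module.finrank_eq_nat_card_basis (MonoidAlgebra.basis G ℤ_[p]),
      card_level_quotient e n]
  let E : S ≃ₗ[ℤ_[p]] R := LinearEquiv.ofFinrankEq S R hrank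
  have h1 : Function.Surjective (E.toLinearMap ∘ₗ (levelAlgHom x e n).toLinearMap) :=
    E.surjective.comp hsurj
  have h2 := OrzechProperty.injective_of_surjective_endomorphism _ h1
  exact Function.Injective.of_comp (f := E) h2

end LevelHom
end
end IwasawaTower

/-! ### Iwasawa algebras as Iwasawa rings -/

namespace IwasawaTower

noncomputable section

section LamEquiv

open Multiplicative

variable {p : ℕ} [Fact p.Prime] {Γ : Type*} [CommGroup Γ] [TopologicalSpace Γ]

theorem transition_transition {U V W : OpenSubgroup Γ} (h : U ≤ V) (h' : V ≤ W)
    (y : MonoidAlgebra ℤ_[p] (Γ ⧸ U.toSubgroup)) :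
    transition p h' (transition p h y) = transition p (h.trans h') y := by
  have : (transition p h').comp (transition p h) = transition p (h.trans h') := by
    refine MonoidAlgebra.algHom_ext (fun g => ?_) (by ext)
    obtain ⟨g, rfl⟩ := QuotientGroup.mk_surjective g
    rw [AlgHom.comp_apply]
    have ht : ∀ {U V : OpenSubgroup Γ} (h : U ≤ V),
        transition p h (MonoidAlgebra.single (QuotientGroup.mk g) 1) =
        MonoidAlgebra.single (QuotientGroup.mk g) 1 := fun h => MonoidAlgebra.mapDomain_single
    rw [ht, ht, ht]
  exact DFunLike.congr_fun this y

theorem transition_single {U V : OpenSubgroup Γ} (h : U ≤ V) (g : Γ) :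
    transition p h (MonoidAlgebra.single (QuotientGroup.mk g) 1) =
        MonoidAlgebra.single (QuotientGroup.mk g) 1 := MonoidAlgebra.mapDomain_single

/-- The projection `Λ_Γ → ℤ_p[Γ/U]`. -/
def projAt (U : OpenSubgroup Γ) : Lam p Γ →ₐ[ℤ_[p]] MonoidAlgebra ℤ_[p] (Γ ⧸ U.toSubgroup) :=
  (Pi.evalAlgHom ℤ_[p] _ U).comp (completedGroupAlgebra p Γ).val

theorem transition_projAt {U V : OpenSubgroup Γ} (h : U ≤ V) (a : Lam p Γ) :
    transition p h (projAt U a) = projAt V a := a.2 U V h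

theorem projAt_of (U : OpenSubgroup Γ) (g : Γ) :
    projAt U (of p g) = MonoidAlgebra.single (QuotientGroup.mk g) 1 := rfl

theorem lam_ext {a b : Lam p Γ} (h : ∀ U, projAt U a = projAt U b) : a = b :=
  Subtype.ext (funext h)

variable {d : ℕ} {A : Type*} [CommRing A] {x : Fin d → A} [Algebra ℤ_[p] A]
  (e : Multiplicative (Fin d → ℤ_[p]) ≃ₜ* Γ)

theorem lam_ext_level {a b : Lam p Γ} (h : ∀ n, projAt (level e n) a = projAt (level e n) b) :
    a = b := by
  refine lam_ext fun U => ?_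
  obtain ⟨n, hn⟩ := exists_level_le e U
  rw [← transition_projAt hn, h, transition_projAt hn]

/-- The map `A → ℤ_p[Γ / Γ ^ (p ^ n)]` with kernel `(ω_n)`. -/
def toLevel (hx : IsIwasawaRing p x) (n : ℕ) :
    A →ₐ[ℤ_[p]] MonoidAlgebra ℤ_[p] (Γ ⧸ (level e n).toSubgroup) :=
  (AlgEquiv.ofBijective (levelAlgHom x e n) (levelAlgHom_bijective x e hx n)).symm.toAlgHom.comp
    (Ideal.Quotient.mkₐ ℤ_[p] (omegaIdeal p x n))

theorem levelAlgHom_toLevel (hx : IsIwasawaRing p x) (n : ℕ) (a : A) :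
    levelAlgHom x e n (toLevel e hx n a) = Ideal.Quotient.mk (omegaIdeal p x n) a :=
  (AlgEquiv.ofBijective (levelAlgHom x e n) (levelAlgHom_bijective x e hx n)).apply_symm_apply _

theorem toLevel_eq_iff (hx : IsIwasawaRing p x) (n : ℕ) (a : A)
    (y : MonoidAlgebra ℤ_[p] (Γ ⧸ (level e n).toSubgroup)) :
    toLevel e hx n a = y ↔ Ideal.Quotient.mk (omegaIdeal p x n) a = levelAlgHom x e n y := by
  rw [← levelAlgHom_toLevel e hx, (levelAlgHom_bijective x e hx n).1.eq_iff]

theorem toLevel_eq_zero_iff (hx : IsIwasawaRing p x) (n : ℕ) (a : A) :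
    toLevel e hx n a = 0 ↔ a ∈ omegaIdeal p x n := by
  rw [toLevel_eq_iff, map_zero, Ideal.Quotient.eq_zero_iff_mem]

theorem toLevel_surjective (hx : IsIwasawaRing p x) (n : ℕ) :
    Function.Surjective (toLevel e hx n) := by
  intro y
  obtain ⟨a, ha⟩ := Ideal.Quotient.mk_surjective (levelAlgHom x e n y)
  exact ⟨a, (toLevel_eq_iff e hx n a y).2 ha⟩

theorem toLevel_basis (hx : IsIwasawaRing p x) (n : ℕ) (i : Fin d) :
    toLevel e hx n (1 + x i) = MonoidAlgebra.single
      (QuotientGroup.mk (e (ofAdd (Pi.single i (1 : ℤ_[p]))))) 1 := by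
  rw [toLevel_eq_iff, levelAlgHom_single_basis]

theorem transition_toLevel (hx : IsIwasawaRing p x) {n m : ℕ} (h : n ≤ m) (a : A) :
    transition p (level_anti e h) (toLevel e hx m a) = toLevel e hx n a := by
  apply (levelAlgHom_bijective x e hx n).1
  rw [← factor_levelAlgHom _ _ h, levelAlgHom_toLevel, levelAlgHom_toLevel]
  rfl

theorem transition_toLevel_eq (hx : IsIwasawaRing p x) {n m : ℕ} {U : OpenSubgroup Γ}
    (h : level e n ≤ U) (h' : level e m ≤ U) (a : A) :
    transition p h (toLevel e hx n a) = transition p h' (toLevel e hx m a) := by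
  rw [← transition_toLevel e hx (le_max_left n m), ← transition_toLevel e hx (le_max_right n m),
    transition_transition, transition_transition]

/-- The comparison map from an Iwasawa ring to `Λ_Γ`. -/
def toLam (hx : IsIwasawaRing p x) : A →ₐ[ℤ_[p]] Lam p Γ :=
  AlgHom.codRestrict (AlgHom.pi fun U : OpenSubgroup Γ =>
    (transition p (exists_level_le e U).choose_spec).comp (toLevel e hx _))
    (completedGroupAlgebra p Γ) (by
      intro a U V h
      simp only [AlgHom.pi_apply, AlgHom.comp_apply]
      rw [transition_transition]
      exact transition_toLevel_eq e hx _ _ a)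

theorem projAt_toLam (hx : IsIwasawaRing p x) {n : ℕ} {U : OpenSubgroup Γ}
    (h : level e n ≤ U) (a : A) :
    projAt U (toLam e hx a) = transition p h (toLevel e hx n a) :=
  transition_toLevel_eq e hx (exists_level_le e U).choose_spec h a

theorem projAt_level_toLam (hx : IsIwasawaRing p x) (n : ℕ) (a : A) :
    projAt (level e n) (toLam e hx a) = toLevel e hx n a := by
  rw [projAt_toLam e hx le_rfl, transition_toLevel e hx le_rfl]

/-- The ideals (ω_n) lie in 𝔪^{n+1}, so their intersection is zero and compatible families of lifts
from the levels converge in A. -/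
theorem toLam_bijective (hx : IsIwasawaRing p x) : Function.Bijective (toLam (Γ := Γ) e hx) := by
  have := hx.noeth
  have := hx.isLocalRing
  have := hx.isAdicComplete
  constructor
  · rw [injective_iff_map_eq_zero]
    intro a ha
    have h0 : ∀ n, a ∈ omegaIdeal p x n := fun n => by
      rw [← toLevel_eq_zero_iff e hx, ← projAt_level_toLam, ha, map_zero]
    have := mem_of_forall_mem_sup_pow (⊥ : Ideal A) a fun k => by
      rw [bot_sup_eq, hx.maximalIdeal_eq]
      exact Ideal.pow_le_pow_right (Nat.le_succ k) (IsIwasawaRing.omegaIdeal_le x k (h0 k))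
    exact this
  · intro y
    choose a ha using fun n => toLevel_surjective e hx n (projAt (level e n) y)
    obtain ⟨z, hz⟩ := exists_of_compatible (A := A) (Y := A) (fun n => omegaIdeal p x n)
      (fun n => by
        rw [hx.maximalIdeal_eq, smul_eq_mul, Ideal.mul_top]
        exact (IsIwasawaRing.omegaIdeal_le x n).trans (Ideal.pow_le_pow_right (Nat.le_succ n)))
      a (fun m n h => by
        rw [← toLevel_eq_zero_iff e hx, map_sub, ha, ← transition_toLevel e hx h, ha,
          transition_projAt, sub_self])
    refine ⟨z, lam_ext_level e fun n => ?_⟩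
    rw [projAt_level_toLam, ← ha, eq_comm, ← sub_eq_zero, ← map_sub, toLevel_eq_zero_iff]
    exact hz n

/-- An Iwasawa ring in `d` variables is the Iwasawa algebra of `ℤ_p^d`. -/
def lamEquiv (hx : IsIwasawaRing p x) : A ≃ₐ[ℤ_[p]] Lam p Γ :=
  AlgEquiv.ofBijective (toLam e hx) (toLam_bijective e hx)

theorem lamEquiv_basis (hx : IsIwasawaRing p x) (i : Fin d) :
    lamEquiv e hx (1 + x i) = of p (e (ofAdd (Pi.single i (1 : ℤ_[p])))) := by
  refine lam_ext_level e fun n => ?_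
  rw [projAt_of, ← toLevel_basis e hx]
  exact projAt_level_toLam e hx n _

theorem projAt_lamEquiv_eq_zero_iff (hx : IsIwasawaRing p x) (n : ℕ) (a : A) :
    projAt (level e n) (lamEquiv e hx a) = 0 ↔ a ∈ omegaIdeal p x n := by
  rw [← toLevel_eq_zero_iff e hx, ← projAt_level_toLam]; rfl

end LamEquiv

namespace IsIwasawaRing

variable {p : ℕ} [Fact p.Prime]

theorem map_parameterIdeal {ι A B : Type*} [CommRing A] [CommRing B] {F : Type*} [FunLike F A B]
    [RingHomClass F A B] (f : F) (x : ι → A) :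
    (parameterIdeal p x).map f = parameterIdeal p (fun i => f (x i)) := by
  rw [parameterIdeal, parameterIdeal, Ideal.map_span, Set.image_insert_eq, map_natCast,
    ← Set.range_comp]
  rfl

theorem map_omegaIdeal {ι A B : Type*} [CommRing A] [CommRing B] {F : Type*} [FunLike F A B]
    [RingHomClass F A B] (f : F) (x : ι → A) (n : ℕ) :
    (omegaIdeal p x n).map f = omegaIdeal p (fun i => f (x i)) n := by
  rw [omegaIdeal, omegaIdeal, Ideal.map_span, ← Set.range_comp]
  congr 2
  funext i
  simp

/-- Being an Iwasawa ring is invariant under isomorphism. -/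
theorem map {d : ℕ} {A B : Type*} [CommRing A] [CommRing B] [Algebra ℤ_[p] A] [Algebra ℤ_[p] B]
    {x : Fin d → A} (hx : IsIwasawaRing p x) (E : A ≃ₐ[ℤ_[p]] B) :
    IsIwasawaRing p (fun i => E (x i)) := by
  have h1 : (parameterIdeal p x).map E.toRingEquiv = parameterIdeal p (fun i => E (x i)) :=
    map_parameterIdeal E.toRingEquiv x
  have h2 : ∀ n, (omegaIdeal p x n).map E = omegaIdeal p (fun i => E (x i)) n :=
    map_omegaIdeal E x
  have h3 : ∀ n, (A ⧸ omegaIdeal p x n) ≃ₐ[ℤ_[p]] (B ⧸ omegaIdeal p (fun i => E (x i)) n) :=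
    fun n => Ideal.quotientEquivAlg _ _ E (h2 n).symm
  have := hx.noeth
  have := hx.maximal
  refine ⟨isNoetherianRing_of_ringEquiv A E.toRingEquiv, ?_, ?_, fun b => ?_, fun n => ?_,
    fun n => ?_⟩
  · rw [← h1]; exact Ideal.map_isMaximal_of_equiv E.toRingEquiv
  · rw [← h1]
    exact (IsAdicComplete.congr_ringEquiv _ E.toRingEquiv).2 hx.complete
  · obtain ⟨a, rfl⟩ := E.surjective b
    obtain ⟨z, hz⟩ := hx.residue a
    refine ⟨z, ?_⟩
    rw [← h1, ← E.commutes z, ← map_sub]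
    exact Ideal.mem_map_of_mem E.toRingEquiv hz
  · have := hx.free n
    exact Module.Free.of_equiv (h3 n).toLinearEquiv
  · rw [← (h3 n).toLinearEquiv.finrank_eq, hx.finrank]

/-- The standard parameters of `ℤ_p[[ℤ_p^d]]`. -/
def stdParam (p : ℕ) [Fact p.Prime] (d : ℕ) : Fin d → Lam p (Multiplicative (Fin d → ℤ_[p])) :=
  fun i => of p (Multiplicative.ofAdd (Pi.single i (1 : ℤ_[p]))) - 1

theorem lamEquiv_param {Γ : Type*} [CommGroup Γ] [TopologicalSpace Γ]
    {d : ℕ} {A : Type*} [CommRing A] {x : Fin d → A} [Algebra ℤ_[p] A]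
    (e : Multiplicative (Fin d → ℤ_[p]) ≃ₜ* Γ) (hx : IsIwasawaRing p x) (i : Fin d) :
    lamEquiv e hx (x i) = of p (e (Multiplicative.ofAdd (Pi.single i (1 : ℤ_[p])))) - 1 := by
  rw [← lamEquiv_basis e hx, map_add, map_one, add_sub_cancel_left]

theorem of_isIwasawaRing {Γ : Type*} [CommGroup Γ] [TopologicalSpace Γ]
    {d : ℕ} {A : Type*} [CommRing A] {x : Fin d → A} [Algebra ℤ_[p] A]
    (e : Multiplicative (Fin d → ℤ_[p]) ≃ₜ* Γ) (hx : IsIwasawaRing p x) :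
    IsIwasawaRing p (fun i => of p (e (Multiplicative.ofAdd (Pi.single i (1 : ℤ_[p])))) - 1) := by
  have := hx.map (lamEquiv e hx)
  simpa only [lamEquiv_param] using this

/-- Power series over an Iwasawa ring form an Iwasawa ring in one more variable, and every Iwasawa
ring in d variables is isomorphic to Λ of ℤ_p^d; the properties therefore climb from ℤ_p by
induction. -/
theorem stdParam_isIwasawaRing (d : ℕ) : IsIwasawaRing p (stdParam p d) := by
  induction d with
  | zero => exact of_isIwasawaRing (ContinuousMulEquiv.refl _) (padicInt (p := p))
  | succ d ih => exact of_isIwasawaRing (ContinuousMulEquiv.refl _) ih.powerSeries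

end IsIwasawaRing

section Basis

variable {p : ℕ} [Fact p.Prime] {Γ : Type*} [CommGroup Γ] [TopologicalSpace Γ]

open IsIwasawaRing

/-- `Λ_Γ` is an Iwasawa ring with parameters `σ_i - 1`. -/
theorem IsZpBasis.isIwasawaRing {d : ℕ} {σ : Fin d → Γ} (hσ : IsZpBasis p σ) :
    IsIwasawaRing p (fun i => of p (σ i) - 1) := by
  obtain ⟨e, he⟩ := hσ
  simpa only [he] using of_isIwasawaRing e (stdParam_isIwasawaRing (p := p) d)

/-- The power series presentation of `Λ_Γ` attached to a basis and its first element. -/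
theorem IsZpBasis.exists_powerSeries_equiv {d : ℕ} {σ : Fin (d + 1) → Γ} (hσ : IsZpBasis p σ) :
    ∃ E : PowerSeries (Lam p (Multiplicative (Fin d → ℤ_[p]))) ≃ₐ[ℤ_[p]] Lam p Γ,
      E PowerSeries.X = of p (σ 0) - 1 ∧
        ∀ i, E (PowerSeries.C (stdParam p d i)) = of p (σ i.succ) - 1 := by
  obtain ⟨e, he⟩ := hσ
  have hx := (stdParam_isIwasawaRing (p := p) d).powerSeries
  refine ⟨lamEquiv e hx, ?_, fun i => ?_⟩
  · rw [← he]; exact lamEquiv_param e hx 0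
  · rw [← he]; exact lamEquiv_param e hx i.succ

end Basis

end
end IwasawaTower

/-! ### Prime ideals generated by parameters, and changes of basis -/

namespace IwasawaTower

noncomputable section

open PowerSeries

section PrimeParams

variable {p : ℕ} [Fact p.Prime]

/-- The ideal generated by `K ⊆ ℤ_p` and the `x i`, `i ∈ S`. -/
def paramSpan {p : ℕ} [Fact p.Prime] {ι A : Type*} [CommRing A] [Algebra ℤ_[p] A]
    (K : Ideal ℤ_[p]) (x : ι → A) (S : Set ι) : Ideal A :=
  K.map (algebraMap ℤ_[p] A) ⊔ Ideal.span (x '' S)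

/-- All subsets of the parameters `x i`, with or without `p`, generate prime ideals, not containing
the remaining parameters. -/
structure HasPrimeParams (p : ℕ) [Fact p.Prime] {ι A : Type*} [CommRing A] [Algebra ℤ_[p] A]
    (x : ι → A) : Prop where
  prime : ∀ (K : Ideal ℤ_[p]) [K.IsPrime] (S : Set ι), (paramSpan K x S).IsPrime
  notMem : ∀ (K : Ideal ℤ_[p]) [K.IsPrime] (S : Set ι) (j : ι), j ∉ S → x j ∉ paramSpan K x S

theorem map_paramSpan {ι A B : Type*} [CommRing A] [CommRing B] [Algebra ℤ_[p] A] [Algebra ℤ_[p] B]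
    (f : A →ₐ[ℤ_[p]] B) (K : Ideal ℤ_[p]) (x : ι → A)
    (S : Set ι) : (paramSpan K x S).map f = paramSpan K (fun i => f (x i)) S := by
  rw [paramSpan, paramSpan, Ideal.map_sup, Ideal.map_span, Set.image_image]
  congr 1
  rw [← f.comp_algebraMap, ← Ideal.map_map]
  rfl

theorem HasPrimeParams.map {ι A B : Type*} [CommRing A] [CommRing B] [Algebra ℤ_[p] A]
    [Algebra ℤ_[p] B] {x : ι → A} (hx : HasPrimeParams p x) (E : A ≃ₐ[ℤ_[p]] B) :
    HasPrimeParams p (fun i => E (x i)) := by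
  have h (K : Ideal ℤ_[p]) (S : Set ι) :
      paramSpan K (fun i => E (x i)) S = (paramSpan K x S).comap E.symm := by
    rw [← show _ = paramSpan K (fun i => E (x i)) S from map_paramSpan E.toAlgHom K x S]
    exact Ideal.map_comap_of_equiv E.toRingEquiv
  refine ⟨fun K _ S => ?_, fun K _ S j hj => ?_⟩
  · have := hx.prime K S
    rw [h]; exact Ideal.comap_isPrime _ _
  · rw [h, Ideal.mem_comap, E.symm_apply_apply]
    exact hx.notMem K S j hj

theorem isPrime_map_C {A : Type*} [CommRing A] [IsNoetherianRing A] (Q : Ideal A) [Q.IsPrime] :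
    (Q.map (C (R := A))).IsPrime := by
  have h : Q.map (C (R := A)) = RingHom.ker (PowerSeries.map (Ideal.Quotient.mk Q)) := by
    ext f
    rw [mem_map_C_iff, RingHom.mem_ker, PowerSeries.ext_iff]
    refine forall_congr' fun i => ?_
    rw [coeff_map, map_zero, Ideal.Quotient.eq_zero_iff_mem]
  rw [h]
  exact RingHom.ker_isPrime _

theorem sup_span_X_eq_comap {A : Type*} [CommRing A] (Q : Ideal A) :
    Q.map (C (R := A)) ⊔ Ideal.span {X} = Q.comap constantCoeff := by
  ext f
  exact IsIwasawaRing.mem_powerSeriesIdeal_iff Q f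

/-- If X is not among the chosen parameters, they generate the extension of a prime Q of A, the
kernel of the map to (A/Q)⟦X⟧; if it is, they generate the preimage of Q under the constant
coefficient. -/
theorem HasPrimeParams.powerSeries {d : ℕ} {A : Type*} [CommRing A] [IsNoetherianRing A]
    [Algebra ℤ_[p] A] {x : Fin d → A} (hx : HasPrimeParams p x) :
    HasPrimeParams p (Fin.cons X (fun i => C (x i)) : Fin (d + 1) → A⟦X⟧) := by
  have hC (K : Ideal ℤ_[p]) (S : Set (Fin (d + 1))) (hS : 0 ∉ S) :
      paramSpan K (Fin.cons X (fun i => C (x i)) : Fin (d + 1) → A⟦X⟧) S =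
        (paramSpan K x (Fin.succ ⁻¹' S)).map (C (R := A)) := by
    rw [paramSpan, paramSpan, Ideal.map_sup, Ideal.map_span, Ideal.map_map]
    refine congrArg₂ (· ⊔ ·) (congrArg (fun f => K.map f)
      (RingHom.ext fun _ => PowerSeries.algebraMap_apply)) (congrArg Ideal.span (Set.ext fun f => ?_))
    simp only [Set.mem_image, Fin.exists_fin_succ, hS, false_and, false_or, Fin.cons_succ,
      Set.mem_preimage, exists_exists_and_eq_and]
  have hX (K : Ideal ℤ_[p]) (S : Set (Fin (d + 1))) (hS : 0 ∈ S) :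
      paramSpan K (Fin.cons X (fun i => C (x i)) : Fin (d + 1) → A⟦X⟧) S =
        (paramSpan K x (Fin.succ ⁻¹' S)).comap constantCoeff := by
    rw [← sup_span_X_eq_comap, paramSpan, paramSpan, Ideal.map_sup, Ideal.map_span, Ideal.map_map,
      sup_assoc, ← Ideal.span_union]
    refine congrArg₂ (· ⊔ ·) (congrArg (fun f => K.map f)
      (RingHom.ext fun _ => PowerSeries.algebraMap_apply)) (congrArg Ideal.span (Set.ext fun f => ?_))
    simp only [Set.mem_image, Fin.exists_fin_succ, hS, true_and, Fin.cons_succ, Fin.cons_zero,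
      Set.mem_preimage, Set.union_singleton, Set.mem_insert_iff, eq_comm]
    exact or_congr Iff.rfl ⟨fun ⟨i, hi, h⟩ => ⟨_, ⟨i, hi, rfl⟩, h⟩,
      fun ⟨_, ⟨i, hi, h'⟩, h⟩ => ⟨i, hi, h' ▸ h⟩⟩
  refine ⟨fun K _ S => ?_, fun K _ S j hj => ?_⟩
  · have := hx.prime K (Fin.succ ⁻¹' S)
    by_cases h0 : 0 ∈ S
    · rw [hX K S h0]; exact Ideal.comap_isPrime _ _
    · rw [hC K S h0]; exact isPrime_map_C _
  · have := hx.prime K (Fin.succ ⁻¹' S)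
    by_cases h0 : 0 ∈ S
    · rw [hX K S h0, Ideal.mem_comap]
      obtain rfl | ⟨j, rfl⟩ := Fin.eq_zero_or_eq_succ j
      · exact absurd h0 hj
      · rw [Fin.cons_succ, constantCoeff_C]
        exact hx.notMem K _ j hj
    · rw [hC K S h0, mem_map_C_iff]
      obtain rfl | ⟨j, rfl⟩ := Fin.eq_zero_or_eq_succ j
      · intro h
        have := h 1
        rw [Fin.cons_zero, coeff_one_X] at this
        exact Ideal.IsPrime.ne_top' ((Ideal.eq_top_iff_one _).2 this)
      · intro h
        have := h 0
        rw [Fin.cons_succ, coeff_zero_C] at this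
        exact hx.notMem K _ j hj this

theorem hasPrimeParams_padicInt : HasPrimeParams p (Fin.elim0 : Fin 0 → ℤ_[p]) := by
  refine ⟨fun K _ S => ?_, fun K _ S j => j.elim0⟩
  have : paramSpan K (Fin.elim0 : Fin 0 → ℤ_[p]) S = K := by
    rw [paramSpan, Set.eq_empty_of_isEmpty S, Set.image_empty, Ideal.span_empty, sup_bot_eq]
    exact Ideal.map_id K
  rwa [this]

theorem HasPrimeParams.of_lamEquiv {Γ : Type*} [CommGroup Γ] [TopologicalSpace Γ]
    {d : ℕ} {A : Type*} [CommRing A] {x : Fin d → A} [Algebra ℤ_[p] A]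
    (e : Multiplicative (Fin d → ℤ_[p]) ≃ₜ* Γ) (hx : IsIwasawaRing p x) (hx' : HasPrimeParams p x) :
    HasPrimeParams p (fun i => of p (e (Multiplicative.ofAdd (Pi.single i (1 : ℤ_[p])))) - 1) := by
  have := hx'.map (lamEquiv e hx)
  simpa only [IsIwasawaRing.lamEquiv_param] using this

open IsIwasawaRing in
theorem hasPrimeParams_stdParam (d : ℕ) : HasPrimeParams p (stdParam p d) := by
  induction d with
  | zero =>
    exact HasPrimeParams.of_lamEquiv (ContinuousMulEquiv.refl _) padicInt hasPrimeParams_padicInt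
  | succ d ih =>
    have := (stdParam_isIwasawaRing (p := p) d).noeth
    exact HasPrimeParams.of_lamEquiv (ContinuousMulEquiv.refl _)
      (stdParam_isIwasawaRing d).powerSeries ih.powerSeries

theorem IsZpBasis.hasPrimeParams {Γ : Type*} [CommGroup Γ] [TopologicalSpace Γ] {d : ℕ}
    {σ : Fin d → Γ} (hσ : IsZpBasis p σ) : HasPrimeParams p (fun i => of p (σ i) - 1) := by
  obtain ⟨e, he⟩ := hσ
  simpa only [he] using HasPrimeParams.of_lamEquiv e (IsIwasawaRing.stdParam_isIwasawaRing d)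
    (hasPrimeParams_stdParam d)

theorem HasPrimeParams.isDomain {ι A : Type*} [CommRing A] [Algebra ℤ_[p] A] {x : ι → A}
    (hx : HasPrimeParams p x) : IsDomain A := by
  have h := hx.prime ⊥ ∅
  rw [paramSpan, Ideal.map_bot, Set.image_empty, Ideal.span_empty, sup_bot_eq] at h
  exact IsDomain.of_bot_isPrime A

theorem isPrime_span_p : (Ideal.span {(p : ℤ_[p])}).IsPrime :=
  (Ideal.span_singleton_prime (PadicInt.prime_p).ne_zero).2 PadicInt.prime_p

theorem paramSpan_p {ι A : Type*} [CommRing A] [Algebra ℤ_[p] A] (x : ι → A) (S : Set ι) :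
    paramSpan (Ideal.span {(p : ℤ_[p])}) x S = Ideal.span (insert (p : A) (x '' S)) := by
  rw [paramSpan, Ideal.map_span, Set.image_singleton, map_natCast, Ideal.span_insert]

end PrimeParams

/-! ### Changes of basis of Γ -/

section BasisChange

open Multiplicative

variable {p : ℕ} [Fact p.Prime] {Γ : Type*} [CommGroup Γ] [TopologicalSpace Γ] {d : ℕ}

/-- A linear automorphism of `ℤ_p^d` as an automorphism of topological groups. -/
def linearEquivMul (M : (Fin d → ℤ_[p]) ≃ₗ[ℤ_[p]] (Fin d → ℤ_[p])) :
    Multiplicative (Fin d → ℤ_[p]) ≃ₜ* Multiplicative (Fin d → ℤ_[p]) where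
  toMulEquiv := AddEquiv.toMultiplicative M.toAddEquiv
  continuous_toFun := continuous_ofAdd.comp
    ((LinearMap.continuous_on_pi M.toLinearMap).comp continuous_toAdd)
  continuous_invFun := continuous_ofAdd.comp
    ((LinearMap.continuous_on_pi M.symm.toLinearMap).comp continuous_toAdd)

theorem isZpBasis_of_linearEquiv (e : Multiplicative (Fin d → ℤ_[p]) ≃ₜ* Γ)
    (M : (Fin d → ℤ_[p]) ≃ₗ[ℤ_[p]] (Fin d → ℤ_[p])) :
    IsZpBasis p fun i => e (ofAdd (M (Pi.single i 1))) :=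
  ⟨(linearEquivMul M).trans e, fun _ => rfl⟩

/-- The automorphism of `ℤ_p^d` replacing the `i`-th standard basis vector by `v`. -/
def updateEquiv (i : Fin d) (v : Fin d → ℤ_[p]) (hv : IsUnit (v i)) :
    (Fin d → ℤ_[p]) ≃ₗ[ℤ_[p]] (Fin d → ℤ_[p]) where
  toFun w := w + w i • (v - (Pi.single i 1 : Fin d → ℤ_[p]))
  map_add' w w' := by rw [Pi.add_apply, add_smul]; abel
  map_smul' r w := by rw [Pi.smul_apply, RingHom.id_apply, smul_add, smul_smul, smul_eq_mul]
  invFun w := w - (hv.unit⁻¹ * w i : ℤ_[p]) • (v - (Pi.single i 1 : Fin d → ℤ_[p]))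
  left_inv w := by
    have h : (hv.unit⁻¹ * (w + w i • (v - (Pi.single i 1 : Fin d → ℤ_[p]))) i : ℤ_[p]) = w i := by
      have : (w + w i • (v - (Pi.single i 1 : Fin d → ℤ_[p]))) i = v i * w i := by simp; ring
      rw [this, ← mul_assoc, IsUnit.val_inv_mul, one_mul]
    show w + w i • _ - _ = w
    rw [h, add_sub_cancel_right]
  right_inv w := by
    have h : (w - (hv.unit⁻¹ * w i : ℤ_[p]) • (v - (Pi.single i 1 : Fin d → ℤ_[p]))) i =
        hv.unit⁻¹ * w i := by
      have h2 := hv.val_inv_mul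
      simp only [Pi.sub_apply, Pi.smul_apply, smul_eq_mul, Pi.single_eq_same]
      linear_combination (-w i) * h2
    show w - _ + (w - (hv.unit⁻¹ * w i : ℤ_[p]) • (v - (Pi.single i 1 : Fin d → ℤ_[p]))) i • _ = w
    rw [h, sub_add_cancel]

theorem isZpBasis_update (e : Multiplicative (Fin d → ℤ_[p]) ≃ₜ* Γ) (i : Fin d) (v : Fin d → ℤ_[p])
    (hv : IsUnit (v i)) :
    IsZpBasis p (Function.update (fun j => e (ofAdd (Pi.single j 1))) i (e (ofAdd v))) := by
  convert isZpBasis_of_linearEquiv e (updateEquiv i v hv) using 1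
  funext j
  by_cases h : j = i
  · subst h
    rw [Function.update_self]
    congr 2
    show v = Pi.single j 1 + (Pi.single j (1 : ℤ_[p]) : Fin d → ℤ_[p]) j • (v - Pi.single j 1)
    rw [Pi.single_eq_same, one_smul, add_sub_cancel]
  · rw [Function.update_of_ne h]
    congr 2
    show Pi.single j 1 = Pi.single j 1 +
      (Pi.single j (1 : ℤ_[p]) : Fin d → ℤ_[p]) i • (v - Pi.single i 1)
    rw [Pi.single_eq_of_ne (Ne.symm h), zero_smul, add_zero]

theorem IsZpBasis.update_mul_zpow {σ : Fin d → Γ} (hσ : IsZpBasis p σ) {i j : Fin d} (h : i ≠ j) (n : ℤ) :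
    IsZpBasis p (Function.update σ i (σ i * σ j ^ n)) := by
  obtain ⟨e, he⟩ := hσ
  obtain rfl := funext he
  convert isZpBasis_update e i (Pi.single i 1 + (n : ℤ_[p]) • Pi.single j 1) ?_ using 2
  · rw [ofAdd_add, map_mul, ← map_zpow, ← ofAdd_zsmul]
    congr 3
  · simp [h]

theorem IsZpBasis.perm {σ : Fin d → Γ} (hσ : IsZpBasis p σ) (π : Equiv.Perm (Fin d)) :
    IsZpBasis p (σ ∘ π) := by
  obtain ⟨e, he⟩ := hσ
  convert isZpBasis_of_linearEquiv e (LinearEquiv.funCongrLeft ℤ_[p] ℤ_[p] π.symm) using 1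
  funext i
  rw [Function.comp_apply, ← he]
  congr 2
  ext k
  simp [LinearEquiv.funCongrLeft_apply, LinearMap.funLeft_apply, Pi.single_apply,
    Equiv.symm_apply_eq]

end BasisChange

end
end IwasawaTower

/-! ### Unique factorization -/

namespace IwasawaTower

noncomputable section

/-! ### Prime elements from Weierstrass preparation -/

section Weierstrass

open PowerSeries IsLocalRing
open scoped Polynomial

variable {A : Type*} [CommRing A] [IsLocalRing A]

/-- Modulo the maximal ideal F is a power of X, so a monic divisor reduces to a power of X as well.
-/
theorem isDistinguishedAt_of_dvd [IsDomain A] {F q : A[X]} (hF : F.IsDistinguishedAt (maximalIdeal A))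
    (hq : q ∣ F) (hm : q.Monic) : q.IsDistinguishedAt (maximalIdeal A) := by
  refine ⟨⟨fun {n} hn => ?_⟩, hm⟩
  have h1 : q.map (residue A) ∣ Polynomial.X ^ F.natDegree := by
    have h := hF.map_eq_X_pow
    have := Polynomial.map_dvd (residue A) hq
    rwa [show F.map (residue A) = Polynomial.X ^ F.natDegree from h] at this
  obtain ⟨i, -, hi⟩ := (dvd_prime_pow Polynomial.prime_X _).1 h1
  have h2 : q.map (residue A) = Polynomial.X ^ i :=
    Polynomial.eq_of_monic_of_associated (hm.map _) (Polynomial.monic_X_pow i) hi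
  have h3 : i = q.natDegree := by
    rw [← hm.natDegree_map (residue A), h2, Polynomial.natDegree_X_pow]
  have h4 := congrArg (fun f => f.coeff n) h2
  simp only [Polynomial.coeff_map, Polynomial.coeff_X_pow] at h4
  rw [if_neg (by omega)] at h4
  exact Ideal.Quotient.eq_zero_iff_mem.1 h4

/-- For distinguished q, Weierstrass division identifies A⟦X⟧/(q) with A[X]/(q). -/
theorem prime_coe_of_isDistinguishedAt [IsDomain A] [IsAdicComplete (maximalIdeal A) A] {q : A[X]}
    (hd : q.IsDistinguishedAt (maximalIdeal A)) (hq : Prime q) : Prime (q : A⟦X⟧) := by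
  have h0 : (q : A⟦X⟧) ≠ 0 := fun h => hq.ne_zero (Polynomial.coe_eq_zero_iff.1 h)
  rw [← Ideal.span_singleton_prime h0, ← Ideal.Quotient.isDomain_iff_prime]
  have : (Ideal.span {q}).IsPrime := (Ideal.span_singleton_prime hq.ne_zero).2 hq
  exact hd.algEquivQuotient.symm.toMulEquiv.isDomain (A[X] ⧸ Ideal.span {q})

/-- A prime ideal of `A⟦X⟧` containing a series that is nonzero modulo the maximal ideal of `A`
contains a distinguished polynomial that is a prime element. -/
theorem exists_prime_isDistinguishedAt_mem [IsDomain A] [UniqueFactorizationMonoid A]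
    [IsAdicComplete (maximalIdeal A) A] (P : Ideal A⟦X⟧) [hP : P.IsPrime] (g : A⟦X⟧) (hgP : g ∈ P)
    (hg : g.map (residue A) ≠ 0) :
    ∃ q : A[X], q.IsDistinguishedAt (maximalIdeal A) ∧ Prime q ∧ Prime (q : A⟦X⟧) ∧
      (q : A⟦X⟧) ∈ P := by
  obtain ⟨F, h, H⟩ := exists_isWeierstrassFactorization hg
  have hF : (F : A⟦X⟧) ∈ P := by
    rw [H.eq_mul] at hgP
    exact (hP.mem_or_mem hgP).resolve_right fun h' => hP.ne_top (P.eq_top_of_isUnit_mem h' H.isUnit)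
  have hFm := H.isDistinguishedAt.monic
  obtain ⟨s, hs, hsF⟩ := UniqueFactorizationMonoid.exists_prime_factors F hFm.ne_zero
  have hsP : s.prod ∈ P.comap (Polynomial.coeToPowerSeries.ringHom (R := A)) := by
    obtain ⟨u, hu⟩ := hsF.symm
    rw [← hu]
    exact Ideal.mul_mem_right _ _ hF
  have := Ideal.comap_isPrime (Polynomial.coeToPowerSeries.ringHom (R := A)) P
  obtain ⟨q, hqs, hqP⟩ := (Ideal.IsPrime.multiset_prod_mem_iff_exists_mem this s).1 hsP
  have hqF : q ∣ F := (Multiset.dvd_prod hqs).trans hsF.dvd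
  have hlc : IsUnit q.leadingCoeff := by
    obtain ⟨r, hr⟩ := hqF
    have := hFm.leadingCoeff
    rw [hr, Polynomial.leadingCoeff_mul] at this
    exact IsUnit.of_mul_eq_one _ this
  obtain ⟨u, hu⟩ := hlc
  set q' := Polynomial.C (↑u⁻¹ : A) * q with hq'
  have hass : Associated q q' :=
    ⟨Units.map (Polynomial.C (R := A)).toMonoidHom u⁻¹, by rw [hq', mul_comm]; rfl⟩
  have hm : q'.Monic := by
    rw [Polynomial.Monic, hq', Polynomial.leadingCoeff_mul, Polynomial.leadingCoeff_C, ← hu,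
      Units.inv_mul]
  have hd := isDistinguishedAt_of_dvd H.isDistinguishedAt (hass.symm.dvd.trans hqF) hm
  have hp : Prime q' := hass.prime (hs q hqs)
  refine ⟨q', hd, hp, prime_coe_of_isDistinguishedAt hd hp, ?_⟩
  have : q' ∈ P.comap (Polynomial.coeToPowerSeries.ringHom (R := A)) := by
    rw [hq']; exact Ideal.mul_mem_left _ _ hqP
  exact this

end Weierstrass

/-! ### A basis in which a given element is regular in one variable -/

section BasisChoice

open IsLocalRing

/-- Modulo 𝔭, f is divisible by the product of the first m of the z k: at each stage primality moves
the next z m into the cofactor, as no earlier z k lies in the new prime. The product lies in 𝔪^m, so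
Krull's theorem applies. -/
theorem mem_of_forall_mem_sup_span {R : Type*} [CommRing R] [IsNoetherianRing R] [IsLocalRing R]
    (𝔭 : Ideal R) (z : ℕ → R) (hz : ∀ k, z k ∈ maximalIdeal R)
    (hprime : ∀ k, (𝔭 ⊔ Ideal.span {z k}).IsPrime)
    (hne : ∀ k l, k < l → z k ∉ 𝔭 ⊔ Ideal.span {z l}) (f : R)
    (hf : ∀ k, f ∈ 𝔭 ⊔ Ideal.span {z k}) : f ∈ 𝔭 := by
  have key : ∀ m, ∃ g, f - (∏ k ∈ Finset.range m, z k) * g ∈ 𝔭 := by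
    intro m
    induction m with
    | zero => exact ⟨f, by simp⟩
    | succ m ih =>
      obtain ⟨g, hg⟩ := ih
      have h1 : (∏ k ∈ Finset.range m, z k) * g ∈ 𝔭 ⊔ Ideal.span {z m} := by
        have := Ideal.sub_mem _ (hf m) (Ideal.mem_sup_left hg)
        rwa [sub_sub_cancel] at this
      have h2 := ((hprime m).mem_or_mem h1).resolve_left fun h => by
        obtain ⟨k, hk, hk'⟩ := ((hprime m).prod_mem_iff).1 h
        exact hne k m (Finset.mem_range.1 hk) hk'
      obtain ⟨a, ha, b, hb, rfl⟩ := Submodule.mem_sup.1 h2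
      obtain ⟨c, rfl⟩ := Ideal.mem_span_singleton'.1 hb
      refine ⟨c, ?_⟩
      have : f - (∏ k ∈ Finset.range (m + 1), z k) * c =
        (f - (∏ k ∈ Finset.range m, z k) * (a + c * z m)) + (∏ k ∈ Finset.range m, z k) * a := by
        rw [Finset.prod_range_succ]; ring
      rw [this]
      exact Ideal.add_mem _ hg (Ideal.mul_mem_left _ _ ha)
  refine mem_of_forall_mem_sup_pow 𝔭 f fun m => ?_
  obtain ⟨g, hg⟩ := key m
  rw [← sub_add_cancel f ((∏ k ∈ Finset.range m, z k) * g)]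
  refine Submodule.add_mem_sup hg (Ideal.mul_mem_right _ _ ?_)
  have := Ideal.prod_mem_prod (ι := ℕ) (s := Finset.range m) (I := fun _ => maximalIdeal R) (x := z)
    fun k _ => hz k
  simpa using this

variable {p : ℕ} [Fact p.Prime] {Γ : Type*} [CommGroup Γ] [TopologicalSpace Γ] {d : ℕ}

theorem IsZpBasis.isLocalRing {σ : Fin d → Γ} (hσ : IsZpBasis p σ) : IsLocalRing (Lam p Γ) :=
  hσ.isIwasawaRing.isLocalRing

/-- The parameters attached to a basis of `Γ`. -/
abbrev param (p : ℕ) [Fact p.Prime] {ι : Type*} (σ : ι → Γ) : ι → Lam p Γ := fun i => of p (σ i) - 1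

theorem paramSpan_update (K : Ideal ℤ_[p]) (σ : Fin d → Γ) (j : Fin d) (S : Set (Fin d)) (hj : j ∉ S)
    (g : Γ) : paramSpan K (param p (Function.update σ j g)) (insert j S) =
      paramSpan K (param p σ) S ⊔ Ideal.span {of p g - 1} := by
  rw [paramSpan, paramSpan, Set.image_insert_eq, Ideal.span_insert, sup_comm (Ideal.span _), ← sup_assoc]
  have h1 : param p (Function.update σ j g) '' S = param p σ '' S :=
    Set.image_congr fun i hi => by
      rw [param, Function.update_of_ne]; rintro rfl; exact hj hi
  have h2 : param p (Function.update σ j g) j = of p g - 1 := by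
    rw [param, Function.update_self]
  rw [h1, h2]

-- The candidates for g are σ_j σ_i^{-p^k}. If f failed for all of them it would lie in the ideal
-- for S by `mem_of_forall_mem_sup_span`. For k < l, a prime containing p and both g - 1 contains
-- x^{p^k}(1 - x^{p^l - p^k}) with x = σ_i - 1; the second factor is a unit, so x would lie in the
-- prime, which is excluded.
open PadicInt in
theorem exists_basis_notMem_step {σ : Fin d → Γ} (hσ : IsZpBasis p σ) (S : Set (Fin d))
    {i j : Fin d} (hij : j ≠ i) (hi : i ∉ S) (hj : j ∉ S) (f : Lam p Γ)
    (hf : f ∉ paramSpan (Ideal.span {(p : ℤ_[p])}) (param p σ) S) :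
    ∃ g : Γ, IsZpBasis p (Function.update σ j g) ∧
      f ∉ paramSpan (Ideal.span {(p : ℤ_[p])}) (param p (Function.update σ j g)) (insert j S) := by
  by_contra hcon
  have hb : ∀ k : ℕ, IsZpBasis p (Function.update σ j (σ j * σ i ^ (-(p ^ k : ℕ) : ℤ))) :=
    fun k => hσ.update_mul_zpow hij _
  simp only [not_exists, not_and, not_not] at hcon
  have hmem := fun k => hcon _ (hb k)
  have hK : (Ideal.span {(p : ℤ_[p])}).IsPrime := isPrime_span_p
  have hnoeth := hσ.isIwasawaRing.noeth
  have hloc := hσ.isLocalRing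
  simp only [paramSpan_update _ _ _ _ hj] at hmem
  have hprime : ∀ k : ℕ, (paramSpan (Ideal.span {(p : ℤ_[p])}) (param p σ) S ⊔
      Ideal.span {of p (σ j * σ i ^ (-(p ^ k : ℕ) : ℤ)) - 1}).IsPrime := fun k => by
    rw [← paramSpan_update _ _ _ _ hj]
    exact (hb k).hasPrimeParams.prime _ _
  refine hf (mem_of_forall_mem_sup_span _ _ (fun k => ?_) hprime (fun k l hkl hmem => ?_) f hmem)
  · have := IsIwasawaRing.x_mem p (param p (Function.update σ j (σ j * σ i ^ (-(p ^ k : ℕ) : ℤ)))) j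
    rw [hσ.isLocalRing.eq_maximalIdeal (hb k).isIwasawaRing.maximal |>.symm]
    simpa [param] using this
  · set Q := paramSpan (Ideal.span {(p : ℤ_[p])}) (param p σ) S ⊔
      Ideal.span {of p (σ j * σ i ^ (-(p ^ l : ℕ) : ℤ)) - 1} with hQ
    have hQp : Q.IsPrime := hprime l
    have hpQ : (p : Lam p Γ) ∈ Q := by
      refine Ideal.mem_sup_left ?_
      rw [paramSpan_p]
      exact Ideal.subset_span (Set.mem_insert _ _)
    have hiQ : of p (σ i) - 1 ∉ Q := by
      have := (hb l).hasPrimeParams.notMem (Ideal.span {(p : ℤ_[p])}) (insert j S) i (by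
        rintro (h | h)
        · exact hij h.symm
        · exact hi h)
      rw [hQ, ← paramSpan_update _ _ _ _ hj]
      rwa [Function.update_of_ne hij.symm] at this
    have hchar : CharP (Lam p Γ ⧸ Q) p := by
      rw [CharP.charP_iff_prime_eq_zero (Fact.out : p.Prime), ← map_natCast (Ideal.Quotient.mk Q)]
      exact Ideal.Quotient.eq_zero_iff_mem.2 hpQ
    have hs : ∀ n : ℕ, of p (σ j * σ i ^ (-(p ^ n : ℕ) : ℤ)) - 1 ∈ Q →
        Ideal.Quotient.mk Q (of p (σ j)) = 1 + Ideal.Quotient.mk Q (of p (σ i) - 1) ^ p ^ n := by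
      intro n hn
      have h1 : of p (σ j) = of p (σ j * σ i ^ (-(p ^ n : ℕ) : ℤ)) * of p (σ i) ^ p ^ n := by
        rw [← map_pow, ← map_mul, zpow_neg, zpow_natCast, inv_mul_cancel_right]
      have h2 : Ideal.Quotient.mk Q (of p (σ j * σ i ^ (-(p ^ n : ℕ) : ℤ))) = 1 := by
        rw [← sub_eq_zero, ← map_one (Ideal.Quotient.mk Q), ← map_sub]
        exact Ideal.Quotient.eq_zero_iff_mem.2 hn
      rw [h1, map_mul, h2, one_mul, map_pow, map_sub, map_one, sub_pow_char_pow, one_pow,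
        add_sub_cancel]
    have h1 := (hs k hmem).symm.trans (hs l (Ideal.mem_sup_right (Ideal.mem_span_singleton_self _)))
    have h2 : (of p (σ i) - 1) ^ p ^ k * (1 - (of p (σ i) - 1) ^ (p ^ l - p ^ k)) ∈ Q := by
      rw [← Ideal.Quotient.eq_zero_iff_mem, mul_sub, mul_one, ← pow_add,
        Nat.add_sub_cancel' (Nat.pow_le_pow_right (Fact.out : p.Prime).pos hkl.le), map_sub, map_pow,
        map_pow, sub_eq_zero]
      exact add_left_cancel h1
    have hpos : p ^ l - p ^ k ≠ 0 := by
      have := Nat.pow_lt_pow_right (Fact.out : p.Prime).one_lt hkl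
      omega
    have him : of p (σ i) - 1 ∈ maximalIdeal (Lam p Γ) := by
      rw [← hσ.isLocalRing.eq_maximalIdeal hσ.isIwasawaRing.maximal]
      exact IsIwasawaRing.x_mem p (param p σ) i
    rcases hQp.mem_or_mem h2 with h3 | h3
    · exact hiQ (hQp.mem_of_pow_mem _ h3)
    · refine hQp.ne_top (Q.eq_top_of_isUnit_mem h3 ?_)
      by_contra hnu
      have h4 := Ideal.add_mem _ ((mem_maximalIdeal _).2 hnu)
        (Ideal.pow_mem_of_mem _ him _ (Nat.pos_of_ne_zero hpos))
      rw [sub_add_cancel] at h4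
      exact (Ideal.ne_top_iff_one _).1 (maximalIdeal.isMaximal _).ne_top h4

/-- For `f` prime to `p` there is a basis of `Γ` for which `f` is regular in the first parameter. -/
theorem exists_basis_notMem {σ : Fin d → Γ} (hσ : IsZpBasis p σ) (i : Fin d) (f : Lam p Γ)
    (hf : ¬ (p : Lam p Γ) ∣ f) :
    ∃ σ' : Fin d → Γ, IsZpBasis p σ' ∧
      f ∉ paramSpan (Ideal.span {(p : ℤ_[p])}) (param p σ') {j | j ≠ i} := by
  have key : ∀ S : Finset (Fin d), i ∉ S → ∃ σ' : Fin d → Γ, IsZpBasis p σ' ∧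
      f ∉ paramSpan (Ideal.span {(p : ℤ_[p])}) (param p σ') (S : Set (Fin d)) := by
    intro S
    induction S using Finset.induction_on with
    | empty =>
      intro _
      refine ⟨σ, hσ, ?_⟩
      rwa [paramSpan_p, Finset.coe_empty, Set.image_empty, insert_empty_eq,
        Ideal.mem_span_singleton]
    | insert j S hj ih =>
      intro hi
      rw [Finset.mem_insert, not_or] at hi
      obtain ⟨σ', hσ', hf'⟩ := ih hi.2
      obtain ⟨g, hg, hg'⟩ := exists_basis_notMem_step hσ' (S : Set (Fin d)) (Ne.symm hi.1)
        (by simpa using hi.2) (by simpa using hj) f hf'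
      exact ⟨_, hg, by rwa [Finset.coe_insert]⟩
  obtain ⟨σ', hσ', h⟩ := key (Finset.univ.erase i) (by simp)
  refine ⟨σ', hσ', ?_⟩
  convert h using 3
  ext j; simp

end BasisChoice

/-! ### Λ_Γ is a unique factorization domain -/

section Factorial

open PowerSeries IsLocalRing IsIwasawaRing

variable {p : ℕ} [Fact p.Prime]

theorem map_residue_ne_zero_of_notMem {d : ℕ} {A : Type*} [CommRing A] [Algebra ℤ_[p] A]
    {x : Fin d → A} (hx : IsIwasawaRing p x) [IsLocalRing A] {g : A⟦X⟧}
    (hg : g ∉ paramSpan (Ideal.span {(p : ℤ_[p])})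
      (Fin.cons X (fun i => C (x i)) : Fin (d + 1) → A⟦X⟧) {j | j ≠ 0}) :
    g.map (residue A) ≠ 0 := by
  intro h
  have := hx.noeth
  apply hg
  have h1 : g ∈ (parameterIdeal p x).map (C (R := A)) := by
    rw [mem_map_C_iff]
    intro i
    rw [← hx.maximalIdeal_eq]
    have := congrArg (coeff i) h
    rw [coeff_map, map_zero] at this
    exact Ideal.Quotient.eq_zero_iff_mem.1 this
  rw [paramSpan_p]
  refine (?_ : (parameterIdeal p x).map (C (R := A)) ≤ _) h1
  rw [Ideal.map_le_iff_le_comap, parameterIdeal, Ideal.span_le]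
  rintro _ (rfl | ⟨i, rfl⟩)
  · rw [SetLike.mem_coe, Ideal.mem_comap, map_natCast]
    exact Ideal.subset_span (Set.mem_insert _ _)
  · exact Ideal.subset_span (Set.mem_insert_of_mem _ ⟨i.succ, Fin.succ_ne_zero i, rfl⟩)

variable {Γ : Type*} [CommGroup Γ] [TopologicalSpace Γ] {d : ℕ}

theorem IsZpBasis.prime_p {σ : Fin d → Γ} (hσ : IsZpBasis p σ) : Prime (p : Lam p Γ) := by
  have := hσ.hasPrimeParams.isDomain
  have hp : (Ideal.span {(p : ℤ_[p])}).IsPrime := isPrime_span_p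
  have h := hσ.hasPrimeParams.prime (Ideal.span {(p : ℤ_[p])}) ∅
  rw [paramSpan_p, Set.image_empty, insert_empty_eq] at h
  refine (Ideal.span_singleton_prime fun h0 => ?_).1 h
  -- It remains to see p ≠ 0, which holds because Λ/I_0 is nonzero and ℤ_p-free.
  have hfree := hσ.isIwasawaRing.free 0
  have hrank := hσ.isIwasawaRing.finrank 0
  rw [zero_mul, pow_zero] at hrank
  have : Nontrivial (Lam p Γ ⧸ omegaIdeal p (fun i => of p (σ i) - 1) 0) :=
    Module.nontrivial_of_finrank_pos (R := ℤ_[p]) (by rw [hrank]; exact one_pos)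
  have : (p : ℤ_[p]) • (1 : Lam p Γ ⧸ omegaIdeal p (fun i => of p (σ i) - 1) 0) = 0 := by
    rw [Algebra.smul_def, mul_one, map_natCast, ← map_natCast (Ideal.Quotient.mk _), h0, map_zero]
  rcases smul_eq_zero.1 this with h | h
  · exact PadicInt.prime_p.ne_zero h
  · exact one_ne_zero h

/-- The power series presentation of `Λ_Γ` for a basis in which a given prime is regular. -/
theorem IsZpBasis.exists_prime_polynomial {σ : Fin (d + 1) → Γ} (hσ : IsZpBasis p σ)
    [IsLocalRing (Lam p (Multiplicative (Fin d → ℤ_[p])))]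
    (hU : UniqueFactorizationMonoid (Lam p (Multiplicative (Fin d → ℤ_[p]))))
    (P : Ideal (Lam p Γ)) [P.IsPrime] (f : Lam p Γ) (hfP : f ∈ P) (hf : ¬ (p : Lam p Γ) ∣ f) :
    ∃ (σ' : Fin (d + 1) → Γ) (_ : IsZpBasis p σ')
      (E : PowerSeries (Lam p (Multiplicative (Fin d → ℤ_[p]))) ≃ₐ[ℤ_[p]] Lam p Γ)
      (q : Polynomial (Lam p (Multiplicative (Fin d → ℤ_[p])))),
      E PowerSeries.X = of p (σ' 0) - 1 ∧
      (∀ i, E (PowerSeries.C (stdParam p d i)) = of p (σ' i.succ) - 1) ∧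
      q.IsDistinguishedAt (maximalIdeal _) ∧ Prime q ∧ Prime (E q) ∧ E q ∈ P := by
  obtain ⟨σ', hσ', hf'⟩ := exists_basis_notMem hσ 0 f hf
  obtain ⟨E, hE, hE'⟩ := hσ'.exists_powerSeries_equiv
  have hA := stdParam_isIwasawaRing (p := p) d
  have := hA.isAdicComplete
  have := (hasPrimeParams_stdParam (p := p) d).isDomain
  have hx : param p σ' = fun i => E ((Fin.cons X (fun i => C (stdParam p d i)) :
      Fin (d + 1) → PowerSeries (Lam p (Multiplicative (Fin d → ℤ_[p])))) i) := by
    funext i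
    refine Fin.cases ?_ (fun i => ?_) i
    · exact hE.symm
    · exact (hE' i).symm
  rw [hx, ← show _ = paramSpan _ (fun i => E _) _ from map_paramSpan E.toAlgHom _ _ _] at hf'
  have h1 := map_residue_ne_zero_of_notMem hA (g := E.symm f) fun h => hf' (by
    have := Ideal.mem_map_of_mem E.toAlgHom h
    rwa [show E.toAlgHom (E.symm f) = f from E.apply_symm_apply f] at this)
  have := Ideal.comap_isPrime E P
  obtain ⟨q, h2, h3, h4, h5⟩ := exists_prime_isDistinguishedAt_mem (P.comap E) (E.symm f)
    (by rw [Ideal.mem_comap, E.apply_symm_apply]; exact hfP) h1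
  exact ⟨σ', hσ', E, q, hE, hE', h2, h3, (MulEquiv.prime_iff E.toMulEquiv).2 h4, h5⟩

/-- Kaplansky's criterion: every nonzero prime ideal contains a prime element. This is p, or after
removing the powers of p from an element of the ideal, a Weierstrass polynomial in a suitable basis.
-/
theorem uniqueFactorizationMonoid_of_prime {σ : Fin (d + 1) → Γ} (hσ : IsZpBasis p σ)
    (hU : UniqueFactorizationMonoid (Lam p (Multiplicative (Fin d → ℤ_[p])))) :
    UniqueFactorizationMonoid (Lam p Γ) := by
  have := hσ.hasPrimeParams.isDomain
  have := hσ.isIwasawaRing.noeth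
  have := (stdParam_isIwasawaRing (p := p) d).isLocalRing
  rw [UniqueFactorizationMonoid.iff_exists_prime_mem_of_isPrime]
  intro P hP0 hP
  obtain ⟨f, hf, hf0⟩ := Submodule.exists_mem_ne_zero_of_ne_bot hP0
  obtain ⟨n, g, hg, rfl⟩ := WfDvdMonoid.max_power_factor hf0 hσ.prime_p.irreducible
  rcases hP.mem_or_mem hf with h | h
  · exact ⟨_, hP.mem_of_pow_mem _ h, hσ.prime_p⟩
  · obtain ⟨_, _, E, q, -, -, -, -, h1, h2⟩ := hσ.exists_prime_polynomial hU P g h hg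
    exact ⟨_, h2, h1⟩

theorem isZpBasis_std (d : ℕ) : IsZpBasis p fun i : Fin d =>
    Multiplicative.ofAdd (Pi.single i (1 : ℤ_[p]) : Fin d → ℤ_[p]) :=
  ⟨ContinuousMulEquiv.refl _, fun _ => rfl⟩

theorem uniqueFactorizationMonoid_std (d : ℕ) :
    UniqueFactorizationMonoid (Lam p (Multiplicative (Fin d → ℤ_[p]))) := by
  induction d with
  | zero =>
    exact (lamEquiv (ContinuousMulEquiv.refl _)
      (padicInt (p := p))).toMulEquiv.uniqueFactorizationMonoid inferInstance
  | succ d ih => exact uniqueFactorizationMonoid_of_prime (isZpBasis_std _) ih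

theorem IsZpBasis.uniqueFactorizationMonoid {σ : Fin d → Γ} (hσ : IsZpBasis p σ) :
    UniqueFactorizationMonoid (Lam p Γ) := by
  obtain ⟨e, -⟩ := hσ
  exact (lamEquiv e (stdParam_isIwasawaRing (p := p) d)).toMulEquiv.uniqueFactorizationMonoid
    (uniqueFactorizationMonoid_std d)

end Factorial

end
end IwasawaTower

/-! ### The ideals `(ω_{σ_1,n}, …, ω_{σ_d,n})` -/

namespace IwasawaTower

noncomputable section

section IwasawaRing

open IsLocalRing IsIwasawaRing

variable {p : ℕ} [Fact p.Prime] {d : ℕ} {A : Type*} [CommRing A] [Algebra ℤ_[p] A] {x : Fin d → A}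

theorem IsIwasawaRing.nzdMod_natCast (hx : IsIwasawaRing p x) (n : ℕ) {N : ℕ} (hN : N ≠ 0) :
    NZDMod (omegaIdeal p x n) (N : A) := by
  intro a ha
  have := hx.free n
  have h : (N : ℤ_[p]) • Ideal.Quotient.mk (omegaIdeal p x n) a = 0 := by
    rw [Algebra.smul_def, map_natCast, ← map_natCast (Ideal.Quotient.mk _), ← map_mul]
    exact Ideal.Quotient.eq_zero_iff_mem.2 ha
  exact Ideal.Quotient.eq_zero_iff_mem.1
    ((smul_eq_zero.1 h).resolve_left (Nat.cast_ne_zero.2 hN))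

/-- The quotient is the group ring of (ℤ/p^n)^d over ℤ_p, which is reduced. -/
theorem IsIwasawaRing.isRadical_omegaIdeal (hx : IsIwasawaRing p x) (n : ℕ) :
    (omegaIdeal p x n).IsRadical := by
  let e := ContinuousMulEquiv.refl (Multiplicative (Fin d → ℤ_[p]))
  have := finite_level_quotient e n
  have := isReduced_monoidAlgebra (p := p) (_ ⧸ (level e n).toSubgroup)
  rw [Ideal.isRadical_iff_quotient_reduced]
  exact isReduced_of_injective _
    (AlgEquiv.ofBijective _ (levelAlgHom_bijective x e hx n)).symm.injective

/-- Polynomials in the parameters are dense; hence local homomorphisms are controlled by their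
values on the parameters. -/
theorem IsIwasawaRing.exists_sub_mem_pow (hx : IsIwasawaRing p x) (k : ℕ) (a : A) :
    ∃ b ∈ Algebra.adjoin ℤ_[p] (Set.range x), a - b ∈ parameterIdeal p x ^ k := by
  induction k generalizing a with
  | zero => exact ⟨0, Subalgebra.zero_mem _, by simp⟩
  | succ k ih =>
    have key : ∀ y ∈ parameterIdeal p x, ∀ a : A, ∃ b ∈ Algebra.adjoin ℤ_[p] (Set.range x),
        a * y - b ∈ parameterIdeal p x ^ (k + 1) := by
      intro y hy
      refine Submodule.span_induction ?_ ?_ ?_ ?_ hy (p := fun y _ => ∀ a : A,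
        ∃ b ∈ Algebra.adjoin ℤ_[p] (Set.range x), a * y - b ∈ parameterIdeal p x ^ (k + 1))
      · intro g hg a
        obtain ⟨b, hb, hab⟩ := ih a
        refine ⟨b * g, Subalgebra.mul_mem _ hb ?_, ?_⟩
        · rcases hg with rfl | hg
          · exact natCast_mem _ _
          · exact Algebra.subset_adjoin hg
        · rw [← sub_mul, pow_succ]
          exact Ideal.mul_mem_mul hab (Ideal.subset_span hg)
      · exact fun a => ⟨0, Subalgebra.zero_mem _, by simp⟩
      · intro y z _ _ hy hz a
        obtain ⟨b, hb, hb'⟩ := hy a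
        obtain ⟨c, hc, hc'⟩ := hz a
        refine ⟨b + c, Subalgebra.add_mem _ hb hc, ?_⟩
        rw [mul_add, add_sub_add_comm]
        exact Ideal.add_mem _ hb' hc'
      · intro r y _ hy a
        rw [smul_eq_mul, ← mul_assoc]
        exact hy (a * r)
    obtain ⟨z, hz⟩ := hx.residue a
    obtain ⟨b, hb, hb'⟩ := key _ hz 1
    refine ⟨algebraMap ℤ_[p] A z + b, Subalgebra.add_mem _ (Subalgebra.algebraMap_mem _ z) hb, ?_⟩
    rwa [← sub_sub, ← one_mul (a - _)]

/-- Two local homomorphisms from an Iwasawa ring that agree on the parameters modulo an ideal agree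
modulo that ideal. -/
theorem IsIwasawaRing.sub_mem_of_forall (hx : IsIwasawaRing p x) {R : Type*} [CommRing R]
    [Algebra ℤ_[p] R] [IsNoetherianRing R] [IsLocalRing R] (φ ψ : A →ₐ[ℤ_[p]] R) (𝔠 : Ideal R)
    (hφ : ∀ i, φ (x i) ∈ maximalIdeal R) (hψ : ∀ i, ψ (x i) ∈ maximalIdeal R)
    (hp : (p : R) ∈ maximalIdeal R) (h : ∀ i, φ (x i) - ψ (x i) ∈ 𝔠) (a : A) : φ a - ψ a ∈ 𝔠 := by
  have hmap : ∀ f : A →ₐ[ℤ_[p]] R, (∀ i, f (x i) ∈ maximalIdeal R) →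
      parameterIdeal p x ≤ (maximalIdeal R).comap f := by
    intro f hf
    rw [parameterIdeal, Ideal.span_le]
    rintro _ (rfl | ⟨i, rfl⟩)
    · rw [SetLike.mem_coe, Ideal.mem_comap, map_natCast]; exact hp
    · exact hf i
  have hpow : ∀ f : A →ₐ[ℤ_[p]] R, (∀ i, f (x i) ∈ maximalIdeal R) → ∀ k, ∀ y ∈ parameterIdeal p x ^ k,
      f y ∈ maximalIdeal R ^ k := fun f hf k y hy =>
    Ideal.le_comap_pow f k (Ideal.pow_right_mono (hmap f hf) k hy)
  have hadj : ∀ b ∈ Algebra.adjoin ℤ_[p] (Set.range x), φ b - ψ b ∈ 𝔠 := by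
    intro b hb
    have : Algebra.adjoin ℤ_[p] (Set.range x) ≤ AlgHom.equalizer
        ((Ideal.Quotient.mkₐ ℤ_[p] 𝔠).comp φ) ((Ideal.Quotient.mkₐ ℤ_[p] 𝔠).comp ψ) := by
      rw [Algebra.adjoin_le_iff]
      rintro _ ⟨i, rfl⟩
      exact Ideal.Quotient.eq.2 (h i)
    exact Ideal.Quotient.eq.1 (this hb)
  refine mem_of_forall_mem_sup_pow 𝔠 _ fun k => ?_
  obtain ⟨b, hb, hab⟩ := hx.exists_sub_mem_pow k a
  have e : φ a - ψ a = (φ b - ψ b) + (φ (a - b) - ψ (a - b)) := by simp only [map_sub]; ring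
  rw [e]
  exact Submodule.add_mem_sup (hadj b hb) (Ideal.sub_mem _ (hpow φ hφ k _ hab) (hpow ψ hψ k _ hab))

end IwasawaRing

/-! ### The ideals as kernels to finite levels, independent of the basis -/

section Levels

open Multiplicative IsIwasawaRing

variable {p : ℕ} [Fact p.Prime] {Γ : Type*} [CommGroup Γ] [TopologicalSpace Γ] {d : ℕ}

theorem one_add_param_pow {ι : Type*} (σ : ι → Γ) (i : ι) (n : ℕ) :
    (1 + param p σ i) ^ p ^ n - 1 = omega p (σ i) n := by
  rw [param, add_sub_cancel, ← map_pow, omega]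

theorem omegaIdeal_param {d : ℕ} (σ : Fin d → Γ) (n : ℕ) :
    omegaIdeal p (param p σ) n = Ideal.span (Set.range fun i => omega p (σ i) n) := by
  simp only [omegaIdeal, one_add_param_pow]

theorem mem_level_iff_exists_pow (e : Multiplicative (Fin d → ℤ_[p]) ≃ₜ* Γ) (n : ℕ) (g : Γ) :
    g ∈ level e n ↔ ∃ h, h ^ p ^ n = g := by
  constructor
  · intro hg
    rw [mem_level] at hg
    choose v hv using hg
    refine ⟨e (ofAdd v), e.symm.injective ?_⟩
    rw [← map_pow, e.symm_apply_apply]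
    apply toAdd.injective
    funext i
    rw [hv, toAdd_pow, Pi.smul_apply, nsmul_eq_mul, Nat.cast_pow, toAdd_ofAdd]
  · rintro ⟨h, rfl⟩
    exact pow_mem_level e n h

theorem level_eq_level {d' : ℕ} (e : Multiplicative (Fin d → ℤ_[p]) ≃ₜ* Γ)
    (e' : Multiplicative (Fin d' → ℤ_[p]) ≃ₜ* Γ) (n : ℕ) : level e n = level e' n := by
  ext g
  rw [← SetLike.mem_coe, ← SetLike.mem_coe]
  exact (mem_level_iff_exists_pow e n g).trans (mem_level_iff_exists_pow e' n g).symm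

/-- The level subgroup consists of the p^n-th powers and so depends on Γ alone. Hence the ideal does
not depend on the basis and contains ω_{g,n} for every g ∈ Γ. -/
theorem IsZpBasis.projAt_level_eq_zero_iff {d' : ℕ} {σ : Fin d → Γ} (hσ : IsZpBasis p σ)
    (e : Multiplicative (Fin d' → ℤ_[p]) ≃ₜ* Γ) (n : ℕ) (a : Lam p Γ) :
    projAt (level e n) a = 0 ↔ a ∈ omegaIdeal p (param p σ) n := by
  obtain ⟨e', he⟩ := hσ
  have hx := stdParam_isIwasawaRing (p := p) d
  have h := projAt_lamEquiv_eq_zero_iff e' hx n ((lamEquiv e' hx).symm a)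
  rw [AlgEquiv.apply_symm_apply] at h
  rw [level_eq_level e e', h]
  have hp : param p σ = fun i => lamEquiv e' hx (stdParam p d i) := by
    funext i
    rw [lamEquiv_param, he]
  rw [hp, ← map_omegaIdeal (lamEquiv e' hx)]
  constructor
  · intro h
    have := Ideal.mem_map_of_mem (lamEquiv e' hx) h
    rwa [AlgEquiv.apply_symm_apply] at this
  · intro h
    obtain ⟨b, hb, rfl⟩ := (Ideal.mem_map_iff_of_surjective _ (lamEquiv e' hx).surjective).1 h
    rwa [AlgEquiv.symm_apply_apply]

theorem IsZpBasis.omegaIdeal_eq {σ σ' : Fin d → Γ} (hσ : IsZpBasis p σ) (hσ' : IsZpBasis p σ')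
    (n : ℕ) : omegaIdeal p (param p σ) n = omegaIdeal p (param p σ') n := by
  obtain ⟨e, he⟩ := id hσ
  ext a
  rw [← hσ.projAt_level_eq_zero_iff e, hσ'.projAt_level_eq_zero_iff e]

theorem IsZpBasis.omega_mem {σ : Fin d → Γ} (hσ : IsZpBasis p σ) (g : Γ) (n : ℕ) :
    omega p g n ∈ omegaIdeal p (param p σ) n := by
  obtain ⟨e, he⟩ := id hσ
  rw [← hσ.projAt_level_eq_zero_iff e, omega, map_sub, projAt_of, map_one,
    (QuotientGroup.eq_one_iff _).2 (pow_mem_level e n g)]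
  exact sub_self _

theorem IsZpBasis.of_sub_one_mem {σ : Fin d → Γ} (hσ : IsZpBasis p σ) [IsLocalRing (Lam p Γ)]
    (g : Γ) : of p g - 1 ∈ IsLocalRing.maximalIdeal (Lam p Γ) := by
  have := hσ.omega_mem g 0
  rw [omega, pow_zero, pow_one] at this
  rw [hσ.isIwasawaRing.maximalIdeal_eq]
  exact Ideal.pow_le_self (by simp) (omegaIdeal_le _ _ this)

end Levels

/-! ### Endomorphisms of Λ_Γ induced by power maps -/

section PowHom

variable {p : ℕ} [Fact p.Prime] {Γ : Type*} [CommGroup Γ] [TopologicalSpace Γ] {d : ℕ}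

/-- The endomorphism of `Λ_Γ` induced by `g ↦ g ^ a`. -/
def powHom (p : ℕ) [Fact p.Prime] (Γ : Type*) [CommGroup Γ] [TopologicalSpace Γ] (a : ℕ) :
    Lam p Γ →ₐ[ℤ_[p]] Lam p Γ :=
  AlgHom.codRestrict (AlgHom.pi fun U : OpenSubgroup Γ =>
    (MonoidAlgebra.mapDomainAlgHom ℤ_[p] ℤ_[p] (powMonoidHom a : Γ ⧸ U.toSubgroup →* _)).comp
      (projAt U)) (completedGroupAlgebra p Γ) (by
      intro x U V h
      have : (transition p h).comp
          (MonoidAlgebra.mapDomainAlgHom ℤ_[p] ℤ_[p] (powMonoidHom a : Γ ⧸ U.toSubgroup →* _)) =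
          (MonoidAlgebra.mapDomainAlgHom ℤ_[p] ℤ_[p]
            (powMonoidHom a : Γ ⧸ V.toSubgroup →* _)).comp (transition p h) := by
        refine MonoidAlgebra.algHom_ext (fun g => ?_) (by ext)
        obtain ⟨g, rfl⟩ := QuotientGroup.mk_surjective g
        simp only [AlgHom.comp_apply]
        rw [transition_single]
        simp only [MonoidAlgebra.mapDomainAlgHom_apply, MonoidAlgebra.mapDomain_single,
          powMonoidHom_apply, ← QuotientGroup.mk_pow]
        exact transition_single h _
      have h2 := DFunLike.congr_fun this (projAt U x)
      rw [AlgHom.comp_apply, AlgHom.comp_apply, transition_projAt] at h2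
      exact h2)

theorem projAt_powHom (a : ℕ) (U : OpenSubgroup Γ) (x : Lam p Γ) :
    projAt U (powHom p Γ a x) =
      MonoidAlgebra.mapDomainAlgHom ℤ_[p] ℤ_[p] (powMonoidHom a : Γ ⧸ U.toSubgroup →* _)
        (projAt U x) := rfl

theorem powHom_of (a : ℕ) (g : Γ) : powHom p Γ a (of p g) = of p (g ^ a) := by
  refine lam_ext fun U => ?_
  rw [projAt_powHom, projAt_of, projAt_of]
  exact MonoidAlgebra.mapDomain_single

/-- At level n this is `mapDomain_pow_mul_eq_zero`. It makes the image of x a substitute for x in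
annihilation arguments, useful when the image has no factor in common with x. -/
theorem IsZpBasis.powHom_mul_mem {σ : Fin d → Γ} (hσ : IsZpBasis p σ) {a : ℕ} (ha : a.Coprime p)
    (n : ℕ) (x y : Lam p Γ) (h : x * y ∈ omegaIdeal p (param p σ) n) :
    powHom p Γ a x * y ∈ omegaIdeal p (param p σ) n := by
  obtain ⟨e, he⟩ := id hσ
  have := finite_level_quotient e n
  rw [← hσ.projAt_level_eq_zero_iff e, map_mul] at h ⊢
  rw [projAt_powHom]
  refine mapDomain_pow_mul_eq_zero (n := n) (fun g => ?_) ha _ _ h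
  obtain ⟨g, rfl⟩ := QuotientGroup.mk_surjective g
  rw [← QuotientGroup.mk_pow]
  exact (QuotientGroup.eq_one_iff _).2 (pow_mem_level e n g)

end PowHom

end
end IwasawaTower

/-! ### Regularity in coordinates and norm elements -/

namespace IwasawaTower

noncomputable section

open PowerSeries IsLocalRing IsIwasawaRing

theorem NZDMod.of_mul_left {R : Type*} [CommRing R] {𝔟 : Ideal R} {c e : R}
    (h : NZDMod 𝔟 (c * e)) : NZDMod 𝔟 c := fun x hx => h x (by
  rw [mul_comm c, mul_assoc]; exact Ideal.mul_mem_left _ _ hx)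

theorem NZDMod.of_mul_right {R : Type*} [CommRing R] {𝔟 : Ideal R} {c e : R}
    (h : NZDMod 𝔟 (c * e)) : NZDMod 𝔟 e := NZDMod.of_mul_left (mul_comm c e ▸ h)

theorem NZDMod.comap {R S : Type*} [CommRing R] [CommRing S] {𝔟 : Ideal S} (f : R →+* S) {c : R}
    (h : NZDMod 𝔟 (f c)) : NZDMod (𝔟.comap f) c := fun x hx => h _ (by
  rw [← map_mul]; exact hx)

theorem NZDMod.map_equiv {p : ℕ} [Fact p.Prime] {R S : Type*} [CommRing R] [CommRing S]
    [Algebra ℤ_[p] R] [Algebra ℤ_[p] S] {𝔟 : Ideal R}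
    (E : R ≃ₐ[ℤ_[p]] S) {c : R} (h : NZDMod 𝔟 c) : NZDMod (𝔟.map E) (E c) := by
  intro x hx
  obtain ⟨x, rfl⟩ := E.surjective x
  rw [← map_mul] at hx
  obtain ⟨y, hy, e⟩ := (Ideal.mem_map_iff_of_surjective _ E.surjective).1 hx
  rw [E.injective.eq_iff] at e
  exact Ideal.mem_map_of_mem E (h x (e ▸ hy))

variable {p : ℕ} [Fact p.Prime]

theorem exists_coeff_one_add_X_pow_notMem {A : Type*} [CommRing A] [IsLocalRing A]
    (hp : (p : A) ∈ maximalIdeal A) (n : ℕ) :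
    ∃ i, coeff i ((1 + X) ^ p ^ n - 1 : A⟦X⟧) ∉ maximalIdeal A := by
  by_contra hcon
  push Not at hcon
  have hchar : CharP (ResidueField A) p := by
    rw [CharP.charP_iff_prime_eq_zero (Fact.out : p.Prime), ← map_natCast (residue A)]
    exact Ideal.Quotient.eq_zero_iff_mem.2 hp
  have hchar' : CharP (PowerSeries (ResidueField A)) p :=
    charP_of_injective_ringHom (f := PowerSeries.C) PowerSeries.C_injective p
  have h0 : ((1 + X) ^ p ^ n - 1 : A⟦X⟧).map (residue A) = 0 := by
    ext i
    rw [coeff_map, map_zero]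
    exact Ideal.Quotient.eq_zero_iff_mem.2 (hcon i)
  simp only [map_sub, map_pow, map_add, map_one, PowerSeries.map_X] at h0
  rw [add_pow_char_pow, one_pow, add_sub_cancel_left] at h0
  exact pow_ne_zero _ PowerSeries.X_ne_zero h0

/-! ### Regular sequences of ω's and norm elements -/

section Coordinates

variable {Γ : Type*} [CommGroup Γ] [TopologicalSpace Γ] {d : ℕ} {σ : Fin d → Γ}

/-- Exchanging j with the first index makes σ_j - 1 the power series variable and the other
parameters constants. -/
theorem IsZpBasis.exists_coordinates (hσ : IsZpBasis p σ) (j : Fin d) :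
    ∃ (d' : ℕ) (E : PowerSeries (Lam p (Multiplicative (Fin d' → ℤ_[p]))) ≃ₐ[ℤ_[p]] Lam p Γ),
      E X = param p σ j ∧ (∀ i, ∃ i', i' ≠ j ∧ E (C (stdParam p d' i)) = param p σ i') ∧
        ∀ i', i' ≠ j → ∃ i, E (C (stdParam p d' i)) = param p σ i' := by
  obtain ⟨d', rfl⟩ : ∃ d', d = d' + 1 := ⟨d - 1, by have := j.2; omega⟩
  obtain ⟨E, h0, hs⟩ := (hσ.perm (Equiv.swap 0 j)).exists_powerSeries_equiv
  refine ⟨d', E, ?_, fun i => ⟨Equiv.swap 0 j i.succ, ?_, hs i⟩, fun i' hi' => ?_⟩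
  · rw [h0, Function.comp_apply, Equiv.swap_apply_left]
  · intro h
    have := (Equiv.swap_apply_eq_iff.1 h)
    rw [Equiv.swap_apply_right] at this
    exact Fin.succ_ne_zero _ this
  · have hne : Equiv.swap 0 j i' ≠ 0 := by
      intro h
      have := (Equiv.swap_apply_eq_iff.1 h)
      rw [Equiv.swap_apply_left] at this
      exact hi' this
    obtain ⟨i, hi⟩ := Fin.exists_succ_eq.2 hne
    refine ⟨i, ?_⟩
    rw [hs, hi, Function.comp_apply, Equiv.swap_apply_self]

theorem omega_mem_adjoin {ι : Type*} (σ : ι → Γ) {s : Set ι} {i : ι} (hi : i ∈ s) (n : ℕ) :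
    omega p (σ i) n ∈ Algebra.adjoin ℤ_[p] (param p σ '' s) := by
  rw [← one_add_param_pow]
  exact Subalgebra.sub_mem _ (Subalgebra.pow_mem _ (Subalgebra.add_mem _ (Subalgebra.one_mem _)
    (Algebra.subset_adjoin (Set.mem_image_of_mem _ hi))) _) (Subalgebra.one_mem _)

theorem nu_mem_adjoin {ι : Type*} (σ : ι → Γ) {s : Set ι} {i : ι} (hi : i ∈ s) (n m : ℕ) :
    nu p (σ i) n m ∈ Algebra.adjoin ℤ_[p] (param p σ '' s) := by
  refine Subalgebra.sum_mem _ fun k _ => Subalgebra.pow_mem _ ?_ _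
  have := Subalgebra.add_mem _ (omega_mem_adjoin (p := p) σ hi n) (Subalgebra.one_mem _)
  rwa [omega, sub_add_cancel] at this

/-- `ω_{σ_j,n}` is regular modulo every ideal generated by polynomials in the `σ_i`, `i ≠ j`. -/
theorem IsZpBasis.nzdMod_omega (hσ : IsZpBasis p σ) (j : Fin d) (S : Set (Lam p Γ))
    (hS : ∀ s ∈ S, s ∈ Algebra.adjoin ℤ_[p] (param p σ '' {i | i ≠ j})) (n : ℕ) :
    NZDMod (Ideal.span S) (omega p (σ j) n) := by
  obtain ⟨d', E, h0, -, h2⟩ := hσ.exists_coordinates j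
  have hx := stdParam_isIwasawaRing (p := p) d'
  have := hx.noeth
  have := hx.isLocalRing
  have := hx.maximalIdeal_eq
  set φ := E.toAlgHom.comp (IsScalarTower.toAlgHom ℤ_[p]
    (Lam p (Multiplicative (Fin d' → ℤ_[p]))) (Lam p (Multiplicative (Fin d' → ℤ_[p])))⟦X⟧) with hφ
  have hφ' : ∀ a, φ a = E (C a) := fun a => rfl
  have hrange : Algebra.adjoin ℤ_[p] (param p σ '' {i | i ≠ j}) ≤ φ.range := by
    rw [Algebra.adjoin_le_iff]
    rintro _ ⟨i', hi', rfl⟩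
    obtain ⟨i, hi⟩ := h2 i' hi'
    exact ⟨_, hi⟩
  have hspan : Ideal.span S = ((Ideal.span (φ ⁻¹' S)).map C).map E := by
    rw [Ideal.map_span, Ideal.map_span, Set.image_image]
    congr 1
    ext s
    constructor
    · intro hs
      obtain ⟨a, rfl⟩ := hrange (hS s hs)
      exact ⟨a, hs, rfl⟩
    · rintro ⟨a, ha, rfl⟩
      exact ha
  have homega : omega p (σ j) n = E ((1 + X) ^ p ^ n - 1) := by
    rw [← one_add_param_pow, ← h0]; simp
  rw [hspan, homega]
  exact (nzdMod_map_C _ _ (exists_coeff_one_add_X_pow_notMem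
    (hx.maximalIdeal_eq ▸ p_mem p _) n)).map_equiv E

theorem span_omega_image_mixedIdeal (K : Ideal (Lam p Γ)) (u : Finset (Fin d)) {n m : ℕ}
    (h : n ≤ m) :
    mixedIdeal K (fun i => omega p (σ i) n) (fun i => nu p (σ i) n m) u ∅ =
      K ⊔ Ideal.span ((fun i => omega p (σ i) m) '' u) := by
  simp only [mixedIdeal, Finset.notMem_empty, if_false, mul_comm (omega p _ n), nu_mul_omega p _ h]

theorem span_omega_image_mixedIdeal_self (K : Ideal (Lam p Γ)) (u : Finset (Fin d)) (n m : ℕ) :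
    mixedIdeal K (fun i => omega p (σ i) n) (fun i => nu p (σ i) n m) u u =
      K ⊔ Ideal.span ((fun i => omega p (σ i) n) '' u) := by
  rw [mixedIdeal]
  congr 2
  refine Set.image_congr fun i hi => ?_
  rw [if_pos (Finset.mem_coe.1 hi)]

/-- The product is ω_{σ_j,m}, while all generators of the ideal are polynomials in the other
parameters. Regularity of the product gives that of both factors. -/
theorem IsZpBasis.nzdMod_mixedIdeal (hσ : IsZpBasis p σ) (S : Set (Lam p Γ)) (u : Finset (Fin d))
    (hS : ∀ s ∈ S, s ∈ Algebra.adjoin ℤ_[p] (param p σ '' {i | i ∉ u})) {n m : ℕ} (h : n ≤ m)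
    (j : Fin d) (hj : j ∈ u) (s : Finset (Fin d)) :
    NZDMod (mixedIdeal (Ideal.span S) (fun i => omega p (σ i) n) (fun i => nu p (σ i) n m)
      (u.erase j) s) (nu p (σ j) n m * omega p (σ j) n) := by
  rw [nu_mul_omega p _ h, mixedIdeal, ← Ideal.span_union]
  refine hσ.nzdMod_omega j _ ?_ m
  rintro t (ht | ⟨i, hi, rfl⟩)
  · refine Algebra.adjoin_mono (Set.image_mono ?_) (hS t ht)
    rintro i hi rfl
    exact hi hj
  · have hi' : i ∈ {i | i ≠ j} := by simp at hi; exact hi.2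
    dsimp only
    split_ifs
    · exact omega_mem_adjoin σ hi' n
    · exact Subalgebra.mul_mem _ (omega_mem_adjoin σ hi' n) (nu_mem_adjoin σ hi' n m)

theorem IsZpBasis.mem_of_prod_nu_mul_mem (hσ : IsZpBasis p σ) (S : Set (Lam p Γ))
    (u : Finset (Fin d)) (hS : ∀ s ∈ S, s ∈ Algebra.adjoin ℤ_[p] (param p σ '' {i | i ∉ u}))
    {n m : ℕ} (h : n ≤ m) (x : Lam p Γ)
    (hx : (∏ i ∈ u, nu p (σ i) n m) * x ∈
      Ideal.span S ⊔ Ideal.span ((fun i => omega p (σ i) m) '' u)) :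
    x ∈ Ideal.span S ⊔ Ideal.span ((fun i => omega p (σ i) n) '' u) := by
  rw [← span_omega_image_mixedIdeal _ _ h] at hx
  rw [← span_omega_image_mixedIdeal_self _ _ n m]
  exact mem_mixedIdeal_of_prod_mul_mem
    (fun j hj s _ _ => (hσ.nzdMod_mixedIdeal S u hS h j hj s).of_mul_left) u subset_rfl x hx

theorem omegaIdeal_param_eq_image (n : ℕ) : omegaIdeal p (param p σ) n =
    Ideal.span ∅ ⊔ Ideal.span ((fun i => omega p (σ i) n) '' (Finset.univ : Finset (Fin d))) := by
  rw [omegaIdeal_param, Ideal.span_empty, bot_sup_eq, Finset.coe_univ, Set.image_univ]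

theorem IsZpBasis.mem_of_normElt_mul_mem (hσ : IsZpBasis p σ) {n m : ℕ} (h : n ≤ m) {x : Lam p Γ}
    (hx : normElt p σ n m * x ∈ omegaIdeal p (param p σ) m) : x ∈ omegaIdeal p (param p σ) n := by
  rw [omegaIdeal_param_eq_image] at hx ⊢
  exact hσ.mem_of_prod_nu_mul_mem ∅ Finset.univ (by simp) h x hx

theorem normElt_mul_mem {n m : ℕ} (h : n ≤ m) {x : Lam p Γ}
    (hx : x ∈ omegaIdeal p (param p σ) n) : normElt p σ n m * x ∈ omegaIdeal p (param p σ) m := by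
  rw [omegaIdeal_param_eq_image] at hx ⊢
  rw [← span_omega_image_mixedIdeal_self _ _ n m] at hx
  rw [← span_omega_image_mixedIdeal _ _ h]
  exact prod_mul_mem_mixedIdeal _ _ hx

/-- In the group ring Λ/I_m this says that elements invariant under the p^n-th powers are multiples
of the norm element. -/
theorem IsZpBasis.exists_sub_normElt_mul_mem (hσ : IsZpBasis p σ) {n m : ℕ} (h : n ≤ m)
    {x : Lam p Γ} (hx : ∀ i, omega p (σ i) n * x ∈ omegaIdeal p (param p σ) m) :
    ∃ y, x - normElt p σ n m * y ∈ omegaIdeal p (param p σ) m := by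
  simp only [omegaIdeal_param_eq_image (p := p) (σ := σ) m,
    ← span_omega_image_mixedIdeal (Ideal.span ∅) Finset.univ h] at hx ⊢
  exact exists_prod_mul_sub_mem_mixedIdeal
    (fun j hj s _ _ => (hσ.nzdMod_mixedIdeal ∅ _ (by simp) h j hj s).of_mul_left)
    (fun j hj s _ _ => (hσ.nzdMod_mixedIdeal ∅ _ (by simp) h j hj s).of_mul_right)
    Finset.univ subset_rfl x fun i _ => hx i

theorem nu_sub_natCast_mem (g : Γ) (n m : ℕ) :
    nu p g n m - (p ^ (m - n) : ℕ) ∈ Ideal.span {omega p g n} := by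
  rw [← Ideal.Quotient.eq_zero_iff_mem]
  have h1 : Ideal.Quotient.mk (Ideal.span {omega p g n}) (of p (g ^ p ^ n)) = 1 := by
    rw [← sub_eq_zero, ← map_one (Ideal.Quotient.mk _), ← map_sub]
    exact Ideal.Quotient.eq_zero_iff_mem.2 (Ideal.mem_span_singleton_self _)
  rw [nu, map_sub, map_sum]
  simp only [map_pow _ (of p (g ^ p ^ n)), h1, one_pow, Finset.sum_const, Finset.card_range, nsmul_one,
    map_natCast, sub_self]

/-- Modulo ω_{σ_i,n} each of the p^{m-n} summands of ν_{σ_i,n,m} is 1. -/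
theorem normElt_sub_natCast_mem (n m : ℕ) :
    normElt p σ n m - ((p ^ (m - n)) ^ d : ℕ) ∈ omegaIdeal p (param p σ) n := by
  rw [← Ideal.Quotient.eq_zero_iff_mem]
  have h1 : ∀ i, Ideal.Quotient.mk (omegaIdeal p (param p σ) n) (nu p (σ i) n m) =
      (p ^ (m - n) : ℕ) := fun i => by
    rw [← sub_eq_zero, ← map_natCast (Ideal.Quotient.mk _), ← map_sub,
      Ideal.Quotient.eq_zero_iff_mem, omegaIdeal_param]
    exact Ideal.span_mono (Set.singleton_subset_iff.2 (Set.mem_range_self i)) (nu_sub_natCast_mem (σ i) n m)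
  rw [normElt, map_sub, map_prod]
  simp only [h1, Finset.prod_const, Finset.card_univ, Fintype.card_fin, map_natCast]
  push_cast
  exact sub_self _

theorem omega_mul_normElt_mem {n m : ℕ} (h : n ≤ m) (i : Fin d) :
    omega p (σ i) n * normElt p σ n m ∈ omegaIdeal p (param p σ) m := by
  rw [mul_comm]
  refine normElt_mul_mem h ?_
  rw [omegaIdeal_param]
  exact Ideal.subset_span ⟨i, rfl⟩

/-- The norm elements of two bases differ by a multiple, modulo `I_m`. -/
theorem IsZpBasis.exists_normElt_sub_mem {σ' : Fin d → Γ} (hσ : IsZpBasis p σ)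
    (hσ' : IsZpBasis p σ') {n m : ℕ} (h : n ≤ m) :
    ∃ y, normElt p σ n m - normElt p σ' n m * y ∈ omegaIdeal p (param p σ') m := by
  refine hσ'.exists_sub_normElt_mul_mem h fun i => ?_
  rw [hσ'.omegaIdeal_eq hσ, mul_comm]
  exact normElt_mul_mem h (hσ.omega_mem (σ' i) n)

/-- Setting σ_j = 1 turns the quotient into that of the Iwasawa ring in the remaining variables by
its ω's, which is ℤ_p-free. -/
theorem IsZpBasis.nzdMod_natCast_sup (hσ : IsZpBasis p σ) (j : Fin d) (m : ℕ) {N : ℕ} (hN : N ≠ 0) :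
    NZDMod (Ideal.span ((fun i => omega p (σ i) m) '' {i | i ≠ j}) ⊔ Ideal.span {param p σ j})
      (N : Lam p Γ) := by
  obtain ⟨d', E, h0, h1, h2⟩ := hσ.exists_coordinates j
  have hx := stdParam_isIwasawaRing (p := p) d'
  have he : ∀ a b, E (C (stdParam p d' a)) = param p σ b →
      E (C ((1 + stdParam p d' a) ^ p ^ m - 1)) = omega p (σ b) m := fun a b h => by
    rw [← one_add_param_pow, ← h]; simp
  have hI : Ideal.span ((fun i => omega p (σ i) m) '' {i | i ≠ j}) ⊔ Ideal.span {param p σ j} =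
      ((omegaIdeal p (stdParam p d') m).comap constantCoeff).map E := by
    rw [← sup_span_X_eq_comap, Ideal.map_sup, Ideal.map_span, Set.image_singleton, h0, omegaIdeal,
      Ideal.map_span, Ideal.map_span, Set.image_image, ← Set.range_comp]
    congr 2
    ext f
    constructor
    · rintro ⟨b, hb, rfl⟩
      obtain ⟨a, ha⟩ := h2 b hb
      exact ⟨a, he a b ha⟩
    · rintro ⟨a, rfl⟩
      obtain ⟨b, hb, ha⟩ := h1 a
      exact ⟨b, hb, (he a b ha).symm⟩
  rw [hI, ← map_natCast E]
  refine NZDMod.map_equiv E (NZDMod.comap _ ?_)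
  rw [map_natCast]
  exact hx.nzdMod_natCast m hN

/-- `ν_{σ_j,n,m}` is regular modulo the `ω_{σ_i,m}`, `i ≠ j`, and a power of `σ_j - 1`. -/
theorem IsZpBasis.nzdMod_nu (hσ : IsZpBasis p σ) (j : Fin d) (n m k : ℕ) :
    NZDMod (Ideal.span ((fun i => omega p (σ i) m) '' {i | i ≠ j}) ⊔
      Ideal.span {param p σ j ^ k}) (nu p (σ j) n m) := by
  have h0 : omega p (σ j) 0 = param p σ j := by rw [omega, pow_zero, pow_one]
  have hT := hσ.nzdMod_omega j ((fun i => omega p (σ i) m) '' {i | i ≠ j}) (by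
    rintro _ ⟨i, hi, rfl⟩
    exact omega_mem_adjoin σ hi m) 0
  rw [h0] at hT
  -- Modulo σ_j - 1 itself, ν_{σ_j,n,m} equals p ^ (m - n), which is regular there.
  refine hT.sup_span_pow ((hσ.nzdMod_natCast_sup j m
    (pow_ne_zero (m - n) (Fact.out : p.Prime).ne_zero)).congr (Ideal.mem_sup_right ?_)) k
  rw [← neg_sub]
  refine neg_mem (Ideal.span_singleton_le_span_singleton.2 ?_ (nu_sub_natCast_mem (σ j) n m))
  rw [omega, map_pow]
  exact sub_one_dvd_pow_sub_one (of p (σ j)) (p ^ n)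

end Coordinates

end
end IwasawaTower

/-! ### Torsion modulo a prime element -/

namespace IwasawaTower

noncomputable section

open PowerSeries IsLocalRing IsIwasawaRing

/-! ### Quotients by a distinguished polynomial -/

section Distinguished

open scoped Polynomial

variable {A : Type*} [CommRing A] [IsLocalRing A] [IsAdicComplete (maximalIdeal A) A]

/-- The powers of `X` form a basis of `A⟦X⟧ / (q)`, for `q` distinguished. -/
def distinguishedBasis {q : A[X]} (hq : q.IsDistinguishedAt (maximalIdeal A)) :
    Module.Basis (Fin q.natDegree) A (A⟦X⟧ ⧸ Ideal.span {(q : A⟦X⟧)}) :=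
  (AdjoinRoot.powerBasisAux' hq.monic).map
    (show AdjoinRoot q ≃ₗ[A] _ from hq.algEquivQuotient.toLinearEquiv)

theorem mk_mem_map_algebraMap_iff {I : Ideal A⟦X⟧} (𝔟 : Ideal A) (z : A⟦X⟧) :
    Ideal.Quotient.mk I z ∈ 𝔟.map (algebraMap A (A⟦X⟧ ⧸ I)) ↔ z ∈ 𝔟.map C ⊔ I := by
  have h : 𝔟.map (algebraMap A (A⟦X⟧ ⧸ I)) = (𝔟.map C).map (Ideal.Quotient.mk I) := by
    rw [Ideal.map_map]; rfl
  rw [h, ← Ideal.mem_comap, Ideal.comap_map_of_surjective' _ Ideal.Quotient.mk_surjective,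
    Ideal.mk_ker]

theorem nzdMod_map_C_sup_span {q : A[X]} (hq : q.IsDistinguishedAt (maximalIdeal A)) {𝔟 : Ideal A}
    {c : A} (hc : NZDMod 𝔟 c) : NZDMod (𝔟.map C ⊔ Ideal.span {(q : A⟦X⟧)}) (C c) := by
  intro z hz
  rw [← mk_mem_map_algebraMap_iff, mem_map_algebraMap_iff_repr (distinguishedBasis hq)] at hz ⊢
  intro i
  refine hc _ ?_
  have h : Ideal.Quotient.mk (Ideal.span {(q : A⟦X⟧)}) (C c * z) =
      c • Ideal.Quotient.mk (Ideal.span {(q : A⟦X⟧)}) z := by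
    rw [← smul_eq_C_mul]; rfl
  have := hz i
  rwa [h, map_smul, Finsupp.smul_apply, smul_eq_mul] at this

theorem eq_zero_of_dvd_C {q : A[X]} (hq : q.IsDistinguishedAt (maximalIdeal A))
    (hp : Prime (q : A⟦X⟧)) {a : A} (h : (q : A⟦X⟧) ∣ C a) : a = 0 := by
  have : (Ideal.span {(q : A⟦X⟧)}).IsPrime := (Ideal.span_singleton_prime hp.ne_zero).2 hp
  have : Module.Free A (A⟦X⟧ ⧸ Ideal.span {(q : A⟦X⟧)}) := Module.Free.of_basis (distinguishedBasis hq)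
  have h1 : algebraMap A (A⟦X⟧ ⧸ Ideal.span {(q : A⟦X⟧)}) a = 0 :=
    Ideal.Quotient.eq_zero_iff_mem.2 (Ideal.mem_span_singleton.2 h)
  exact (FaithfulSMul.algebraMap_eq_zero_iff A _).1 h1

/-- δ is the discriminant of A⟦X⟧/(q) over A. What matters is that it is chosen before 𝔟, so one δ
serves for the ω-ideals of all levels. -/
theorem exists_ne_zero_C_mul_mem [IsDomain A] [CharZero A] {q : A[X]}
    (hq : q.IsDistinguishedAt (maximalIdeal A)) (hp : Prime (q : A⟦X⟧)) :
    ∃ δ : A, δ ≠ 0 ∧ ∀ 𝔟 : Ideal A, 𝔟.IsRadical → ∀ y : A⟦X⟧,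
      y ∈ (𝔟.map C ⊔ Ideal.span {(q : A⟦X⟧)}).radical →
        C δ * y ∈ 𝔟.map C ⊔ Ideal.span {(q : A⟦X⟧)} := by
  have : (Ideal.span {(q : A⟦X⟧)}).IsPrime := (Ideal.span_singleton_prime hp.ne_zero).2 hp
  have : Module.Free A (A⟦X⟧ ⧸ Ideal.span {(q : A⟦X⟧)}) := Module.Free.of_basis (distinguishedBasis hq)
  refine ⟨Algebra.discr A (distinguishedBasis hq), discr_ne_zero_of_isDomain _,
    fun 𝔟 h𝔟 y hy => ?_⟩
  obtain ⟨N, hN⟩ := hy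
  rw [← mk_mem_map_algebraMap_iff, map_pow] at hN
  rw [← mk_mem_map_algebraMap_iff]
  exact discr_mul_mem (distinguishedBasis hq) 𝔟 h𝔟 _ hN

end Distinguished

open scoped Polynomial in
theorem coe_eq_eval₂ {A : Type*} [CommRing A] (q : A[X]) : (q : A⟦X⟧) = q.eval₂ (C (R := A)) X := by
  have : Polynomial.coeToPowerSeries.ringHom (R := A) = Polynomial.eval₂RingHom C X := by
    refine Polynomial.ringHom_ext (fun a => ?_) ?_ <;> simp
  exact DFunLike.congr_fun this q

/-- With η = 1 + y + ⋯ + y^{M-1}, multiplication by δη sends the multiples of y - 1 into 𝔠, so the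
regular N can be cancelled there; and η ≡ M modulo y - 1. -/
theorem sup_span_geom_mem {R : Type*} [CommRing R] {𝔠 : Ideal R} {δ y v : R} {N M : ℕ}
    (hN : NZDMod 𝔠 (N : R)) (hδ : δ * (y ^ M - 1) ∈ 𝔠)
    (hv : N * v ∈ 𝔠 ⊔ Ideal.span {y - 1}) : δ * M * v ∈ 𝔠 ⊔ Ideal.span {y - 1} := by
  obtain ⟨c, hc, b, hb, e⟩ := Submodule.mem_sup.1 hv
  obtain ⟨b, rfl⟩ := Ideal.mem_span_singleton.1 hb
  set η := ∑ i ∈ Finset.range M, y ^ i with hη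
  have h1 : η * (y - 1) = y ^ M - 1 := geom_sum_mul y M
  have h2 : δ * η * v ∈ 𝔠 := hN _ (by
    have : (N : R) * (δ * η * v) = δ * η * c + δ * (y ^ M - 1) * b := by
      rw [← h1]; linear_combination (-δ * η) * e
    rw [this]
    exact Ideal.add_mem _ (Ideal.mul_mem_left _ _ hc) (Ideal.mul_mem_right _ _ hδ))
  have h3 : η - M ∈ Ideal.span {y - 1} := by
    have : η - M = ∑ i ∈ Finset.range M, (y ^ i - 1) := by simp [hη]
    rw [this]
    exact Ideal.sum_mem _ fun i _ => Ideal.mem_span_singleton.2 (sub_one_dvd_pow_sub_one y i)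
  have : δ * M * v = δ * η * v - δ * v * (η - M) := by ring
  rw [this]
  exact Ideal.sub_mem _ (Ideal.mem_sup_left h2) (Ideal.mem_sup_right (Ideal.mul_mem_left _ _ h3))

/-! ### Stability under power maps and bounded torsion -/

section Roots

variable {p : ℕ} [Fact p.Prime] {Γ : Type*} [CommGroup Γ] [TopologicalSpace Γ] {d : ℕ}
  {σ : Fin (d + 1) → Γ}

/-- A polynomial in `σ_0 - 1` whose root set is stable under `σ_0 ↦ σ_0 ^ a` divides a power of
`σ_0 ^ N - 1`, modulo the `ω_{σ_i,n}`, `i ≠ 0`. -/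
theorem IsZpBasis.omega_mem_radical (hσ : IsZpBasis p σ)
    (E : PowerSeries (Lam p (Multiplicative (Fin d → ℤ_[p]))) ≃ₐ[ℤ_[p]] Lam p Γ)
    (h0 : E X = param p σ 0) (hs : ∀ i, E (C (stdParam p d i)) = param p σ i.succ)
    (q : Polynomial (Lam p (Multiplicative (Fin d → ℤ_[p])))) (hq : q.Monic)
    (hstable : ∀ a : ℕ, a.Coprime p → E q ∣ powHom p Γ a (E q)) (n : ℕ) :
    ((1 + X) ^ p ^ n) ^ (p * q.natDegree.factorial) - 1 ∈
      ((omegaIdeal p (stdParam p d) n).map C ⊔ Ideal.span {(q : (Lam p _)⟦X⟧)}).radical := by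
  have hnoeth := hσ.isIwasawaRing.noeth
  have hloc := hσ.isLocalRing
  have hx := stdParam_isIwasawaRing (p := p) d
  rw [Ideal.radical_eq_sInf, Ideal.mem_sInf]
  rintro 𝔮 ⟨hle, h𝔮⟩
  let D := PowerSeries (Lam p (Multiplicative (Fin d → ℤ_[p]))) ⧸ 𝔮
  let mk : Lam p Γ →+* D := (Ideal.Quotient.mk 𝔮).comp (E.symm : Lam p Γ →+* _)
  have hmk : ∀ z, mk (E z) = Ideal.Quotient.mk 𝔮 z := fun z =>
    congrArg (Ideal.Quotient.mk 𝔮) (E.symm_apply_apply z)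
  let ρ := (Ideal.Quotient.mk 𝔮).comp (C (R := Lam p (Multiplicative (Fin d → ℤ_[p]))))
  let s : D := mk (of p (σ 0))
  have hsu : IsUnit s := ((Group.isUnit (σ 0)).map (of p)).map mk
  have hs1 : s = Ideal.Quotient.mk 𝔮 (1 + X) := by
    rw [← hmk, map_add, h0, map_one, param, add_sub_cancel]
  have homega : ∀ i : Fin d, mk (of p (σ i.succ)) ^ p ^ n = 1 := by
    intro i
    have h1 : of p (σ i.succ) = E (C (1 + stdParam p d i)) := by
      rw [map_add, map_add, hs, map_one, map_one, param, add_sub_cancel]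
    rw [h1, hmk, ← map_pow, ← sub_eq_zero, ← map_one (Ideal.Quotient.mk 𝔮), ← map_sub,
      Ideal.Quotient.eq_zero_iff_mem]
    refine hle (Ideal.mem_sup_left ?_)
    rw [← map_pow, ← map_one C, ← map_sub]
    exact Ideal.mem_map_of_mem _ (Ideal.subset_span ⟨i, rfl⟩)
  have hroot : ∀ j : ℕ, (q.map ρ).eval (s ^ (1 + j * p ^ (n + 1)) - 1) = 0 := by
    intro j
    -- Since σ_i^{p^n} = 1 modulo 𝔮 for i ≠ 0, the a-th power map fixes the coefficients of q there
    -- and moves its root s - 1 to s ^ a - 1. The exponent n + 1 rather than n keeps a prime to p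
    -- also for n = 0.
    set a := 1 + j * p ^ (n + 1) with ha
    have hcop : a.Coprime p := by
      rw [ha, pow_succ, ← mul_assoc, Nat.coprime_add_mul_right_left]
      exact Nat.coprime_one_left p
    have hE0 : mk (E q) = 0 := by
      rw [hmk, Ideal.Quotient.eq_zero_iff_mem]
      exact hle (Ideal.mem_sup_right (Ideal.mem_span_singleton_self _))
    have hE1 : mk (powHom p Γ a (E q)) = 0 := by
      obtain ⟨r, hr⟩ := hstable a hcop
      rw [hr, map_mul, hE0, zero_mul]
    have hcoef : ∀ c, mk (powHom p Γ a (E (C c))) = ρ c := by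
      intro c
      let ι : Lam p (Multiplicative (Fin d → ℤ_[p])) →ₐ[ℤ_[p]] Lam p Γ :=
        E.toAlgHom.comp (IsScalarTower.toAlgHom ℤ_[p] _ _)
      have hι : ∀ i, ι (stdParam p d i) = of p (σ i.succ) - 1 := hs
      have hpι : ∀ i, (powHom p Γ a).comp ι (stdParam p d i) = of p (σ i.succ ^ a) - 1 := by
        intro i
        rw [AlgHom.comp_apply, hι, map_sub, map_one, powHom_of]
      have key := hx.sub_mem_of_forall ((powHom p Γ a).comp ι) ι (RingHom.ker mk)
        (fun i => by rw [hpι]; exact hσ.of_sub_one_mem _)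
        (fun i => by rw [hι]; exact hσ.of_sub_one_mem _)
        (by rw [hσ.isIwasawaRing.maximalIdeal_eq]; exact p_mem p _)
        (fun i => by
          rw [hpι, hι, RingHom.mem_ker, sub_sub_sub_cancel_right, map_sub, map_pow, map_pow, ha,
            pow_add, pow_one, pow_succ, mul_comm j, mul_assoc, pow_mul, homega, one_pow, mul_one,
            sub_self]) c
      rw [RingHom.mem_ker, map_sub, sub_eq_zero] at key
      exact key.trans (hmk (C c))
    let Φ := mk.comp ((powHom p Γ a : Lam p Γ →+* Lam p Γ).comp (E.toRingEquiv.toRingHom))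
    have hΦ : Φ (q : (Lam p (Multiplicative (Fin d → ℤ_[p])))⟦X⟧) = 0 := hE1
    have hΦX : Φ X = s ^ a - 1 := by
      show mk (powHom p Γ a (E X)) = _
      rw [h0, param, map_sub, map_one, powHom_of, map_sub, map_one, map_pow, map_pow]
    rw [coe_eq_eval₂, Polynomial.hom_eval₂, hΦX,
      show Φ.comp C = ρ from RingHom.ext hcoef] at hΦ
    rwa [Polynomial.eval_map]
  -- These are deg q + 1 roots of a monic polynomial over a domain, so two of them coincide. Their
  -- exponents differ by p^{n+1} times a number between 1 and deg q, a divisor of (deg q)!.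
  have hninj : ¬ Function.Injective
      (fun j : Fin (q.natDegree + 1) => s ^ (1 + (j : ℕ) * p ^ (n + 1)) - 1) := by
    intro hinj
    have := Polynomial.eq_zero_of_natDegree_lt_card_of_eval_eq_zero (q.map ρ) hinj
      (fun j => hroot j) (by
        rw [Fintype.card_fin]
        exact Nat.lt_succ_of_le Polynomial.natDegree_map_le)
    exact (hq.map ρ).ne_zero this
  have hpow : ∀ i j : ℕ, i < j → j ≤ q.natDegree →
      s ^ (1 + i * p ^ (n + 1)) = s ^ (1 + j * p ^ (n + 1)) →
      s ^ (p ^ (n + 1) * q.natDegree.factorial) = 1 := by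
    intro i j hij hj h
    have h1 : s ^ (p ^ (n + 1) * (j - i)) = 1 := by
      have e : 1 + j * p ^ (n + 1) = (1 + i * p ^ (n + 1)) + p ^ (n + 1) * (j - i) := by
        obtain ⟨k, rfl⟩ := Nat.exists_eq_add_of_le hij.le
        rw [Nat.add_sub_cancel_left]; ring
      rw [e, pow_add _ (1 + i * _)] at h
      exact (hsu.pow _).mul_left_cancel (by rw [← h, mul_one])
    obtain ⟨k, hk⟩ := Nat.dvd_factorial (Nat.sub_pos_of_lt hij) ((Nat.sub_le j i).trans hj)
    rw [hk, ← mul_assoc, pow_mul, h1, one_pow]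
  have hfin : s ^ (p ^ (n + 1) * q.natDegree.factorial) = 1 := by
    simp only [Function.Injective, not_forall] at hninj
    obtain ⟨i, j, hij, hne⟩ := hninj
    have hij' := sub_left_injective hij
    rcases lt_or_gt_of_ne (fun h => hne (Fin.ext h) : (i : ℕ) ≠ j) with h | h
    · exact hpow i j h (Nat.lt_succ_iff.1 j.2) hij'
    · exact hpow j i h (Nat.lt_succ_iff.1 i.2) hij'.symm
  rw [← Ideal.Quotient.eq_zero_iff_mem, map_sub, map_one, map_pow, map_pow, ← hs1, ← pow_mul,
    ← mul_assoc, ← pow_succ, hfin, sub_self]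

theorem charZero_stdLam (d : ℕ) : CharZero (Lam p (Multiplicative (Fin d → ℤ_[p]))) := by
  have hx := stdParam_isIwasawaRing (p := p) d
  refine charZero_of_inj_zero fun N hN => ?_
  by_contra h
  have h1 := hx.nzdMod_natCast 0 h 1 (by rw [hN, zero_mul]; exact Ideal.zero_mem _)
  have h2 := Ideal.pow_le_self (by simp) (omegaIdeal_le _ _ h1)
  exact hx.maximal.ne_top ((Ideal.eq_top_iff_one _).2 h2)

theorem omegaIdeal_eq_map {σ : Fin (d + 1) → Γ}
    (E : PowerSeries (Lam p (Multiplicative (Fin d → ℤ_[p]))) ≃ₐ[ℤ_[p]] Lam p Γ)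
    (h0 : E X = param p σ 0) (hs : ∀ i, E (C (stdParam p d i)) = param p σ i.succ) (n : ℕ) :
    omegaIdeal p (param p σ) n =
      ((omegaIdeal p (stdParam p d) n).map C ⊔ Ideal.span {(1 + X) ^ p ^ n - 1}).map E := by
  rw [sup_comm, ← omegaIdeal_cons, map_omegaIdeal]
  congr 1
  funext i
  refine Fin.cases ?_ (fun i => ?_) i
  · exact h0.symm
  · exact (hs i).symm

/-- For a prime of `Λ_Γ` whose zero locus is stable under all `g ↦ g ^ a`, a fixed multiple kills
the `p`-power torsion of all `Λ_Γ / (π, I_n)`. -/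
theorem IsZpBasis.exists_torsion_bound {d : ℕ} {σ : Fin d → Γ} (hσ : IsZpBasis p σ)
    {π : Lam p Γ} (hπ : Prime π) (hp : ¬ (p : Lam p Γ) ∣ π)
    (hstable : ∀ a : ℕ, a.Coprime p → π ∣ powHom p Γ a π) :
    ∃ s, ¬ π ∣ s ∧ ∀ (n N : ℕ), N ≠ 0 → ∀ v,
      (N : Lam p Γ) * v ∈ Ideal.span {π} ⊔ omegaIdeal p (param p σ) n →
      s * v ∈ Ideal.span {π} ⊔ omegaIdeal p (param p σ) n := by
  have hdom := hσ.hasPrimeParams.isDomain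
  have hπp : (Ideal.span {π}).IsPrime := (Ideal.span_singleton_prime hπ.ne_zero).2 hπ
  obtain _ | d := d
  -- For d = 0 the maximal ideal is (p), so a prime element would be divisible by p.
  · exfalso
    apply hp
    have := hσ.isLocalRing
    have h1 : π ∈ maximalIdeal (Lam p Γ) := hπ.not_isUnit
    rw [hσ.isIwasawaRing.maximalIdeal_eq, parameterIdeal, Set.range_eq_empty, insert_empty_eq,
      Ideal.mem_span_singleton] at h1
    exact h1
  have hx := stdParam_isIwasawaRing (p := p) d
  have hloc := hx.isLocalRing
  have hcomplete := hx.isAdicComplete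
  have hdom' := (hasPrimeParams_stdParam (p := p) d).isDomain
  have hchar := charZero_stdLam (p := p) d
  obtain ⟨σ', hσ', E, q, h0, hs, hd, -, hqE, hqπ⟩ := hσ.exists_prime_polynomial
    (uniqueFactorizationMonoid_std d) (Ideal.span {π}) π (Ideal.mem_span_singleton_self π) hp
  have hass : Associated π (E q) :=
    (hπ.dvd_prime_iff_associated hqE).1 (Ideal.mem_span_singleton.1 hqπ)
  have hq : Prime (q : PowerSeries (Lam p (Multiplicative (Fin d → ℤ_[p])))) :=
    (MulEquiv.prime_iff E.toMulEquiv).1 hqE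
  have hstable' : ∀ a : ℕ, a.Coprime p → E q ∣ powHom p Γ a (E q) := fun a ha =>
    hass.symm.dvd.trans ((hstable a ha).trans (map_dvd _ hass.dvd))
  obtain ⟨δ, hδ, hδ'⟩ := exists_ne_zero_C_mul_mem hd hq
  set M := p * q.natDegree.factorial with hM
  have hM0 : (M : Lam p (Multiplicative (Fin d → ℤ_[p]))) ≠ 0 := Nat.cast_ne_zero.2
    (mul_ne_zero (Fact.out : p.Prime).ne_zero (Nat.factorial_ne_zero _))
  have hI : ∀ n, Ideal.span {π} ⊔ omegaIdeal p (param p σ) n =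
      ((omegaIdeal p (stdParam p d) n).map C ⊔ Ideal.span {(q : PowerSeries _)} ⊔
        Ideal.span {(1 + X) ^ p ^ n - 1}).map E := by
    intro n
    rw [hσ.omegaIdeal_eq hσ', omegaIdeal_eq_map E h0 hs, Ideal.span_singleton_eq_span_singleton.2 hass,
      ← Set.image_singleton, ← Ideal.map_span, ← Ideal.map_sup, sup_comm, sup_right_comm]
  -- The multiplier is a nonzero element of the coefficient ring, which injects into the quotient by
  -- q; it is therefore not divisible by π.
  refine ⟨E (C δ * M), fun h => ?_, fun n N hN v hv => ?_⟩
  · have h1 := hass.symm.dvd.trans h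
    rw [map_dvd_iff E] at h1
    rw [← map_natCast C, ← map_mul] at h1
    exact mul_ne_zero hδ hM0 (eq_zero_of_dvd_C hd hq h1)
  · rw [hI] at hv ⊢
    obtain ⟨v, rfl⟩ := E.surjective v
    rw [← map_natCast E, ← map_mul] at hv
    obtain ⟨w, hw, e⟩ := (Ideal.mem_map_iff_of_surjective _ E.surjective).1 hv
    rw [E.injective.eq_iff] at e
    rw [← map_mul]
    refine Ideal.mem_map_of_mem E (sup_span_geom_mem (N := N) ?_ ?_ (e ▸ hw))
    · have := nzdMod_map_C_sup_span hd (hx.nzdMod_natCast n hN)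
      rwa [map_natCast] at this
    · exact hδ' _ (hx.isRadical_omegaIdeal n) _
        (hσ'.omega_mem_radical E h0 hs q hd.monic hstable' n)

/-- Every prime of `Λ_Γ` is, up to a multiple outside of it, regular modulo all `I_m`, or has bounded
torsion modulo all `I_n`. -/
theorem IsZpBasis.regular_or_torsion_bound {d : ℕ} {σ : Fin d → Γ} (hσ : IsZpBasis p σ)
    {π : Lam p Γ} (hπ : Prime π) :
    (∃ s, ¬ π ∣ s ∧ ∀ m x, π * x ∈ omegaIdeal p (param p σ) m →
      s * x ∈ omegaIdeal p (param p σ) m) ∨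
    ∃ s, ¬ π ∣ s ∧ ∀ (n N : ℕ), N ≠ 0 → ∀ v,
      (N : Lam p Γ) * v ∈ Ideal.span {π} ⊔ omegaIdeal p (param p σ) n →
      s * v ∈ Ideal.span {π} ⊔ omegaIdeal p (param p σ) n := by
  have hdom := hσ.hasPrimeParams.isDomain
  by_cases hp : (p : Lam p Γ) ∣ π
  · obtain ⟨u, hu⟩ := (hσ.prime_p.dvd_prime_iff_associated hπ).1 hp
    refine Or.inl ⟨1, fun h => hπ.not_isUnit (isUnit_of_dvd_one h), fun m x hx => ?_⟩
    rw [one_mul]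
    refine hσ.isIwasawaRing.nzdMod_natCast m (Fact.out : p.Prime).ne_zero x ?_
    have : (p : Lam p Γ) * x = ↑u⁻¹ * (π * x) := by
      rw [← hu, ← mul_assoc, mul_comm (p : Lam p Γ) u, ← mul_assoc, Units.inv_mul, one_mul]
    rw [this]
    exact Ideal.mul_mem_left _ _ hx
  -- If π does not divide its image under some power map, that image is the required multiplier;
  -- otherwise the torsion bound applies.
  · by_cases hst : ∀ a : ℕ, a.Coprime p → π ∣ powHom p Γ a π
    · exact Or.inr (hσ.exists_torsion_bound hπ hp hst)
    · push Not at hst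
      obtain ⟨a, ha, hndvd⟩ := hst
      exact Or.inl ⟨_, hndvd, fun m x hx => hσ.powHom_mul_mem ha m π x hx⟩

end Roots

end
end IwasawaTower

/-! ### Tight generating sets -/

namespace IwasawaTower

noncomputable section

open IsLocalRing IsIwasawaRing

variable {p : ℕ} [Fact p.Prime] {Γ : Type*} [CommGroup Γ] [TopologicalSpace Γ] {d : ℕ}

/-! ### Elements that are not p-th powers and their procyclic groups -/

section Primitive

open Multiplicative

theorem exists_isUnit_of_notMem_pow (e : Multiplicative (Fin d → ℤ_[p]) ≃ₜ* Γ) {g : Γ}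
    (hg : g ∉ (powMonoidHom p : Γ →* Γ).range) : ∃ i, IsUnit (toAdd (e.symm g) i) := by
  by_contra hcon
  push Not at hcon
  apply hg
  have h1 : g ∈ level e 1 := by
    rw [mem_level]
    intro i
    have : toAdd (e.symm g) i ∈ maximalIdeal ℤ_[p] := hcon i
    rwa [PadicInt.maximalIdeal_eq_span_p, Ideal.mem_span_singleton, ← pow_one (p : ℤ_[p])] at this
  obtain ⟨h, rfl⟩ := (mem_level_iff_exists_pow e 1 g).1 h1
  exact ⟨h, by simp⟩

/-- An element that is not a `p`-th power is a member of a basis. -/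
theorem exists_isZpBasis_of_notMem_pow (e : Multiplicative (Fin d → ℤ_[p]) ≃ₜ* Γ) {g : Γ}
    (hg : g ∉ (powMonoidHom p : Γ →* Γ).range) :
    ∃ (σ : Fin d → Γ) (i : Fin d), IsZpBasis p σ ∧ σ i = g := by
  obtain ⟨i, hi⟩ := exists_isUnit_of_notMem_pow e hg
  refine ⟨_, i, isZpBasis_update e i _ hi, ?_⟩
  rw [Function.update_self, ofAdd_toAdd, e.apply_symm_apply]

/-- The map `z ↦ g ^ z` from `ℤ_p` to `Γ`. -/
def padicPow (e : Multiplicative (Fin d → ℤ_[p]) ≃ₜ* Γ) (g : Γ) (z : ℤ_[p]) : Γ :=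
  e (ofAdd (z • toAdd (e.symm g)))

theorem continuous_padicPow (e : Multiplicative (Fin d → ℤ_[p]) ≃ₜ* Γ) (g : Γ) :
    Continuous (padicPow e g) :=
  e.continuous.comp (continuous_ofAdd.comp (continuous_id.smul continuous_const))

theorem padicPow_intCast (e : Multiplicative (Fin d → ℤ_[p]) ≃ₜ* Γ) (g : Γ) (n : ℤ) :
    padicPow e g n = g ^ n := by
  rw [padicPow, Int.cast_smul_eq_zsmul, ofAdd_zsmul, ofAdd_toAdd, map_zpow, e.apply_symm_apply]

theorem padicPow_mem_closure (e : Multiplicative (Fin d → ℤ_[p]) ≃ₜ* Γ) (g : Γ) (z : ℤ_[p]) :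
    padicPow e g z ∈ closure (Subgroup.zpowers g : Set Γ) := by
  have hz : z ∈ closure (Set.range (Int.cast : ℤ → ℤ_[p])) := PadicInt.denseRange_intCast z
  refine map_mem_closure (continuous_padicPow e g) hz ?_
  rintro _ ⟨n, rfl⟩
  rw [padicPow_intCast]
  exact ⟨n, rfl⟩

theorem closure_zpowers_eq_range (e : Multiplicative (Fin d → ℤ_[p]) ≃ₜ* Γ) (g : Γ) :
    closure (Subgroup.zpowers g : Set Γ) = Set.range (padicPow e g) := by
  have hT2 : T2Space Γ := e.toHomeomorph.t2Space
  refine subset_antisymm (closure_minimal ?_ ?_) ?_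
  · rintro _ ⟨n, rfl⟩
    exact ⟨n, padicPow_intCast e g n⟩
  · exact (isCompact_range (continuous_padicPow e g)).isClosed
  · rintro _ ⟨z, rfl⟩
    exact padicPow_mem_closure e g z

theorem padicPow_padicPow (e : Multiplicative (Fin d → ℤ_[p]) ≃ₜ* Γ) (g : Γ) (z w : ℤ_[p]) :
    padicPow e (padicPow e g z) w = padicPow e g (w * z) := by
  rw [padicPow, padicPow, e.symm_apply_apply, toAdd_ofAdd, smul_smul, padicPow]

/-- g is h^z with z ∈ ℤ_p, and z is a unit because g is not a p-th power. -/
theorem closure_zpowers_eq_of_mem (e : Multiplicative (Fin d → ℤ_[p]) ≃ₜ* Γ) {g h : Γ}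
    (hg : g ∉ (powMonoidHom p : Γ →* Γ).range)
    (hgh : g ∈ closure (Subgroup.zpowers h : Set Γ)) :
    closure (Subgroup.zpowers g : Set Γ) = closure (Subgroup.zpowers h : Set Γ) := by
  rw [closure_zpowers_eq_range e] at hgh
  obtain ⟨z, rfl⟩ := hgh
  have hz : IsUnit z := by
    by_contra hz
    have : z ∈ maximalIdeal ℤ_[p] := hz
    rw [PadicInt.maximalIdeal_eq_span_p, Ideal.mem_span_singleton] at this
    obtain ⟨w, rfl⟩ := this
    refine hg ⟨padicPow e h w, ?_⟩
    rw [powMonoidHom_apply, ← zpow_natCast, ← padicPow_intCast e, padicPow_padicPow]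
    simp
  rw [closure_zpowers_eq_range e, closure_zpowers_eq_range e]
  obtain ⟨u, rfl⟩ := hz
  ext k
  constructor
  · rintro ⟨w, rfl⟩
    exact ⟨_, (padicPow_padicPow e h _ w).symm⟩
  · rintro ⟨w, rfl⟩
    refine ⟨w * ↑u⁻¹, ?_⟩
    rw [padicPow_padicPow, mul_assoc, Units.inv_mul, mul_one]

end Primitive

section Closure

variable [IsTopologicalGroup Γ]

theorem mem_closure_subgroup_iff (e : Multiplicative (Fin d → ℤ_[p]) ≃ₜ* Γ) (H : Subgroup Γ)
    (g : Γ) : g ∈ closure (H : Set Γ) ↔ ∀ n, ∃ h, g * h ^ p ^ n ∈ H := by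
  constructor
  · intro hg n
    have hopen : IsOpen ((fun x => g⁻¹ * x) ⁻¹' (level e n : Set Γ)) :=
      (level e n).isOpen.preimage (continuous_const_mul g⁻¹)
    obtain ⟨x, hx, hxH⟩ := mem_closure_iff.1 hg _ hopen (by
      show g⁻¹ * g ∈ level e n
      rw [inv_mul_cancel]; exact (level e n).one_mem)
    obtain ⟨h, hh⟩ := (mem_level_iff_exists_pow e n _).1 hx
    exact ⟨h, by rw [hh, mul_inv_cancel_left]; exact hxH⟩
  · intro h
    rw [mem_closure_iff]
    intro O hO hgO
    obtain ⟨n, hn⟩ := exists_level_subset e (hO.preimage (continuous_const_mul g))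
      (show g * 1 ∈ O by rwa [mul_one])
    obtain ⟨x, hx⟩ := h n
    exact ⟨_, hn (pow_mem_level e n x), hx⟩

end Closure

/-! ### The ideals J_n and norm compatibility -/

section Tight

variable {σ : Fin d → Γ} {c : ℕ} {τ : Fin c → Γ}

theorem IsZpBasis.omega_mem_maximalIdeal (hσ : IsZpBasis p σ) [IsLocalRing (Lam p Γ)] (g : Γ)
    (n : ℕ) : omega p g n ∈ maximalIdeal (Lam p Γ) := hσ.of_sub_one_mem _

/-- ν_{g,0,n} is a product of n factors ν_{g,k,k+1}, each congruent to p modulo ω_{g,k} and so in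
the maximal ideal. -/
theorem IsZpBasis.nu_mem_pow (hσ : IsZpBasis p σ) [IsLocalRing (Lam p Γ)] (g : Γ) (n : ℕ) :
    nu p g 0 n ∈ maximalIdeal (Lam p Γ) ^ n := by
  induction n with
  | zero => simp
  | succ n ih =>
    rw [← nu_mul_nu p g (Nat.zero_le n) (Nat.le_succ n), pow_succ]
    refine Ideal.mul_mem_mul ih ?_
    have h1 := nu_sub_natCast_mem (p := p) g n (n + 1)
    rw [Nat.add_sub_cancel_left, pow_one] at h1
    have h2 := (Ideal.span_singleton_le_iff_mem _).2 (hσ.omega_mem_maximalIdeal g n) h1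
    rw [← sub_add_cancel (nu p g n (n + 1)) (p : Lam p Γ)]
    refine Ideal.add_mem _ h2 ?_
    rw [hσ.isIwasawaRing.maximalIdeal_eq]
    exact p_mem p _

theorem IsZpBasis.J_le_pow (hσ : IsZpBasis p σ) [IsLocalRing (Lam p Γ)] (n : ℕ) :
    J p τ n ≤ maximalIdeal (Lam p Γ) ^ n := by
  rw [J, Ideal.span_le]
  rintro _ ⟨i, rfl⟩
  exact hσ.nu_mem_pow _ n

theorem IsZpBasis.omegaIdeal_le_pow (hσ : IsZpBasis p σ) [IsLocalRing (Lam p Γ)] (n : ℕ) :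
    omegaIdeal p (param p σ) n ≤ maximalIdeal (Lam p Γ) ^ n := by
  rw [hσ.isIwasawaRing.maximalIdeal_eq]
  exact (omegaIdeal_le _ n).trans (Ideal.pow_le_pow_right (Nat.le_succ n))

/-- The elements `g` with `g ^ (p ^ m) - 1` in a given ideal. -/
def powSubgroup (𝔞 : Ideal (Lam p Γ)) (m : ℕ) : Subgroup Γ where
  carrier := {g | omega p g m ∈ 𝔞}
  one_mem' := by simp [omega]
  mul_mem' {a b} ha hb := by
    have : omega p (a * b) m = of p (a ^ p ^ m) * omega p b m + omega p a m := by
      simp only [omega, mul_pow, map_mul]; ring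
    rw [Set.mem_ofPred_eq, this]
    exact Ideal.add_mem _ (Ideal.mul_mem_left _ _ hb) ha
  inv_mem' {a} ha := by
    have h1 : of p (a⁻¹ ^ p ^ m) * of p (a ^ p ^ m) = 1 := by
      rw [← map_mul, ← mul_pow, inv_mul_cancel, one_pow, map_one]
    have : omega p a⁻¹ m = -of p (a⁻¹ ^ p ^ m) * omega p a m := by
      simp only [omega]; linear_combination h1
    rw [Set.mem_ofPred_eq, this]
    exact Ideal.mul_mem_left _ _ ha

theorem mem_powSubgroup {𝔞 : Ideal (Lam p Γ)} {m : ℕ} {g : Γ} :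
    g ∈ powSubgroup 𝔞 m ↔ omega p g m ∈ 𝔞 := Iff.rfl

/-- The g with ω_{g,m} ∈ J_m form a subgroup containing all τ_j. Since J_m is closed, the condition
passes to the closure of the subgroup they generate, which is Γ. -/
theorem IsTight.omegaIdeal_le_J [IsTopologicalGroup Γ] (hσ : IsZpBasis p σ) (hτ : IsTight p τ)
    (m : ℕ) : omegaIdeal p (param p σ) m ≤ J p τ m := by
  have hloc := hσ.isLocalRing
  have hnoeth := hσ.isIwasawaRing.noeth
  obtain ⟨e, -⟩ := id hσ
  rw [omegaIdeal_param, Ideal.span_le]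
  rintro _ ⟨i, rfl⟩
  have hle : Subgroup.closure (Set.range τ) ≤ powSubgroup (J p τ m) m := by
    rw [Subgroup.closure_le]
    rintro _ ⟨j, rfl⟩
    rw [SetLike.mem_coe, mem_powSubgroup, ← nu_mul_omega p (τ j) (Nat.zero_le m)]
    exact Ideal.mul_mem_right _ _ (Ideal.subset_span ⟨j, rfl⟩)
  have hmem : σ i ∈ closure (Subgroup.closure (Set.range τ) : Set Γ) := hτ.generates ▸ trivial
  rw [mem_closure_subgroup_iff e] at hmem
  refine mem_of_forall_mem_sup_pow _ _ fun k => ?_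
  obtain ⟨h, hh⟩ := hmem k
  have h1 : omega p (σ i * h ^ p ^ k) m ∈ J p τ m := hle hh
  have h2 : omega p (σ i) m = omega p (σ i * h ^ p ^ k) m +
      -of p (σ i ^ p ^ m) * omega p (h ^ p ^ m) k := by
    simp only [omega, mul_pow, map_mul]
    rw [← pow_mul, ← pow_mul, mul_comm (p ^ k)]
    ring
  simp only [h2]
  exact Submodule.add_mem_sup h1 (Ideal.mul_mem_left _ _
    (hσ.omegaIdeal_le_pow k (hσ.omega_mem _ _)))

/-- In a basis containing τ_i, the factor ν_{τ_i,n,m} of the norm element combines with ν_{τ_i,0,n}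
to ν_{τ_i,0,m}. The given norm element is a multiple of this one modulo I_m ⊆ J_m. -/
theorem IsTight.normCompatible [IsTopologicalGroup Γ] (hσ : IsZpBasis p σ) (hτ : IsTight p τ) :
    NormCompatible p σ τ := by
  intro n m h x hx
  refine Submodule.span_induction ?_ ?_ ?_ ?_ hx (p := fun x _ => normElt p σ n m * x ∈ J p τ m)
  · rintro _ ⟨i, rfl⟩
    obtain ⟨e, -⟩ := id hσ
    obtain ⟨σ', j, hσ', hj⟩ := exists_isZpBasis_of_notMem_pow e (hτ.not_mem i)
    obtain ⟨y, hy⟩ := hσ.exists_normElt_sub_mem hσ' h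
    have h1 := Ideal.mul_mem_right (nu p (τ i) 0 n) _ (hτ.omegaIdeal_le_J hσ' m hy)
    have h2 : normElt p σ' n m * nu p (τ i) 0 n ∈ J p τ m := by
      rw [normElt, ← Finset.mul_prod_erase _ _ (Finset.mem_univ j), hj, mul_right_comm,
        mul_comm (nu p (τ i) n m), nu_mul_nu p (τ i) (Nat.zero_le n) h]
      exact Ideal.mul_mem_right _ _ (Ideal.subset_span ⟨i, rfl⟩)
    have h3 : normElt p σ n m * nu p (τ i) 0 n =
        (normElt p σ n m - normElt p σ' n m * y) * nu p (τ i) 0 n +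
          y * (normElt p σ' n m * nu p (τ i) 0 n) := by ring
    simp only [h3]
    exact Ideal.add_mem _ h1 (Ideal.mul_mem_left _ _ h2)
  · rw [mul_zero]; exact Ideal.zero_mem _
  · intro a b _ _ ha hb
    rw [mul_add]; exact Ideal.add_mem _ ha hb
  · intro r a _ ha
    rw [smul_eq_mul, mul_left_comm]; exact Ideal.mul_mem_left _ _ ha

end Tight

end
end IwasawaTower

/-! ### Divisibility by prime powers -/

namespace IwasawaTower

noncomputable section

open IsLocalRing IsIwasawaRing

variable {p : ℕ} [Fact p.Prime] {Γ : Type*} [CommGroup Γ] [TopologicalSpace Γ] {d : ℕ}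
  {σ : Fin d → Γ} {π : Lam p Γ}

theorem IsZpBasis.dvd_of_forall_mem_sup (hσ : IsZpBasis p σ) {t x : Lam p Γ}
    (h : ∀ n, x ∈ omegaIdeal p (param p σ) n ⊔ Ideal.span {t}) : t ∣ x := by
  have hloc := hσ.isLocalRing
  have hnoeth := hσ.isIwasawaRing.noeth
  rw [← Ideal.mem_span_singleton]
  refine mem_of_forall_mem_sup_pow _ _ fun n => ?_
  rw [sup_comm]
  exact sup_le_sup_right (hσ.omegaIdeal_le_pow n) _ (h n)

theorem pow_mul_mem_of_mul_mem {R : Type*} [CommRing R] {I : Ideal R} {a s : R}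
    (h : ∀ x, a * x ∈ I → s * x ∈ I) (k : ℕ) (x : R) (hx : a ^ k * x ∈ I) : s ^ k * x ∈ I := by
  induction k generalizing x with
  | zero => simpa using hx
  | succ k ih =>
    rw [pow_succ, mul_assoc]
    refine ih _ ?_
    rw [mul_left_comm]
    refine h _ ?_
    rwa [← mul_assoc, ← pow_succ']

/-- Write ν f = i + π^k t with i ∈ I_m. Each ω_{σ_l,n} kills ν modulo I_m, hence also s^k t, which
is therefore a multiple ν y. Cancelling ν gives s^k f ≡ π^k y modulo I_n, for every n. -/
theorem IsZpBasis.pow_dvd_of_regular (hσ : IsZpBasis p σ) (hπ : Prime π) {s : Lam p Γ}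
    (hs : ¬ π ∣ s) (hreg : ∀ m x, π * x ∈ omegaIdeal p (param p σ) m →
      s * x ∈ omegaIdeal p (param p σ) m) (k : ℕ) (f : Lam p Γ)
    (hf : ∀ n, ∃ m, n ≤ m ∧ normElt p σ n m * f ∈ omegaIdeal p (param p σ) m ⊔ Ideal.span {π ^ k}) :
    π ^ k ∣ f := by
  have hdom := hσ.hasPrimeParams.isDomain
  have hs' : ¬ π ∣ s ^ k := fun h => hs (hπ.dvd_of_dvd_pow h)
  refine hπ.pow_dvd_of_dvd_mul_left k hs' (hσ.dvd_of_forall_mem_sup fun n => ?_)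
  obtain ⟨m, hnm, h⟩ := hf n
  obtain ⟨i, hi, b, hb, e⟩ := Submodule.mem_sup.1 h
  obtain ⟨t, rfl⟩ := Ideal.mem_span_singleton.1 hb
  obtain ⟨y, hy⟩ := hσ.exists_sub_normElt_mul_mem hnm (x := s ^ k * t) fun l => by
    rw [mul_left_comm]
    refine pow_mul_mem_of_mul_mem (hreg m) k _ ?_
    have : π ^ k * (omega p (σ l) n * t) = (omega p (σ l) n * normElt p σ n m) * f -
        omega p (σ l) n * i := by linear_combination omega p (σ l) n * e
    rw [this]
    exact Ideal.sub_mem _ (Ideal.mul_mem_right _ _ (omega_mul_normElt_mem hnm l))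
      (Ideal.mul_mem_left _ _ hi)
  have h1 := hσ.mem_of_normElt_mul_mem hnm (x := s ^ k * f - π ^ k * y) (by
    have : normElt p σ n m * (s ^ k * f - π ^ k * y) =
      s ^ k * i + π ^ k * (s ^ k * t - normElt p σ n m * y) := by linear_combination (-s ^ k) * e
    rw [this]
    exact Ideal.add_mem _ (Ideal.mul_mem_left _ _ hi) (Ideal.mul_mem_left _ _ hy))
  rw [← sub_add_cancel (s ^ k * f) (π ^ k * y)]
  exact Submodule.add_mem_sup h1 (Ideal.mul_mem_right _ _ (Ideal.mem_span_singleton_self _))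

theorem IsZpBasis.pow_dvd_of_torsion_bound (hσ : IsZpBasis p σ) (hπ : Prime π) {s : Lam p Γ}
    (hs : ¬ π ∣ s) (htor : ∀ (n N : ℕ), N ≠ 0 → ∀ v,
      (N : Lam p Γ) * v ∈ Ideal.span {π} ⊔ omegaIdeal p (param p σ) n →
      s * v ∈ Ideal.span {π} ⊔ omegaIdeal p (param p σ) n) (k : ℕ) (f : Lam p Γ)
    (hf : ∀ n, ∃ m, n ≤ m ∧ normElt p σ n m * f ∈ omegaIdeal p (param p σ) m ⊔ Ideal.span {π ^ k}) :
    π ^ k ∣ f := by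
  have hdom := hσ.hasPrimeParams.isDomain
  have hrad := fun m => hσ.isIwasawaRing.isRadical_omegaIdeal m
  have key : ∀ j ≤ k, π ^ j ∣ f := by
    intro j
    induction j with
    | zero => simp
    | succ j ih =>
      intro hj
      obtain ⟨g, rfl⟩ := ih (Nat.le_of_succ_le hj)
      obtain ⟨r, rfl⟩ := Nat.exists_eq_add_of_le hj
      rw [pow_succ]
      refine mul_dvd_mul_left _ ?_
      -- Here f = π^j g, and π ∣ g is to be shown. The extra factor π comes from the use of
      -- radicality and is cancelled at the end.
      have hgoal : π ^ 2 ∣ s * π * g := hσ.dvd_of_forall_mem_sup fun n => by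
        obtain ⟨m, hnm, h⟩ := hf n
        obtain ⟨i, hi, b, hb, e⟩ := Submodule.mem_sup.1 h
        obtain ⟨t, rfl⟩ := Ideal.mem_span_singleton.1 hb
        set N := normElt p σ n m with hN
        set t' := π ^ r * t with ht'
        -- Some power of π times N g - π t' lies in I_m; since I_m is radical, one factor π is
        -- enough.
        have h1 : π * (N * g - π * t') ∈ omegaIdeal p (param p σ) m := by
          refine hrad m ⟨j + 1 + r, ?_⟩
          have : (π * (N * g - π * t')) ^ (j + 1 + r) =
              π ^ r * i * (π * (N * g - π * t') ^ (j + r)) := by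
            have e' : π ^ r * i = π ^ (j + r) * (N * g - π * t') := by
              rw [ht']; simp only [pow_add, pow_one] at e ⊢; linear_combination π ^ r * e
            rw [e', mul_pow]
            ring
          rw [this]
          exact Ideal.mul_mem_right _ _ (Ideal.mul_mem_left _ _ hi)
        -- ω_{σ_l,n} π t' vanishes modulo I_m because its square does, so π t' is a norm multiple N
        -- v.
        obtain ⟨v, hv⟩ := hσ.exists_sub_normElt_mul_mem hnm (x := π * t') fun l => by
          refine hrad m ⟨2, ?_⟩
          have : (omega p (σ l) n * (π * t')) ^ 2 = omega p (σ l) n * t' *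
              (π * g * (omega p (σ l) n * N) - omega p (σ l) n * (π * (N * g - π * t'))) := by ring
          rw [this]
          exact Ideal.mul_mem_left _ _ (Ideal.sub_mem _
            (Ideal.mul_mem_left _ _ (omega_mul_normElt_mem hnm l)) (Ideal.mul_mem_left _ _ h1))
        -- N is a power of p modulo I_n, so v is p-power torsion modulo (π, I_n), and s v lies in
        -- that ideal.
        have hv2 := htor n ((p ^ (m - n)) ^ d)
          (pow_ne_zero _ (pow_ne_zero _ (Fact.out : p.Prime).ne_zero)) v (by
            have : (((p ^ (m - n)) ^ d : ℕ) : Lam p Γ) * v = π * t' +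
              (-(π * t' - N * v) - (N - ((p ^ (m - n)) ^ d : ℕ)) * v) := by ring
            rw [this]
            refine Submodule.add_mem_sup (Ideal.mul_mem_right _ _ (Ideal.mem_span_singleton_self _))
              (Ideal.sub_mem _ (neg_mem (omegaIdeal_anti _ hnm hv))
                (Ideal.mul_mem_right _ _ (normElt_sub_natCast_mem n m))))
        obtain ⟨a, ha, i', hi', e2⟩ := Submodule.mem_sup.1 hv2
        obtain ⟨v', rfl⟩ := Ideal.mem_span_singleton.1 ha
        have h2 := hσ.mem_of_normElt_mul_mem hnm (x := s * π * g - π ^ 2 * v') (by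
          have : normElt p σ n m * (s * π * g - π ^ 2 * v') = s * (π * (N * g - π * t')) +
              s * π * (π * t' - N * v) + π * (N * i') := by
            rw [← hN]; linear_combination (-N * π) * e2
          rw [this]
          exact Ideal.add_mem _ (Ideal.add_mem _ (Ideal.mul_mem_left _ _ h1)
            (Ideal.mul_mem_left _ _ hv)) (Ideal.mul_mem_left _ _ (normElt_mul_mem hnm hi')))
        rw [← sub_add_cancel (s * π * g) (π ^ 2 * v')]
        exact Submodule.add_mem_sup h2
          (Ideal.mul_mem_right _ _ (Ideal.mem_span_singleton_self _))
      rw [pow_two, mul_assoc, mul_left_comm, mul_dvd_mul_iff_left hπ.ne_zero] at hgoal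
      exact (hπ.dvd_or_dvd hgoal).resolve_left hs
  exact key k le_rfl

/-! ### Divisibility modulo J_m: the primes not dividing, and dividing, some τ_i - 1 -/

section Tight

variable {c : ℕ} {τ : Fin c → Γ}

theorem IsZpBasis.prod_mul_mem_omegaIdeal (hσ : IsZpBasis p σ) (m : ℕ) {x : Lam p Γ}
    (hx : x ∈ J p τ m) : (∏ i, (of p (τ i) - 1)) * x ∈ omegaIdeal p (param p σ) m := by
  refine Submodule.span_induction ?_ ?_ ?_ ?_ hx
    (p := fun x _ => (∏ i, (of p (τ i) - 1)) * x ∈ omegaIdeal p (param p σ) m)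
  · rintro _ ⟨i, rfl⟩
    have h := hσ.omega_mem (τ i) m
    rw [← nu_mul_omega p _ (Nat.zero_le m), omega, pow_zero, pow_one] at h
    rw [← Finset.mul_prod_erase _ _ (Finset.mem_univ i), mul_right_comm,
      mul_comm _ (nu p (τ i) 0 m)]
    exact Ideal.mul_mem_right _ _ h
  · rw [mul_zero]; exact Ideal.zero_mem _
  · intro a b _ _ ha hb
    rw [mul_add]; exact Ideal.add_mem _ ha hb
  · intro r a _ ha
    rw [smul_eq_mul, mul_left_comm]; exact Ideal.mul_mem_left _ _ ha

/-- The product w of all τ_i - 1 carries J_m into I_m and is prime to π, so f can be replaced by w f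
and J_m by I_m. -/
theorem IsZpBasis.pow_dvd_of_forall_not_dvd (hσ : IsZpBasis p σ) (hπ : Prime π)
    (hτπ : ∀ i, ¬ π ∣ of p (τ i) - 1) (k : ℕ) (f : Lam p Γ)
    (hf : ∀ n, ∃ m, n ≤ m ∧ normElt p σ n m * f ∈ J p τ m ⊔ Ideal.span {π ^ k}) :
    π ^ k ∣ f := by
  have hdom := hσ.hasPrimeParams.isDomain
  set w := ∏ i, (of p (τ i) - 1) with hw
  have hπw : ¬ π ∣ w := fun h => by
    obtain ⟨i, -, hi⟩ := (Prime.dvd_finsetProd_iff hπ _).1 h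
    exact hτπ i hi
  have hf' : ∀ n, ∃ m, n ≤ m ∧ normElt p σ n m * (w * f) ∈
      omegaIdeal p (param p σ) m ⊔ Ideal.span {π ^ k} := by
    intro n
    obtain ⟨m, hnm, h⟩ := hf n
    refine ⟨m, hnm, ?_⟩
    obtain ⟨x, hx, b, hb, e⟩ := Submodule.mem_sup.1 h
    rw [mul_left_comm, ← e, mul_add]
    exact Submodule.add_mem_sup (hσ.prod_mul_mem_omegaIdeal m hx) (Ideal.mul_mem_left _ _ hb)
  refine hπ.pow_dvd_of_dvd_mul_left k hπw ?_
  rcases hσ.regular_or_torsion_bound hπ with ⟨s, hs, h⟩ | ⟨s, hs, h⟩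
  · exact hσ.pow_dvd_of_regular hπ hs h k _ hf'
  · exact hσ.pow_dvd_of_torsion_bound hπ hs h k _ hf'

theorem IsZpBasis.prime_param (hσ : IsZpBasis p σ) (j : Fin d) : Prime (param p σ j) := by
  have h := hσ.hasPrimeParams.prime ⊥ {j}
  rw [paramSpan, Ideal.map_bot, bot_sup_eq, Set.image_singleton] at h
  refine (Ideal.span_singleton_prime fun h0 => ?_).1 h
  refine hσ.hasPrimeParams.notMem ⊥ ∅ j (Set.notMem_empty j) ?_
  show param p σ j ∈ _
  rw [h0]; exact Ideal.zero_mem _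

variable [IsTopologicalGroup Γ]

/-- In the group ring of Γ/(Γ^{p^n}·⟨g⟩) the element g becomes 1, hence so does h. -/
theorem mem_closure_zpowers_of_dvd (e : Multiplicative (Fin d → ℤ_[p]) ≃ₜ* Γ) {g h : Γ}
    (hgh : of p g - 1 ∣ of p h - 1) : h ∈ closure (Subgroup.zpowers g : Set Γ) := by
  rw [mem_closure_subgroup_iff e]
  intro n
  let U : OpenSubgroup Γ := ⟨(level e n).toSubgroup ⊔ Subgroup.zpowers g,
    Subgroup.isOpen_mono le_sup_left (level e n).isOpen⟩
  have hg : (QuotientGroup.mk g : Γ ⧸ U.toSubgroup) = 1 := (QuotientGroup.eq_one_iff _).2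
    (Subgroup.mem_sup_right (Subgroup.mem_zpowers g))
  have h1 : projAt U (of p h - 1) = 0 := by
    obtain ⟨r, hr⟩ := hgh
    rw [hr, map_mul, map_sub, projAt_of, map_one, hg, MonoidAlgebra.one_def, sub_self, zero_mul]
  rw [map_sub, projAt_of, map_one, sub_eq_zero, MonoidAlgebra.one_def] at h1
  have h2 : (QuotientGroup.mk h : Γ ⧸ U.toSubgroup) = 1 :=
    MonoidAlgebra.of_injective (R := ℤ_[p]) h1
  have h3 : h ∈ (level e n).toSubgroup ⊔ Subgroup.zpowers g := (QuotientGroup.eq_one_iff _).1 h2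
  obtain ⟨a, ha, b, hb, rfl⟩ := Subgroup.mem_sup.1 h3
  obtain ⟨x, hx⟩ := (mem_level_iff_exists_pow e n a).1 ha
  refine ⟨x⁻¹, ?_⟩
  rwa [inv_pow, hx, mul_inv_cancel_comm]

theorem IsTight.pow_dvd_of_dvd (hσ : IsZpBasis p σ) (hτ : IsTight p τ) (hπ : Prime π) {i : Fin c}
    (hi : π ∣ of p (τ i) - 1) (k : ℕ) (f : Lam p Γ)
    (hf : ∀ n, ∃ m, n ≤ m ∧ normElt p σ n m * f ∈ J p τ m ⊔ Ideal.span {π ^ k}) :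
    π ^ k ∣ f := by
  have hdom := hσ.hasPrimeParams.isDomain
  have hloc := hσ.isLocalRing
  have hnoeth := hσ.isIwasawaRing.noeth
  obtain ⟨e, -⟩ := id hσ
  obtain ⟨σ', j, hσ', hj⟩ := exists_isZpBasis_of_notMem_pow e (hτ.not_mem i)
  set T := param p σ' j with hT
  have hTi : T = of p (τ i) - 1 := by rw [hT, param, hj]
  have hass : Associated (π ^ k) (T ^ k) :=
    ((hπ.dvd_prime_iff_associated (hσ'.prime_param j)).1 (by rwa [← hT, hTi])).pow_pow
  have hTp : Prime T := hσ'.prime_param j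
  refine hass.dvd.trans ?_
  rw [Ideal.span_singleton_eq_span_singleton.2 hass] at hf
  -- If T = τ_i - 1 divided some other τ_l - 1, then τ_l would lie in the closed subgroup generated
  -- by τ_i and, not being a p-th power, generate the same one, against tightness.
  set w := ∏ l ∈ Finset.univ.erase i, (of p (τ l) - 1) with hw
  have hTw : ¬ T ∣ w := fun h => by
    obtain ⟨l, hl, hl'⟩ := (Prime.dvd_finsetProd_iff hTp _).1 h
    rw [hTi] at hl'
    exact hτ.distinct l i (Finset.ne_of_mem_erase hl)
      (closure_zpowers_eq_of_mem e (hτ.not_mem l) (mem_closure_zpowers_of_dvd e hl'))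
  refine hTp.pow_dvd_of_dvd_mul_left k hTw ?_
  set u := Finset.univ.erase j with hu
  set Ω : ℕ → Ideal (Lam p Γ) := fun m => Ideal.span ((fun l => omega p (σ' l) m) '' (u : Set (Fin d)))
    with hΩ
  have hwJ : ∀ m, ∀ x ∈ J p τ m, w * x ∈ Ω m ⊔ Ideal.span {nu p (τ i) 0 m} := by
    intro m x hx
    refine Submodule.span_induction ?_ ?_ ?_ ?_ hx
      (p := fun x _ => w * x ∈ Ω m ⊔ Ideal.span {nu p (τ i) 0 m})
    · rintro _ ⟨l, rfl⟩
      by_cases hl : l = i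
      · subst hl
        exact Ideal.mul_mem_left _ _ (Ideal.mem_sup_right (Ideal.mem_span_singleton_self _))
      · have h1 : omegaIdeal p (param p σ') m ≤ Ω m ⊔ Ideal.span {nu p (τ i) 0 m} := by
          rw [omegaIdeal_param, Ideal.span_le]
          rintro _ ⟨a, rfl⟩
          by_cases ha : a = j
          · subst ha
            refine Ideal.mem_sup_right ?_
            simp only [hj]
            rw [← nu_mul_omega p _ (Nat.zero_le m)]
            exact Ideal.mul_mem_right _ _ (Ideal.mem_span_singleton_self _)
          · exact Ideal.mem_sup_left (Ideal.subset_span ⟨a, by simp [hu, ha], rfl⟩)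
        have h := hσ'.omega_mem (τ l) m
        rw [← nu_mul_omega p _ (Nat.zero_le m), omega, pow_zero, pow_one] at h
        rw [hw, ← Finset.mul_prod_erase _ _ (Finset.mem_erase.2 ⟨hl, Finset.mem_univ l⟩),
          mul_right_comm, mul_comm _ (nu p (τ l) 0 m)]
        exact Ideal.mul_mem_right _ _ (h1 h)
    · rw [mul_zero]; exact Ideal.zero_mem _
    · intro a b _ _ ha hb
      rw [mul_add]; exact Ideal.add_mem _ ha hb
    · intro r a _ ha
      rw [smul_eq_mul, mul_left_comm]; exact Ideal.mul_mem_left _ _ ha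
  rw [← Ideal.mem_span_singleton]
  refine mem_of_forall_mem_sup_pow _ _ fun n => ?_
  obtain ⟨m, hnm, h⟩ := hf n
  obtain ⟨y, hy⟩ := hσ'.exists_normElt_sub_mem hσ hnm
  have h1 : normElt p σ' n m * f ∈ J p τ m ⊔ Ideal.span {T ^ k} := by
    have : normElt p σ' n m * f = (normElt p σ' n m - normElt p σ n m * y) * f +
      y * (normElt p σ n m * f) := by ring
    rw [this]
    exact Ideal.add_mem _ (Ideal.mem_sup_left (Ideal.mul_mem_right _ _ (hτ.omegaIdeal_le_J hσ m hy)))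
      (Ideal.mul_mem_left _ _ h)
  obtain ⟨x, hx, b, hb, e1⟩ := Submodule.mem_sup.1 h1
  obtain ⟨o, ho, b', hb', e2⟩ := Submodule.mem_sup.1 (hwJ m x hx)
  obtain ⟨z, rfl⟩ := Ideal.mem_span_singleton.1 hb'
  set N := ∏ l ∈ u, nu p (σ' l) n m with hN
  have hNN : normElt p σ' n m = nu p (τ i) n m * N := by
    rw [normElt, ← Finset.mul_prod_erase _ _ (Finset.mem_univ j), hj]
  have hset : ((u : Finset (Fin d)) : Set (Fin d)) = {l | l ≠ j} := by ext l; simp [hu]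
  -- Both the norm element and ν_{τ_i,0,m} contain the factor ν_{τ_i,n,m}, which is regular modulo Ω
  -- m and T^k and can be cancelled.
  have h2 : N * (w * f) - nu p (τ i) 0 n * z ∈ Ω m ⊔ Ideal.span {T ^ k} := by
    have := hσ'.nzdMod_nu j n m k
    rw [← hset, hj] at this
    refine this _ ?_
    have e3 : nu p (τ i) n m * (N * (w * f) - nu p (τ i) 0 n * z) = o + w * b := by
      rw [hNN] at e1
      linear_combination (-w) * e1 - e2 - z * nu_mul_nu p (τ i) (Nat.zero_le n) hnm
    rw [e3]
    exact Submodule.add_mem_sup ho (Ideal.mul_mem_left _ _ hb)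
  -- ν_{τ_i,0,n} and T^k involve only σ'_j, so the norm factors N in the other directions can be
  -- cancelled, lowering the level of Ω from m to n.
  have h3 := hσ'.mem_of_prod_nu_mul_mem {nu p (τ i) 0 n, T ^ k} u (by
      have hju : j ∈ {l | l ∉ u} := by simp [hu]
      rintro t (rfl | rfl)
      · rw [← hj]; exact nu_mem_adjoin σ' hju 0 n
      · exact Subalgebra.pow_mem _ (Algebra.subset_adjoin (Set.mem_image_of_mem _ hju)) k) hnm (w * f) (by
    rw [← hN, ← sub_add_cancel (N * (w * f)) (nu p (τ i) 0 n * z)]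
    refine Ideal.add_mem _ ((sup_le le_sup_right (le_sup_of_le_left (Ideal.span_mono ?_)) :
      Ω m ⊔ Ideal.span {T ^ k} ≤ _) h2)
      (Ideal.mem_sup_left (Ideal.mul_mem_right _ _ (Ideal.subset_span (Set.mem_insert _ _))))
    exact Set.singleton_subset_iff.2 (Set.mem_insert_of_mem _ rfl))
  refine (sup_le ?_ ?_ : _ ≤ Ideal.span {T ^ k} ⊔ maximalIdeal (Lam p Γ) ^ n) h3
  · rw [Ideal.span_le]
    rintro t (rfl | rfl)
    · exact Ideal.mem_sup_right (hσ.nu_mem_pow _ n)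
    · exact Ideal.mem_sup_left (Ideal.mem_span_singleton_self _)
  · refine le_trans ?_ ((hσ'.omegaIdeal_le_pow n).trans le_sup_right)
    rw [omegaIdeal_param]
    exact Ideal.span_mono (Set.image_subset_range _ _)

end Tight

end
end IwasawaTower

/-! ### The module `Ÿ` -/

namespace IwasawaTower

noncomputable section

open IsLocalRing IsIwasawaRing

/-- A height one prime of a UFD is principal. The auxiliary prime element ϖ serves only for the zero
ideal. -/
theorem exists_prime_le_span {R : Type*} [CommRing R] [IsDomain R] [UniqueFactorizationMonoid R]
    {ϖ : R} (hϖ : Prime ϖ) (P : Ideal R) [P.IsPrime] (hP : P.height ≤ 1) :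
    ∃ π, Prime π ∧ P ≤ Ideal.span {π} := by
  by_cases h : P = ⊥
  · exact ⟨ϖ, hϖ, h ▸ bot_le⟩
  · have h0 := mt Ideal.height_eq_zero_iff_eq_bot.1 h
    have h1 : P.height = 1 := le_antisymm hP (Order.one_le_iff_ne_zero.2 h0)
    obtain ⟨π, hπP, hπ⟩ := Ideal.IsPrime.exists_mem_prime_of_ne_bot ‹P.IsPrime› h
    exact ⟨π, hπ, (Ideal.eq_span_singleton_of_height_eq_one h1 hπP hπ).le⟩

variable {p : ℕ} [Fact p.Prime] {Γ : Type*} [CommGroup Γ] [TopologicalSpace Γ]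
  [IsTopologicalGroup Γ] {d c : ℕ} {σ : Fin d → Γ} {τ : Fin c → Γ}

theorem IsTight.pow_dvd (hσ : IsZpBasis p σ) (hτ : IsTight p τ) {π : Lam p Γ} (hπ : Prime π)
    (k : ℕ) (f : Lam p Γ)
    (hf : ∀ n, ∃ m, n ≤ m ∧ normElt p σ n m * f ∈ J p τ m ⊔ Ideal.span {π ^ k}) :
    π ^ k ∣ f := by
  by_cases h : ∃ i, π ∣ of p (τ i) - 1
  · obtain ⟨i, hi⟩ := h
    exact hτ.pow_dvd_of_dvd hσ hπ hi k f hf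
  · exact hσ.pow_dvd_of_forall_not_dvd hπ (not_exists.1 h) k f hf

variable (Y : Type*) [AddCommGroup Y] [Module (Lam p Γ) Y]

/-- The map from `Y` to the product of the `Y / J_n Y`. -/
def toLayers (p : ℕ) [Fact p.Prime] {Γ : Type*} [CommGroup Γ] [TopologicalSpace Γ] {c : ℕ}
    (τ : Fin c → Γ) (Y : Type*) [AddCommGroup Y] [Module (Lam p Γ) Y] :
    Y →ₗ[Lam p Γ] ∀ n, Layer p τ Y n :=
  LinearMap.pi fun n => (J p τ n • (⊤ : Submodule (Lam p Γ) Y)).mkQ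

/-- Because J_n lies in 𝔪^n and Y is complete, every compatible family in the layers comes from an
element of Y. -/
theorem ddot_le_range [Module.Finite (Lam p Γ) Y] (hσ : IsZpBasis p σ)
    (hJ : NormCompatible p σ τ) : ddot Y hJ ≤ LinearMap.range (toLayers p τ Y) := by
  intro x hx
  have hloc := hσ.isLocalRing
  have hnoeth := hσ.isIwasawaRing.noeth
  have hcomp := hσ.isIwasawaRing.isAdicComplete
  choose y hy using fun n => Submodule.Quotient.mk_surjective _ (x n)
  obtain ⟨z, hz⟩ := exists_of_compatible (fun n => J p τ n • (⊤ : Submodule (Lam p Γ) Y))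
    (fun n => Submodule.smul_mono_left (hσ.J_le_pow n)) y (fun n m h => by
      rw [← Submodule.Quotient.eq, hy, ← hx.2 n m h, ← hy m]
      rfl)
  refine ⟨z, funext fun n => ?_⟩
  rw [← hy n]
  exact ((Submodule.Quotient.eq _).2 (hz n)).symm

theorem finite_ddot [Module.Finite (Lam p Γ) Y] (hσ : IsZpBasis p σ)
    (hJ : NormCompatible p σ τ) : Module.Finite (Lam p Γ) (ddot Y hJ) := by
  have hnoeth := hσ.isIwasawaRing.noeth
  rw [Module.Finite.iff_fg, ← Submodule.map_comap_eq_of_le (ddot_le_range Y hσ hJ)]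
  exact (IsNoetherian.noetherian _).map _

theorem exists_normElt_smul_mem {hJ : NormCompatible p σ τ} {z : Y}
    (hz : toLayers p τ Y z ∈ ddot Y hJ) (n : ℕ) :
    ∃ m, n ≤ m ∧ normElt p σ n m • z ∈ J p τ m • (⊤ : Submodule (Lam p Γ) Y) := by
  obtain ⟨m, h, hm⟩ := hz.1 n
  exact ⟨m, h, (Submodule.Quotient.mk_eq_zero _).1 hm⟩

/-- An element of `Ÿ` is killed by an element prime to a given prime of `Λ_Γ`. -/
theorem IsTight.exists_smul_eq_zero [Module.Finite (Lam p Γ) Y] (hσ : IsZpBasis p σ)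
    (hτ : IsTight p τ) {hJ : NormCompatible p σ τ} {z : Y} (hz : toLayers p τ Y z ∈ ddot Y hJ)
    {π : Lam p Γ} (hπ : Prime π) : ∃ s, ¬ π ∣ s ∧ s • z = 0 := by
  have hdom := hσ.hasPrimeParams.isDomain
  have hnoeth := hσ.isIwasawaRing.noeth
  by_contra hcon
  push Not at hcon
  -- A z that no element prime to π kills is detected modulo some π^k. The divisibility theorem
  -- applied to a lift f of φ z contradicts this.
  obtain ⟨k, φ, hφ⟩ := exists_linearMap_quotient_pow_ne_zero hπ z hcon
  obtain ⟨f, hf⟩ := Ideal.Quotient.mk_surjective (φ z)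
  apply hφ
  rw [← hf, Ideal.Quotient.eq_zero_iff_mem, Ideal.mem_span_singleton]
  refine hτ.pow_dvd hσ hπ k f fun n => ?_
  obtain ⟨m, h, hm⟩ := exists_normElt_smul_mem Y hz n
  refine ⟨m, h, ?_⟩
  have key : ∀ y ∈ J p τ m • (⊤ : Submodule (Lam p Γ) Y), ∀ g : Lam p Γ,
      Ideal.Quotient.mk (Ideal.span {π ^ k}) g = φ y → g ∈ J p τ m ⊔ Ideal.span {π ^ k} := by
    intro y hy g hg
    have h1 : φ y ∈ (J p τ m).map (Ideal.Quotient.mk (Ideal.span {π ^ k})) := by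
      refine Submodule.smul_induction_on hy (fun r hr y _ => ?_) fun a b ha hb => ?_
      · rw [map_smul, Algebra.smul_def]
        exact Ideal.mul_mem_right _ _ (Ideal.mem_map_of_mem _ hr)
      · rw [map_add]; exact Ideal.add_mem _ ha hb
    rwa [← hg, ← Ideal.mem_comap, Ideal.comap_map_of_surjective' _ Ideal.Quotient.mk_surjective,
      Ideal.mk_ker] at h1
  refine key _ hm _ ?_
  rw [map_smul, ← hf, Algebra.smul_def, map_mul]
  rfl

theorem IsTight.isPseudoNull_ddot [Module.Finite (Lam p Γ) Y] (hσ : IsZpBasis p σ)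
    (hτ : IsTight p τ) (hJ : NormCompatible p σ τ) : IsPseudoNull (Lam p Γ) (ddot Y hJ) := by
  have hdom := hσ.hasPrimeParams.isDomain
  have hufd := hσ.uniqueFactorizationMonoid
  refine ⟨finite_ddot Y hσ hJ, fun P _ hP => ?_⟩
  rw [IsLocalizedModule.subsingleton_iff P.primeCompl (LocalizedModule.mkLinearMap _ _)]
  rintro ⟨x, hx⟩
  obtain ⟨z, rfl⟩ := ddot_le_range Y hσ hJ hx
  obtain ⟨π, hπ, hPπ⟩ := exists_prime_le_span hσ.prime_p P hP
  obtain ⟨s, hs, hsz⟩ := hτ.exists_smul_eq_zero Y hσ hx hπ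
  refine ⟨s, fun h => hs (Ideal.mem_span_singleton.1 (hPπ h)), Subtype.ext ?_⟩
  show s • toLayers p τ Y z = 0
  rw [← map_smul, hsz, map_zero]

end
end IwasawaTower

open IwasawaTower in
theorem propositionp (p : ℕ) [Fact p.Prime] {Γ : Type*} [CommGroup Γ] [TopologicalSpace Γ]
    [IsTopologicalGroup Γ] (d : ℕ) (hΓ : Nonempty (Γ ≃ₜ* Multiplicative (Fin d → ℤ_[p])))
    (σ : Fin d → Γ) (hσ : IsZpBasis p σ)
    (c : ℕ) (τ : Fin c → Γ) (hτ : IsTight p τ)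
    (Y : Type*) [AddCommGroup Y] [Module (Lam p Γ) Y] [Module.Finite (Lam p Γ) Y] :
    ∃ hJ : NormCompatible p σ τ, IsPseudoNull (Lam p Γ) (ddot Y hJ) :=
  ⟨hτ.normCompatible hσ, hτ.isPseudoNull_ddot Y hσ _⟩
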